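/- **Theorem.** Let $d\ge 1$ be an integer, $\mathbb T^d=\mathbb R^d/2\pi\mathbb Z^d$, let $s>d/2$ be an integer, $\nu>0$, $T>0$, $J_T=[0,T]$, and let $H^r=H^r(\mathbb T^d)$ be the Sobolev space of real-valued functions with norm $\|u\|_r^2=\sum_{k\in\mathbb Z^d}(1+|k|^2)^r|\hat u(k)|^2$. Let $h\in L^2(J_T,H^{s-1})$ and $f=P_p+g$, where $P_p$ is a real polynomial of degree $p\ge 2$ and $g:\mathbb R\to\mathbb R$ is a bounded $C^\infty$ function all of whose derivatives are bounded. Consider the equation $$\partial_t u-\nu\Delta u+f(u)=h(t,x)+\eta(t,x),\qquad (t,x)\in(0,T)\times\mathbb T^d .\tag{0.1}$$ For a subspace $\mathcal H\subset H^{s+2}$ let $$\mathcal C(\mathcal H)=\Big\{\eta-\sum_{m=1}^n\zeta_m^p:\ n\ge1,\ \eta,\zeta_1,\dots,\zeta_n\in\mathcal H\Big\},$$ and let $\mathcal F(\mathcal H)$ be the largest vector space contained in $H^{s+2}\cap\overline{\mathcal C(\mathcal H)}^{H^s}$, where the closure is taken in $H^s$. Put $\mathcal H_0=\mathcal H$ and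 $\mathcal H_j=\mathcal F(\mathcal H_{j-1})$ for $j\ge1$. The space $\mathcal H$ is called *saturating* if $\bigcup_{j\ge1}\mathcal H_j$ is dense in $H^s$. Assume that one of the following two conditions holds: (a) $g=0$; or (b) $p>s$. If $\mathcal H\subset H^{s+2}$ is a finite-dimensional saturating subspace, then (0.1) is approximately controllable by $\mathcal H$-valued control: for every $\varepsilon>0$ and all $u_0,u_1\in H^s$ there is a control $\eta\in L^2(J_T,\mathcal H)$ such that (0.1) with the initial condition $u(0)=u_0$ has a unique solution $u\in C(J_T,H^s)\cap L^2(J_T,H^{s+1})$, and this solution satisfies $\|u(T)-u_1\|_s<\varepsilon$. -/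

import Mathlib

open MeasureTheory Set Filter Topology
open scoped ENNReal ContDiff

noncomputable section

namespace TorusParabolic

/-! ### The torus and its Sobolev spaces

The torus `ℝ^d / 2πℤ^d` is parametrised by `x = 2πy`, `y ∈ (ℝ/ℤ)^d`, so a function on it is a
function on Mathlib's `UnitAddTorus (Fin d)`. In this parametrisation the exponential
`e^{i⟨k,x⟩}` is `UnitAddTorus.mFourier k`, and `-Δ`, taken in the variable `x`, multiplies the
`k`-th Fourier coefficient by `|k|² = k₁² + ⋯ + k_d²`. -/

/-- Normalised Lebesgue (Haar) measure on the torus. -/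
def torusMeasure (d : ℕ) : Measure (UnitAddTorus (Fin d)) :=
  Measure.pi fun _ => AddCircle.haarAddCircle

instance (d : ℕ) : IsProbabilityMeasure (torusMeasure d) := by
  unfold torusMeasure; infer_instance

/-- Real-valued `L²` on the torus. -/
abbrev L2 (d : ℕ) : Type := Lp ℝ 2 (torusMeasure d)

/-- `k`-th Fourier coefficient `(2π)^{-d} ∫ v(x) e^{-i⟨k,x⟩} dx` of a real function. -/
def fourierCoef {d : ℕ} (v : UnitAddTorus (Fin d) → ℝ) (k : Fin d → ℤ) : ℂ :=
  UnitAddTorus.mFourierCoeff (fun x => (v x : ℂ)) k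

/-- `|k|²` for a frequency `k`. -/
def freqSq {d : ℕ} (k : Fin d → ℤ) : ℝ := ∑ i, (k i : ℝ) ^ 2

lemma freqSq_nonneg {d : ℕ} (k : Fin d → ℤ) : 0 ≤ freqSq k :=
  Finset.sum_nonneg fun _ _ => sq_nonneg _

/-- All Fourier coefficients at once, as a real-linear map into `ℓ²(ℤ^d)`. -/
def coefSeq (d : ℕ) : L2 d →ₗ[ℝ] lp (fun _ : Fin d → ℤ => ℂ) 2 :=
  ((UnitAddTorus.mFourierBasis (d := Fin d)).repr.toLinearEquiv.toLinearMap.restrictScalars ℝ).comp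
    (Complex.ofRealCLM.compLpₗ (p := 2) (μ := torusMeasure d))

lemma coefSeq_apply {d : ℕ} (u : L2 d) (k : Fin d → ℤ) :
    (coefSeq d u : (Fin d → ℤ) → ℂ) k = fourierCoef u k := by
  refine (UnitAddTorus.mFourierBasis_repr
    (Complex.ofRealCLM.compLp u : Lp ℂ 2 (torusMeasure d)) k).trans ?_
  refine integral_congr_ae ?_
  have h2 := Complex.ofRealCLM.coeFn_compLp u
  filter_upwards [h2] with x hx
  exact congrArg (UnitAddTorus.mFourier (-k) x • ·) hx

lemma fourierCoef_add {d : ℕ} (u v : L2 d) (k : Fin d → ℤ) :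
    fourierCoef (u + v : L2 d) k = fourierCoef u k + fourierCoef v k := by
  simp only [← coefSeq_apply, map_add, lp.coeFn_add, Pi.add_apply]

lemma fourierCoef_smul {d : ℕ} (a : ℝ) (u : L2 d) (k : Fin d → ℤ) :
    fourierCoef (a • u : L2 d) k = a • fourierCoef u k := by
  simp only [← coefSeq_apply, map_smul, lp.coeFn_smul, Pi.smul_apply]

lemma coefSeq_injective (d : ℕ) : Function.Injective (coefSeq d) := by
  intro u v huv
  have h1 : (Complex.ofRealCLM.compLp u : Lp ℂ 2 (torusMeasure d)) = Complex.ofRealCLM.compLp v :=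
    (UnitAddTorus.mFourierBasis (d := Fin d)).repr.injective huv
  refine Lp.ext ?_
  filter_upwards [Complex.ofRealCLM.coeFn_compLp u, Complex.ofRealCLM.coeFn_compLp v] with x hu hv
  rw [h1, hv] at hu
  exact (Complex.ofReal_injective hu).symm

/-- The sequence `(1+|k|²)^{s/2} û(k)`, whose `ℓ²` norm is the `H^s` norm of `u`. -/
def weightedCoef {d : ℕ} (s : ℕ) (u : L2 d) (k : Fin d → ℤ) : ℂ :=
  Real.sqrt ((1 + freqSq k) ^ s) • fourierCoef u k

lemma weightedCoef_add {d : ℕ} (s : ℕ) (u v : L2 d) :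
    weightedCoef s (u + v) = weightedCoef s u + weightedCoef s v := by
  funext k
  simp only [weightedCoef, fourierCoef_add, smul_add, Pi.add_apply]

lemma weightedCoef_smul {d : ℕ} (s : ℕ) (a : ℝ) (u : L2 d) :
    weightedCoef s (a • u) = a • weightedCoef s u := by
  funext k
  simp only [weightedCoef, fourierCoef_smul, Pi.smul_apply]
  rw [smul_comm]

/-- `H^s` as a linear subspace of real `L²`: the `u` with `∑ (1+|k|²)^s |û(k)|² < ∞`. -/
def sobolevSubmodule (d s : ℕ) : Submodule ℝ (L2 d) where
  carrier := {u | Memℓp (weightedCoef s u) 2}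
  zero_mem' := by
    have : weightedCoef s (0 : L2 d) = 0 := by
      simpa using weightedCoef_smul s (0 : ℝ) (0 : L2 d)
    simp only [mem_ofPred_eq, this]
    exact zero_memℓp
  add_mem' {u v} hu hv := by
    simp only [mem_ofPred_eq] at hu hv ⊢
    rw [weightedCoef_add]
    exact hu.add hv
  smul_mem' a u hu := by
    simp only [mem_ofPred_eq] at hu ⊢
    rw [weightedCoef_smul]
    exact hu.const_smul a

/-- Membership in `H^s`, spelled out. -/
lemma mem_sobolevSubmodule {d s : ℕ} (u : L2 d) :
    u ∈ sobolevSubmodule d s ↔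
      Summable fun k : Fin d → ℤ => (1 + freqSq k) ^ s * ‖fourierCoef u k‖ ^ 2 := by
  have h0 : ∀ k : Fin d → ℤ, ‖weightedCoef s u k‖ ^ (2 : ℝ≥0∞).toReal
      = (1 + freqSq k) ^ s * ‖fourierCoef u k‖ ^ 2 := by
    intro k
    have : (0 : ℝ) ≤ (1 + freqSq k) ^ s := pow_nonneg (by linarith [freqSq_nonneg k]) s
    simp only [weightedCoef, norm_smul, ENNReal.toReal_ofNat, Real.rpow_ofNat, mul_pow,
      Real.norm_eq_abs, sq_abs, Real.sq_sqrt this]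
  change Memℓp (weightedCoef s u) 2 ↔ _
  rw [memℓp_gen_iff (by norm_num)]
  simp only [h0]

/-- The Sobolev space `H^s` of the torus (real-valued functions), as a type of its own so that it
carries the `H^s` norm and not the `L²` norm. -/
@[ext]
structure HSp (d s : ℕ) : Type where
  /-- the underlying function (class) -/
  val : L2 d
  mem : val ∈ sobolevSubmodule d s

namespace HSp

variable {d s : ℕ}

lemma val_injective : Function.Injective (HSp.val : HSp d s → L2 d) := fun _ _ h => HSp.ext h

instance : Zero (HSp d s) := ⟨⟨0, Submodule.zero_mem _⟩⟩
instance : Add (HSp d s) := ⟨fun u v => ⟨u.val + v.val, Submodule.add_mem _ u.mem v.mem⟩⟩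
instance : Neg (HSp d s) := ⟨fun u => ⟨-u.val, Submodule.neg_mem _ u.mem⟩⟩
instance : Sub (HSp d s) := ⟨fun u v => ⟨u.val - v.val, Submodule.sub_mem _ u.mem v.mem⟩⟩
instance : SMul ℝ (HSp d s) := ⟨fun a u => ⟨a • u.val, Submodule.smul_mem _ a u.mem⟩⟩
instance : SMul ℕ (HSp d s) := ⟨fun n u => ⟨n • u.val, nsmul_mem u.mem n⟩⟩
instance : SMul ℤ (HSp d s) := ⟨fun n u => ⟨n • u.val, zsmul_mem u.mem n⟩⟩

instance : AddCommGroup (HSp d s) :=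
  val_injective.addCommGroup _ rfl (fun _ _ => rfl) (fun _ => rfl) (fun _ _ => rfl)
    (fun _ _ => rfl) (fun _ _ => rfl)

instance : Module ℝ (HSp d s) :=
  val_injective.module ℝ { toFun := HSp.val, map_zero' := rfl, map_add' := fun _ _ => rfl }
    fun _ _ => rfl

/-- The underlying function (class), as a linear map. -/
def toL2 : HSp d s →ₗ[ℝ] L2 d where
  toFun := HSp.val
  map_add' _ _ := rfl
  map_smul' _ _ := rfl

end HSp

/-- The isometric identification of `H^s` with weighted `ℓ²` sequences. -/
def HSp.toSeq {d s : ℕ} : HSp d s →ₗ[ℝ] lp (fun _ : Fin d → ℤ => ℂ) 2 where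
  toFun u := ⟨weightedCoef s u.toL2, u.mem⟩
  map_add' u v := Subtype.ext (weightedCoef_add s u.toL2 v.toL2)
  map_smul' a u := Subtype.ext (weightedCoef_smul s a u.toL2)

lemma HSp.toSeq_injective {d s : ℕ} :
    Function.Injective (HSp.toSeq : HSp d s →ₗ[ℝ] lp (fun _ : Fin d → ℤ => ℂ) 2) := by
  intro u v huv
  apply HSp.ext
  apply coefSeq_injective d
  apply lp.ext
  funext k
  have h1 : weightedCoef s u.toL2 k = weightedCoef s v.toL2 k :=
    congrFun (congrArg Subtype.val huv) k
  have h2 : Real.sqrt ((1 + freqSq k) ^ s) ≠ 0 :=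
    (Real.sqrt_pos.2 (pow_pos (by linarith [freqSq_nonneg k]) s)).ne'
  have h3 := smul_right_injective ℂ h2 h1
  rw [coefSeq_apply, coefSeq_apply]
  exact h3

instance (d s : ℕ) : NormedAddCommGroup (HSp d s) :=
  NormedAddCommGroup.induced (HSp d s) (lp (fun _ : Fin d → ℤ => ℂ) 2) HSp.toSeq
    HSp.toSeq_injective

instance (d s : ℕ) : NormedSpace ℝ (HSp d s) :=
  NormedSpace.induced ℝ (HSp d s) (lp (fun _ : Fin d → ℤ => ℂ) 2) HSp.toSeq

/-- The norm on `H^s` is the usual one. -/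
lemma HSp.norm_sq {d s : ℕ} (u : HSp d s) :
    ‖u‖ ^ 2 = ∑' k : Fin d → ℤ, (1 + freqSq k) ^ s * ‖fourierCoef u.toL2 k‖ ^ 2 := by
  have h1 : ‖u‖ = ‖HSp.toSeq u‖ := rfl
  have h2 := lp.norm_rpow_eq_tsum (p := 2) (by norm_num) (HSp.toSeq u)
  simp only [ENNReal.toReal_ofNat, Real.rpow_ofNat] at h2
  rw [h1, h2]
  refine tsum_congr fun k => ?_
  have h3 : (0 : ℝ) ≤ (1 + freqSq k) ^ s := pow_nonneg (by linarith [freqSq_nonneg k]) s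
  change ‖weightedCoef s u.toL2 k‖ ^ 2 = _
  simp only [weightedCoef, norm_smul, mul_pow, Real.norm_eq_abs, sq_abs, Real.sq_sqrt h3]

lemma sobolevSubmodule_anti (d : ℕ) {s t : ℕ} (hst : s ≤ t) :
    sobolevSubmodule d t ≤ sobolevSubmodule d s := by
  intro u hu
  rw [mem_sobolevSubmodule] at hu ⊢
  refine Summable.of_nonneg_of_le (fun k => ?_) (fun k => ?_) hu
  · exact mul_nonneg (pow_nonneg (by linarith [freqSq_nonneg k]) s) (sq_nonneg _)
  · exact mul_le_mul_of_nonneg_right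
      (pow_le_pow_right₀ (by linarith [freqSq_nonneg k]) hst) (sq_nonneg _)

/-- The inclusion `H^t ⊆ H^s` for `s ≤ t`. -/
def HSp.incl {d s t : ℕ} (hst : s ≤ t) : HSp d t →ₗ[ℝ] HSp d s where
  toFun u := ⟨u.val, sobolevSubmodule_anti d hst u.mem⟩
  map_add' _ _ := rfl
  map_smul' _ _ := rfl

/-! ### Solutions and approximate controllability -/

/-- `u` is a solution in `C([0,T], H^s) ∩ L²([0,T], H^{s+1})` of
`∂ₜu - νΔu + f(u) = φ`, `u(0) = u₀`. The equation is tested against the exponentials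
`e^{i⟨k,x⟩}`, `k ∈ ℤ^d`, and integrated in time. -/
structure IsSolution {d s : ℕ} (ν T : ℝ) (f : ℝ → ℝ) (u₀ : HSp d s) (φ : ℝ → HSp d (s - 1))
    (u : ℝ → HSp d s) : Prop where
  continuousOn : ContinuousOn u (Icc 0 T)
  memL2 : ∃ v : ℝ → HSp d (s + 1), MemLp v 2 (volume.restrict (Icc 0 T)) ∧
    ∀ᵐ t ∂(volume.restrict (Icc 0 T)), HSp.incl (Nat.le_succ s) (v t) = u t
  initial : u 0 = u₀
  equation : ∀ k : Fin d → ℤ, ∀ t ∈ Icc 0 T,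
    fourierCoef (u t).toL2 k = fourierCoef u₀.toL2 k +
      ∫ τ in (0 : ℝ)..t,
        (-((ν * freqSq k : ℝ) : ℂ) * fourierCoef (u τ).toL2 k
          - fourierCoef (fun x => f ((u τ).toL2 x)) k
          + fourierCoef (φ τ).toL2 k)

/-- Approximate controllability on `[0,T]`, by `H`-valued control, of
`∂ₜu - νΔu + f(u) = h + η`: from every `u₀ ∈ H^s`, within any `ε > 0` of every `u₁ ∈ H^s`, with a
control `η ∈ L²([0,T], H)` for which the solution exists on the whole of `[0,T]` (and is unique). -/
def ApproxControllable {d s : ℕ} (ν T : ℝ) (f : ℝ → ℝ) (h : ℝ → HSp d (s - 1))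
    (H : Submodule ℝ (HSp d (s + 2))) : Prop :=
  ∀ ε : ℝ, 0 < ε → ∀ u₀ u₁ : HSp d s,
    ∃ η : ℝ → H, MemLp η 2 (volume.restrict (Icc 0 T)) ∧
      ∃ u : ℝ → HSp d s,
        IsSolution ν T f u₀ (fun t => h t + HSp.incl (by omega) (η t : HSp d (s + 2))) u ∧
        (∀ u' : ℝ → HSp d s,
          IsSolution ν T f u₀ (fun t => h t + HSp.incl (by omega) (η t : HSp d (s + 2))) u' →
            EqOn u' u (Icc 0 T)) ∧
        ‖u T - u₁‖ < ε

/-! ### Saturating subspaces -/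

/-- The cone of all `η - ∑_{m=1}^n ζ_m^p`, `n ≥ 1`, `η, ζ₁, …, ζ_n ∈ H`, as a subset of `H^s`. -/
def cone {d : ℕ} (s p : ℕ) (H : Submodule ℝ (HSp d (s + 2))) : Set (HSp d s) :=
  {w | ∃ n : ℕ, 1 ≤ n ∧ ∃ η ∈ H, ∃ ζ : Fin n → HSp d (s + 2), (∀ m, ζ m ∈ H) ∧
    ∀ᵐ x ∂(torusMeasure d), w.toL2 x = η.toL2 x - ∑ m, (ζ m).toL2 x ^ p}

/-- `H^{s+2} ∩ closure of the cone in H^s`, as a subset of `H^{s+2}`. -/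
def coneClosure {d : ℕ} (s p : ℕ) (H : Submodule ℝ (HSp d (s + 2))) : Set (HSp d (s + 2)) :=
  {v | HSp.incl (Nat.le_add_right s 2) v ∈ closure (cone s p H)}

/-- `𝓕(H)`: the largest vector space contained in `H^{s+2} ∩ closure of the cone in H^s`. -/
def nextSpace {d : ℕ} (s p : ℕ) (H : Submodule ℝ (HSp d (s + 2))) :
    Submodule ℝ (HSp d (s + 2)) :=
  sSup {W | (W : Set (HSp d (s + 2))) ⊆ coneClosure s p H}

lemma mem_coneClosure {d s p : ℕ} {H : Submodule ℝ (HSp d (s + 2))} {v : HSp d (s + 2)} :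
    v ∈ coneClosure s p H ↔ HSp.incl (Nat.le_add_right s 2) v ∈ closure (cone s p H) := Iff.rfl

lemma cone_add_mem {d s p : ℕ} {H : Submodule ℝ (HSp d (s + 2))} {v w : HSp d s}
    (hv : v ∈ cone s p H) (hw : w ∈ cone s p H) : v + w ∈ cone s p H := by
  obtain ⟨n, hn, η, hη, ζ, hζ, h⟩ := hv
  obtain ⟨n', hn', η', hη', ζ', hζ', h'⟩ := hw
  refine ⟨n + n', by omega, η + η', H.add_mem hη hη', Fin.append ζ ζ', ?_, ?_⟩
  · intro m
    refine Fin.addCases (fun i => ?_) (fun i => ?_) m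
    · simpa using hζ i
    · simpa using hζ' i
  · rw [map_add, map_add]
    filter_upwards [h, h', Lp.coeFn_add v.toL2 w.toL2, Lp.coeFn_add η.toL2 η'.toL2]
      with x h1 h2 h3 h4
    rw [h3, h4, Pi.add_apply, Pi.add_apply, h1, h2, Fin.sum_univ_add]
    simp only [Fin.append_left, Fin.append_right]
    ring

lemma coneClosure_add_mem {d s p : ℕ} {H : Submodule ℝ (HSp d (s + 2))} {v w : HSp d (s + 2)}
    (hv : v ∈ coneClosure s p H) (hw : w ∈ coneClosure s p H) : v + w ∈ coneClosure s p H := by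
  rw [mem_coneClosure] at hv hw ⊢
  rw [map_add]
  exact map_mem_closure₂ continuous_add hv hw fun _ ha _ hb => cone_add_mem ha hb

lemma bot_subset_coneClosure {d s p : ℕ} (hp : p ≠ 0) (H : Submodule ℝ (HSp d (s + 2))) :
    ((⊥ : Submodule ℝ (HSp d (s + 2))) : Set (HSp d (s + 2))) ⊆ coneClosure s p H := by
  intro v hv
  obtain rfl : v = 0 := by simpa using hv
  rw [mem_coneClosure, map_zero]
  refine subset_closure ⟨1, le_rfl, 0, H.zero_mem, fun _ => 0, fun _ => H.zero_mem, ?_⟩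
  rw [map_zero, map_zero]
  exact ae_of_all _ fun x => by simp [hp]

/-- The largest vector space in the definition of `𝓕(H)` exists, and `nextSpace` is it. -/
lemma nextSpace_isGreatest {d s p : ℕ} (hp : p ≠ 0) (H : Submodule ℝ (HSp d (s + 2))) :
    IsGreatest {W : Submodule ℝ (HSp d (s + 2)) | (W : Set (HSp d (s + 2))) ⊆ coneClosure s p H}
      (nextSpace s p H) := by
  refine ⟨?_, fun W hW => le_sSup hW⟩
  intro v hv
  have hv' : v ∈ sSup {W : Submodule ℝ (HSp d (s + 2)) |
    (W : Set (HSp d (s + 2))) ⊆ coneClosure s p H} := hv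
  rw [sSup_eq_iSup'] at hv'
  refine Submodule.iSup_induction _ (motive := fun v => v ∈ coneClosure s p H) hv'
    (fun W x hx => W.2 hx) ?_ (fun x y hx hy => coneClosure_add_mem hx hy)
  exact bot_subset_coneClosure hp H (Submodule.zero_mem _)

/-- `H₀ = H`, `H_j = 𝓕(H_{j-1})`. -/
def iterSpace {d : ℕ} (s p : ℕ) (H : Submodule ℝ (HSp d (s + 2))) :
    ℕ → Submodule ℝ (HSp d (s + 2))
  | 0 => H
  | j + 1 => nextSpace s p (iterSpace s p H j)

/-- `H` is saturating: `⋃_{j ≥ 1} H_j` is dense in `H^s`. -/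
def Saturating {d : ℕ} (s p : ℕ) (H : Submodule ℝ (HSp d (s + 2))) : Prop :=
  Dense (⋃ j : ℕ, HSp.incl (Nat.le_add_right s 2) '' (iterSpace s p H (j + 1) : Set (HSp d (s + 2))))

end TorusParabolic

end

/-!
The proof uses controls that are constant on finitely many time intervals and, on most of them,
very large. Write `A` for the leading coefficient of `P` and `p = q + 1`.

*Impulses.* Let the initial state be `v + lam ζ` and let the control `lam^p η` act for time
`lam^{-p}`. In the time variable `θ = lam^p t ∈ [0, 1]` the only terms of the equation that survive
as `lam → ∞` are `η` and the leading part `A (lam ζ)^p` of `f`, so the solution is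
`lam ζ + v + θ (η - A ζ^p) + o(1)` in `H^s` (`HasLeadingPart.exists_impulse_response`). What has to
be checked is that on a ball about `lam ζ` the difference between `f(u)` and `A (lam ζ)^p` is
`O(lam^{p-1})` in `H^s`. For polynomials this follows from the algebra property of `H^s`
(`Growth.polynomial`). For bounded smooth `g`, the `H^s` norm of `g(u)` is `O(lam^s)`
(`Growth.bddSmooth`), which is where `s < p` enters. Existence on the short time interval is a
contraction argument in `C([a,b], L²)`, on curves in an `H^s` ball (`exists_mild_nonlinear`). The
Duhamel formula is used frequency by frequency, so no semigroup theory is needed.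

*Displacements.* Call `w ∈ H^s` available (`Shiftable`) if from every state `v`, at every time, some
control leads arbitrarily close to `v + w` in arbitrarily short time. Available displacements are
closed under sums and under limits in `H^s`. Elements of `H` are available (impulses with `ζ = 0`).
If all multiples of `ζ` are available then so is `-A ζ^p`: move by `lam ζ`, wait for time `lam^{-p}`
without control, move by `-lam ζ` (`Admissible.shiftable_pow`). So if a space `V` is available, then
so are `A` times the cone over `V` and its closure, and hence the space `𝓕(V)`; multiplication by
`A ≠ 0`, of either sign, preserves a vector space (`Admissible.shiftable_iterSpace`). Since `H` is
saturating, every element of `H^s` is available.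

*The final time.* Near the target the equation without control moves the state only little during
a fixed positive time (`Admissible.exists_coasting`). Displacements to the target and such waiting
periods alternate until time `T` is hit exactly (`Admissible.exists_steers_near`). Uniqueness is
Grönwall's inequality in `L²` (`SolvesOn.eqOn`).
-/

noncomputable section

namespace TorusParabolic

/-! ### Weighted sequence spaces -/

section Sequences

/-- Cauchy–Schwarz in `ℝ≥0∞`. -/
lemma lintegral_mul_sq_le {α : Type*} [MeasurableSpace α] {μ : Measure α} {f g : α → ℝ≥0∞}
    (hf : AEMeasurable f μ) (hg : AEMeasurable g μ) :
    (∫⁻ x, f x * g x ∂μ) ^ 2 ≤ (∫⁻ x, f x ^ 2 ∂μ) * ∫⁻ x, g x ^ 2 ∂μ := by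
  have h := ENNReal.lintegral_mul_le_Lp_mul_Lq μ Real.HolderConjugate.two_two hf hg
  simp only [Pi.mul_apply, ENNReal.rpow_ofNat] at h
  calc (∫⁻ x, f x * g x ∂μ) ^ 2
      ≤ ((∫⁻ x, f x ^ 2 ∂μ) ^ (1 / (2 : ℝ)) * (∫⁻ x, g x ^ 2 ∂μ) ^ (1 / (2 : ℝ))) ^ 2 := by
        gcongr
    _ = _ := by
        rw [mul_pow, ← ENNReal.rpow_natCast, ← ENNReal.rpow_natCast, ← ENNReal.rpow_mul,
          ← ENNReal.rpow_mul]
        norm_num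

lemma tsum_mul_sq_le {ι : Type*} (f g : ι → ℝ≥0∞) :
    (∑' i, f i * g i) ^ 2 ≤ (∑' i, f i ^ 2) * ∑' i, g i ^ 2 := by
  let _ : MeasurableSpace ι := ⊤
  have h := lintegral_mul_sq_le (μ := Measure.count) (f := f) (g := g)
    measurable_from_top.aemeasurable measurable_from_top.aemeasurable
  simpa only [lintegral_count] using h

lemma ennreal_add_sq_le (a b : ℝ≥0∞) : (a + b) ^ 2 ≤ 2 * a ^ 2 + 2 * b ^ 2 := by
  have h := ENNReal.rpow_add_le_mul_rpow_add_rpow a b (p := 2) (by norm_num)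
  norm_num at h
  rwa [mul_add] at h

variable {d : ℕ}

/-- The weight `1 + |k|²`. -/
def wt (k : Fin d → ℤ) : ℝ := 1 + freqSq k

lemma one_le_wt (k : Fin d → ℤ) : 1 ≤ wt k := by
  have := freqSq_nonneg k
  unfold wt; linarith

lemma wt_pos (k : Fin d → ℤ) : 0 < wt k := one_pos.trans_le (one_le_wt k)

lemma freqSq_neg (k : Fin d → ℤ) : freqSq (-k) = freqSq k := by
  simp [freqSq]

lemma wt_le_add (k j : Fin d → ℤ) : wt k ≤ 2 * (wt j + wt (k - j)) := by
  have : freqSq k ≤ 2 * (freqSq j + freqSq (k - j)) := by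
    unfold freqSq
    rw [← Finset.sum_add_distrib, Finset.mul_sum]
    refine Finset.sum_le_sum fun i _ => ?_
    have : (k i : ℝ) = j i + (k - j) i := by simp
    rw [this]
    nlinarith [sq_nonneg ((j i : ℝ) - (k - j) i)]
  unfold wt; linarith

lemma wt_rpow_le_add {c : ℝ} (hc : 0 ≤ c) (k j : Fin d → ℤ) :
    wt k ^ c ≤ 4 ^ c * (wt j ^ c + wt (k - j) ^ c) := by
  have h0 : 0 < wt k := wt_pos k
  have hj := wt_pos j
  have hkj := wt_pos (k - j)
  have h1 : wt k ≤ 4 * max (wt j) (wt (k - j)) := by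
    have := wt_le_add k j
    have h2 := le_max_left (wt j) (wt (k - j))
    have h3 := le_max_right (wt j) (wt (k - j))
    linarith
  calc wt k ^ c ≤ (4 * max (wt j) (wt (k - j))) ^ c := by gcongr
    _ = 4 ^ c * (max (wt j) (wt (k - j))) ^ c :=
        Real.mul_rpow (by norm_num) (hj.le.trans (le_max_left _ _))
    _ ≤ _ := by
        gcongr
        rcases le_total (wt j) (wt (k - j)) with h | h
        · rw [max_eq_right h]
          linarith [Real.rpow_nonneg hj.le c]
        · rw [max_eq_left h]
          linarith [Real.rpow_nonneg hkj.le c]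

/-- The lattice sum `∑ (1+|k|²)^{-γ}` converges for `γ > d/2`: since `1 + |k|² ≥ 1 + kᵢ²` for each
`i`, it is dominated by a product of one-dimensional sums. -/
lemma summable_wt_rpow {γ : ℝ} (hγ : (d : ℝ) / 2 < γ) :
    Summable fun k : Fin d → ℤ => wt k ^ (-γ) := by
  have hγ0 : 0 < γ := lt_of_le_of_lt (by positivity) hγ
  set F : ℤ → ℝ := fun n => (1 + (n : ℝ) ^ 2) ^ (-(γ / d)) with hF
  have hF0 : ∀ n, 0 ≤ F n := fun n => by positivity
  have hle : ∀ k : Fin d → ℤ, wt k ^ (-γ) ≤ ∏ i, F (k i) := by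
    intro k
    rcases Nat.eq_zero_or_pos d with rfl | hd
    · simp [wt, freqSq]
    have hd' : (0 : ℝ) < d := by exact_mod_cast hd
    calc wt k ^ (-γ) = ∏ _i : Fin d, wt k ^ (-(γ / d)) := by
          rw [Finset.prod_const, Finset.card_univ, Fintype.card_fin, ← Real.rpow_natCast,
            ← Real.rpow_mul (wt_pos k).le]
          congr 1
          field_simp
      _ ≤ ∏ i, F (k i) := by
          refine Finset.prod_le_prod (fun _ _ => Real.rpow_nonneg (wt_pos k).le _) fun i _ => ?_
          refine Real.rpow_le_rpow_of_nonpos (by positivity) ?_ (by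
            have : 0 ≤ γ / d := by positivity
            linarith)
          have := Finset.single_le_sum (f := fun i => (k i : ℝ) ^ 2)
            (fun i _ => sq_nonneg _) (Finset.mem_univ i)
          unfold wt freqSq
          simpa using this
  rcases Nat.eq_zero_or_pos d with rfl | hd
  · exact Summable.of_finite
  have hd' : (0 : ℝ) < d := by exact_mod_cast hd
  have hFs : Summable F := by
    have h1 : 1 < 2 * (γ / d) := by
      rw [mul_div_assoc', lt_div_iff₀ hd']; linarith
    refine Summable.of_nonneg_of_le hF0 (fun n => ?_)
      ((Real.summable_abs_int_rpow h1).add (summable_of_hasFiniteSupport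
        (f := fun n : ℤ => if n = 0 then (1 : ℝ) else 0)
        ((Set.finite_singleton 0).subset fun n hn => by simpa using hn)))
    rcases eq_or_ne n 0 with rfl | hn
    · have : (0 : ℝ) ≤ |((0 : ℤ) : ℝ)| ^ (-(2 * (γ / d))) := by positivity
      have h2 : F 0 = 1 := by simp [hF]
      rw [h2, if_pos rfl]
      linarith
    · rw [if_neg hn, add_zero, ← mul_neg, Real.rpow_mul (abs_nonneg _)]
      have hn' : 0 < |(n : ℝ)| := abs_pos.2 (by exact_mod_cast hn)
      refine Real.rpow_le_rpow_of_nonpos (by positivity) ?_ (by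
            have : 0 ≤ γ / d := by positivity
            linarith)
      rw [Real.rpow_two, sq_abs]
      linarith
  refine summable_of_sum_le (c := ∏ _i : Fin d, ∑' n, F n)
    (fun k => Real.rpow_nonneg (wt_pos k).le _) fun A => ?_
  classical
  calc ∑ k ∈ A, wt k ^ (-γ) ≤ ∑ k ∈ A, ∏ i, F (k i) := Finset.sum_le_sum fun k _ => hle k
    _ ≤ ∑ k ∈ Fintype.piFinset fun i => A.image fun k => k i, ∏ i, F (k i) :=
        Finset.sum_le_sum_of_subset_of_nonneg
          (fun k hk => Fintype.mem_piFinset.2 fun i => Finset.mem_image_of_mem _ hk)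
          fun _ _ _ => Finset.prod_nonneg fun _ _ => hF0 _
    _ = ∏ i, ∑ n ∈ A.image fun k => k i, F n := (Finset.prod_univ_sum _ _).symm
    _ ≤ _ := Finset.prod_le_prod (fun _ _ => Finset.sum_nonneg fun _ _ => hF0 _)
        fun i _ => hFs.sum_le_tsum _ fun _ _ => hF0 _

/-- `∑ (1+|k|²)^σ |c k|²`, the square of the `H^σ` norm in terms of Fourier coefficients. -/
def seqE (σ : ℝ) (c : (Fin d → ℤ) → ℂ) : ℝ≥0∞ :=
  ∑' k, ENNReal.ofReal (wt k ^ σ) * ‖c k‖ₑ ^ 2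

lemma seqE_mono_of_le {σ : ℝ} {c c' : (Fin d → ℤ) → ℂ} (h : ∀ k, ‖c k‖ ≤ ‖c' k‖) :
    seqE σ c ≤ seqE σ c' := by
  refine ENNReal.tsum_le_tsum fun k => ?_
  gcongr
  exact enorm_le_iff_norm_le.2 (h k)

lemma seqE_mono {σ τ : ℝ} (h : σ ≤ τ) (c : (Fin d → ℤ) → ℂ) : seqE σ c ≤ seqE τ c := by
  refine ENNReal.tsum_le_tsum fun k => ?_
  gcongr
  exact one_le_wt k

lemma seqE_add_le (σ : ℝ) (c c' : (Fin d → ℤ) → ℂ) :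
    seqE σ (c + c') ≤ 2 * seqE σ c + 2 * seqE σ c' := by
  unfold seqE
  rw [← ENNReal.tsum_mul_left, ← ENNReal.tsum_mul_left, ← ENNReal.tsum_add]
  refine ENNReal.tsum_le_tsum fun k => ?_
  calc ENNReal.ofReal (wt k ^ σ) * ‖(c + c') k‖ₑ ^ 2
      ≤ ENNReal.ofReal (wt k ^ σ) * (2 * ‖c k‖ₑ ^ 2 + 2 * ‖c' k‖ₑ ^ 2) := by
        gcongr
        exact (pow_le_pow_left₀ zero_le (enorm_add_le _ _) 2).trans (ennreal_add_sq_le _ _)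
    _ = _ := by ring

lemma seqE_smul (σ a : ℝ) (c : (Fin d → ℤ) → ℂ) :
    seqE σ (a • c) = ENNReal.ofReal (a ^ 2) * seqE σ c := by
  unfold seqE
  rw [← ENNReal.tsum_mul_left]
  refine tsum_congr fun k => ?_
  rw [Pi.smul_apply, enorm_smul, mul_pow, ← sq_abs a, ENNReal.ofReal_pow (abs_nonneg a),
    ← Real.enorm_eq_ofReal_abs]
  ring

lemma seqE_neg (σ : ℝ) (c : (Fin d → ℤ) → ℂ) : seqE σ (-c) = seqE σ c := by
  simp [seqE]

/-- Young's inequality `ℓ¹ * ℓ² ⊆ ℓ²` on `ℤ^d`. -/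
lemma tsum_conv_sq_le (A B : (Fin d → ℤ) → ℝ≥0∞) :
    ∑' k, (∑' j, A j * B (k - j)) ^ 2 ≤ (∑' j, A j) ^ 2 * ∑' j, B j ^ 2 := by
  have h1 : ∀ k, (∑' j, A j * B (k - j)) ^ 2 ≤ (∑' j, A j) * ∑' j, A j * B (k - j) ^ 2 := by
    intro k
    have h := tsum_mul_sq_le (fun j => A j ^ (1 / 2 : ℝ)) fun j => A j ^ (1 / 2 : ℝ) * B (k - j)
    have h2 : ∀ x : ℝ≥0∞, x ^ (1 / 2 : ℝ) * x ^ (1 / 2 : ℝ) = x := fun x => by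
      rw [← ENNReal.rpow_add_of_nonneg _ _ (by norm_num) (by norm_num)]; norm_num
    simp only [← mul_assoc, mul_pow, h2] at h
    simpa only [sq, h2] using h
  calc ∑' k, (∑' j, A j * B (k - j)) ^ 2
      ≤ ∑' k, (∑' j, A j) * ∑' j, A j * B (k - j) ^ 2 := ENNReal.tsum_le_tsum h1
    _ = (∑' j, A j) * ∑' j, A j * ∑' k, B (k - j) ^ 2 := by
        rw [ENNReal.tsum_mul_left, ENNReal.tsum_comm]
        simp only [ENNReal.tsum_mul_left]
    _ = (∑' j, A j) * ∑' j, A j * ∑' k, B k ^ 2 := by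
        congr 2
        funext j
        rw [← (Equiv.subRight j).tsum_eq fun k => B k ^ 2]
        rfl
    _ = _ := by rw [ENNReal.tsum_mul_right]; ring

lemma tsum_weight_mul_sq_le (γ : ℝ) (V : (Fin d → ℤ) → ℝ≥0∞) :
    (∑' k, ENNReal.ofReal (wt k ^ (-γ / 2)) * V k) ^ 2 ≤
      (∑' k : Fin d → ℤ, ENNReal.ofReal (wt k ^ (-γ))) * ∑' k, V k ^ 2 := by
  refine (tsum_mul_sq_le _ _).trans (le_of_eq ?_)
  congr 2
  funext k
  rw [← ENNReal.ofReal_pow (Real.rpow_nonneg (wt_pos k).le _), ← Real.rpow_natCast,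
    ← Real.rpow_mul (wt_pos k).le]
  norm_num

/-- A convergent lattice sum as an extended real. -/
def latticeSum (d : ℕ) (γ : ℝ) : ℝ≥0∞ := ∑' k : Fin d → ℤ, ENNReal.ofReal (wt k ^ (-γ))

lemma latticeSum_ne_top {γ : ℝ} (hγ : (d : ℝ) / 2 < γ) : latticeSum d γ ≠ ⊤ :=
  (summable_wt_rpow hγ).tsum_ofReal_ne_top

/-- `ℓ¹` bound by the weighted `ℓ²` norm: the Sobolev embedding in terms of coefficients. -/
lemma tsum_enorm_sq_le (γ : ℝ) (c : (Fin d → ℤ) → ℂ) :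
    (∑' k, ‖c k‖ₑ) ^ 2 ≤ latticeSum d γ * seqE γ c := by
  have h := tsum_weight_mul_sq_le γ fun k => ENNReal.ofReal (wt k ^ (γ / 2)) * ‖c k‖ₑ
  have e1 : ∀ k : Fin d → ℤ, ENNReal.ofReal (wt k ^ (-γ / 2)) *
      (ENNReal.ofReal (wt k ^ (γ / 2)) * ‖c k‖ₑ) = ‖c k‖ₑ := fun k => by
    rw [← mul_assoc, ← ENNReal.ofReal_mul (Real.rpow_nonneg (wt_pos k).le _),
      ← Real.rpow_add (wt_pos k)]
    ring_nf
    simp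
  have e2 : ∀ k : Fin d → ℤ, (ENNReal.ofReal (wt k ^ (γ / 2)) * ‖c k‖ₑ) ^ 2 =
      ENNReal.ofReal (wt k ^ γ) * ‖c k‖ₑ ^ 2 := fun k => by
    rw [mul_pow, ← ENNReal.ofReal_pow (Real.rpow_nonneg (wt_pos k).le _), ← Real.rpow_natCast,
      ← Real.rpow_mul (wt_pos k).le]
    norm_num
  simp only [e1, e2] at h
  exact h

/-- The weights in the product estimate: at least one of the frequencies `j` and `k - j` is
comparable to `k`, and the smaller one absorbs the excess `a + b - c`. -/
lemma weight_split {a b c : ℝ} (hc : 0 ≤ c) (hca : c ≤ a) (hcb : c ≤ b) (k j : Fin d → ℤ) :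
    wt k ^ (c / 2) ≤ 2 * 4 ^ (c / 2) * ((wt j ^ (-(a + b - c) / 2) +
      wt (k - j) ^ (-(a + b - c) / 2)) * (wt j ^ (a / 2) * wt (k - j) ^ (b / 2))) := by
  -- `x^{-α} y^{-β} ≤ x^{-α-β} + y^{-α-β}` for `x, y > 0` and `α, β ≥ 0`
  have key : ∀ {x y α β : ℝ}, 0 < x → 0 < y → 0 ≤ α → 0 ≤ β →
      x ^ (-α) * y ^ (-β) ≤ x ^ (-(α + β)) + y ^ (-(α + β)) := by
    intro x y α β hx hy hα hβ
    rcases le_total x y with h | h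
    · calc x ^ (-α) * y ^ (-β) ≤ x ^ (-α) * x ^ (-β) := by
            gcongr 1
            exact Real.rpow_le_rpow_of_nonpos hx h (by linarith)
        _ = x ^ (-(α + β)) := by rw [← Real.rpow_add hx]; ring_nf
        _ ≤ _ := by linarith [Real.rpow_nonneg hy.le (-(α + β))]
    · calc x ^ (-α) * y ^ (-β) ≤ y ^ (-α) * y ^ (-β) := by
            gcongr 1
            exact Real.rpow_le_rpow_of_nonpos hy h (by linarith)
        _ = y ^ (-(α + β)) := by rw [← Real.rpow_add hy]; ring_nf
        _ ≤ _ := by linarith [Real.rpow_nonneg hx.le (-(α + β))]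
  have hx := wt_pos j
  have hy := wt_pos (k - j)
  have h1 := wt_rpow_le_add (c := c / 2) (by linarith) k j
  have k1 := key (x := wt j) (y := wt (k - j)) (α := (a - c) / 2) (β := b / 2) hx hy (by linarith)
    (by linarith)
  have k2 := key (x := wt j) (y := wt (k - j)) (α := a / 2) (β := (b - c) / 2) hx hy (by linarith)
    (by linarith)
  have e1 : wt j ^ (c / 2) = (wt j ^ (-((a - c) / 2)) * wt (k - j) ^ (-(b / 2))) *
      (wt j ^ (a / 2) * wt (k - j) ^ (b / 2)) := by
    rw [mul_mul_mul_comm, ← Real.rpow_add hx, ← Real.rpow_add hy]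
    ring_nf
    simp
  have e2 : wt (k - j) ^ (c / 2) = (wt j ^ (-(a / 2)) * wt (k - j) ^ (-((b - c) / 2))) *
      (wt j ^ (a / 2) * wt (k - j) ^ (b / 2)) := by
    rw [mul_mul_mul_comm, ← Real.rpow_add hx, ← Real.rpow_add hy]
    ring_nf
    simp
  have s1 : -((a - c) / 2 + b / 2) = -(a + b - c) / 2 := by ring
  have s2 : -(a / 2 + (b - c) / 2) = -(a + b - c) / 2 := by ring
  rw [s1] at k1
  rw [s2] at k2
  have hpos : 0 ≤ wt j ^ (a / 2) * wt (k - j) ^ (b / 2) := by positivity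
  have h4 : (0 : ℝ) ≤ 4 ^ (c / 2) := by positivity
  calc wt k ^ (c / 2) ≤ 4 ^ (c / 2) * (wt j ^ (c / 2) + wt (k - j) ^ (c / 2)) := h1
    _ ≤ 4 ^ (c / 2) * ((wt j ^ (-(a + b - c) / 2) +
      wt (k - j) ^ (-(a + b - c) / 2)) * (wt j ^ (a / 2) * wt (k - j) ^ (b / 2)) +
      (wt j ^ (-(a + b - c) / 2) +
      wt (k - j) ^ (-(a + b - c) / 2)) * (wt j ^ (a / 2) * wt (k - j) ^ (b / 2))) := by
        refine mul_le_mul_of_nonneg_left (add_le_add ?_ ?_) h4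
        · rw [e1]; exact mul_le_mul_of_nonneg_right k1 hpos
        · rw [e2]; exact mul_le_mul_of_nonneg_right k2 hpos
    _ = _ := by ring

/-- The product estimate `‖v w‖_c ≤ C ‖v‖_a ‖w‖_b` for `0 ≤ c ≤ min a b`, `a + b - c > d/2`, in
terms of Fourier coefficients: the frequency `k` is shared between `j` and `k - j`, and the surplus
`a + b - c` of derivatives is spent on putting one of the factors into `ℓ¹`. -/
lemma tsum_weight_conv_sq_le {a b c : ℝ} (hc : 0 ≤ c) (hca : c ≤ a) (hcb : c ≤ b)
    (A B : (Fin d → ℤ) → ℝ≥0∞) :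
    ∑' k, ENNReal.ofReal (wt k ^ c) * (∑' j, A j * B (k - j)) ^ 2 ≤
      ENNReal.ofReal (16 * 4 ^ c) * latticeSum d (a + b - c) *
        ((∑' k, ENNReal.ofReal (wt k ^ a) * A k ^ 2) *
          ∑' k, ENNReal.ofReal (wt k ^ b) * B k ^ 2) := by
  set γ := a + b - c with hγ
  set V : (Fin d → ℤ) → ℝ≥0∞ := fun k => ENNReal.ofReal (wt k ^ (a / 2)) * A k with hV
  set W : (Fin d → ℤ) → ℝ≥0∞ := fun k => ENNReal.ofReal (wt k ^ (b / 2)) * B k with hW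
  set m : (Fin d → ℤ) → ℝ≥0∞ := fun k => ENNReal.ofReal (wt k ^ (-γ / 2)) with hm
  have sq_w : ∀ (t : ℝ) (k : Fin d → ℤ),
      ENNReal.ofReal (wt k ^ (t / 2)) ^ 2 = ENNReal.ofReal (wt k ^ t) := fun t k => by
    rw [← ENNReal.ofReal_pow (Real.rpow_nonneg (wt_pos k).le _), ← Real.rpow_natCast,
      ← Real.rpow_mul (wt_pos k).le]
    norm_num
  have hVs : ∑' k, V k ^ 2 = ∑' k, ENNReal.ofReal (wt k ^ a) * A k ^ 2 := by
    simp only [hV, mul_pow, sq_w]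
  have hWs : ∑' k, W k ^ 2 = ∑' k, ENNReal.ofReal (wt k ^ b) * B k ^ 2 := by
    simp only [hW, mul_pow, sq_w]
  set K : ℝ≥0∞ := ENNReal.ofReal (2 * 4 ^ (c / 2)) with hK
  have h1 : ∀ k, ENNReal.ofReal (wt k ^ (c / 2)) * (∑' j, A j * B (k - j)) ≤
      K * (∑' j, (m j * V j) * W (k - j) + ∑' j, (m j * W j) * V (k - j)) := by
    intro k
    have h2 : ∑' j, (m j * W j) * V (k - j) = ∑' j, (m (k - j) * W (k - j)) * V j := by
      rw [← (Equiv.subLeft k).tsum_eq fun j => (m j * W j) * V (k - j)]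
      simp
    rw [h2, ← ENNReal.tsum_add, ← ENNReal.tsum_mul_left, ← ENNReal.tsum_mul_left]
    refine ENNReal.tsum_le_tsum fun j => ?_
    have h3 := ENNReal.ofReal_le_ofReal (weight_split hc hca hcb k j)
    have p1 := wt_pos j
    have p2 := wt_pos (k - j)
    rw [ENNReal.ofReal_mul (by positivity : (0 : ℝ) ≤ 2 * 4 ^ (c / 2)),
      ENNReal.ofReal_mul (q := wt j ^ (a / 2) * wt (k - j) ^ (b / 2)) (by positivity),
      ENNReal.ofReal_add (by positivity) (by positivity),
      ENNReal.ofReal_mul (q := wt (k - j) ^ (b / 2)) (by positivity)] at h3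
    calc ENNReal.ofReal (wt k ^ (c / 2)) * (A j * B (k - j))
        ≤ (K * ((m j + m (k - j)) * (ENNReal.ofReal (wt j ^ (a / 2)) *
            ENNReal.ofReal (wt (k - j) ^ (b / 2))))) * (A j * B (k - j)) := by
          gcongr
      _ = _ := by simp only [hV, hW]; ring
  have h5 : ∀ U U' : (Fin d → ℤ) → ℝ≥0∞, ∑' k, (∑' j, (m j * U j) * U' (k - j)) ^ 2 ≤
      latticeSum d γ * ((∑' k, U k ^ 2) * ∑' k, U' k ^ 2) := by
    intro U U'
    refine (tsum_conv_sq_le (fun j => m j * U j) U').trans ?_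
    rw [← mul_assoc]
    gcongr
    exact tsum_weight_mul_sq_le γ U
  calc ∑' k, ENNReal.ofReal (wt k ^ c) * (∑' j, A j * B (k - j)) ^ 2
      = ∑' k, (ENNReal.ofReal (wt k ^ (c / 2)) * (∑' j, A j * B (k - j))) ^ 2 := by
        simp only [mul_pow, sq_w]
    _ ≤ ∑' k, (K * (∑' j, (m j * V j) * W (k - j) + ∑' j, (m j * W j) * V (k - j))) ^ 2 :=
        ENNReal.tsum_le_tsum fun k => pow_le_pow_left₀ zero_le (h1 k) 2
    _ ≤ ∑' k, K ^ 2 * (2 * (∑' j, (m j * V j) * W (k - j)) ^ 2 +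
          2 * (∑' j, (m j * W j) * V (k - j)) ^ 2) := by
        refine ENNReal.tsum_le_tsum fun k => ?_
        rw [mul_pow]
        gcongr
        exact ennreal_add_sq_le _ _
    _ ≤ K ^ 2 * (2 * (latticeSum d γ * ((∑' k, V k ^ 2) * ∑' k, W k ^ 2)) +
          2 * (latticeSum d γ * ((∑' k, W k ^ 2) * ∑' k, V k ^ 2))) := by
        rw [ENNReal.tsum_mul_left, ENNReal.tsum_add, ENNReal.tsum_mul_left, ENNReal.tsum_mul_left]
        gcongr
        · exact h5 V W
        · exact h5 W V
    _ = _ := by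
        rw [← hVs, ← hWs]
        have : ENNReal.ofReal (16 * 4 ^ c) = 4 * K ^ 2 := by
          rw [hK, ← ENNReal.ofReal_pow (by positivity), mul_pow, ← Real.rpow_natCast (4 ^ (c / 2)),
            ← Real.rpow_mul (by norm_num), show (4 : ℝ≥0∞) = ENNReal.ofReal 4 by norm_num,
            ← ENNReal.ofReal_mul (by norm_num)]
          congr 1
          push_cast
          rw [div_mul_cancel₀ _ (by norm_num)]
          ring
        rw [this]
        ring

end Sequences

/-! ### Fourier coefficients of real functions on the torus -/

section FourierAnalysis

variable {d : ℕ}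

lemma fourierCoef_congr {f g : UnitAddTorus (Fin d) → ℝ} (h : f =ᵐ[torusMeasure d] g) :
    fourierCoef f = fourierCoef g := by
  funext k
  refine integral_congr_ae ?_
  filter_upwards [h] with x hx
  simp only [hx]

lemma fourierCoef_neg_freq (f : UnitAddTorus (Fin d) → ℝ) (k : Fin d → ℤ) :
    fourierCoef f (-k) = (starRingEnd ℂ) (fourierCoef f k) := by
  unfold fourierCoef UnitAddTorus.mFourierCoeff
  rw [← integral_conj]
  refine integral_congr_ae (ae_of_all _ fun x => ?_)
  simp [UnitAddTorus.mFourier_neg]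

lemma enorm_fourierCoef_le (f : UnitAddTorus (Fin d) → ℝ) (k : Fin d → ℤ) :
    ‖fourierCoef f k‖ₑ ≤ ∫⁻ x, ‖f x‖ₑ ∂(torusMeasure d) := by
  unfold fourierCoef UnitAddTorus.mFourierCoeff
  refine (enorm_integral_le_lintegral_enorm _).trans (lintegral_mono fun x => ?_)
  rw [enorm_smul]
  have h1 : ‖UnitAddTorus.mFourier (-k) x‖ₑ ≤ 1 := by
    rw [← enorm_one (G := ℝ), enorm_le_iff_norm_le]
    simpa [UnitAddTorus.mFourier_norm] using (UnitAddTorus.mFourier (-k)).norm_coe_le_norm x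
  calc _ ≤ 1 * ‖((f x : ℝ) : ℂ)‖ₑ := by gcongr
    _ = ‖f x‖ₑ := by rw [one_mul, ← ofReal_norm, Complex.norm_real, ofReal_norm]

lemma coefSeq_norm (v : L2 d) : ‖coefSeq d v‖ = ‖v‖ := by
  have h1 : ‖coefSeq d v‖ = ‖(Complex.ofRealCLM.compLp v : Lp ℂ 2 (torusMeasure d))‖ :=
    (UnitAddTorus.mFourierBasis (d := Fin d)).repr.norm_map _
  rw [h1, Lp.norm_def, Lp.norm_def]
  congr 1
  refine eLpNorm_congr_norm_ae ?_
  filter_upwards [Complex.ofRealCLM.coeFn_compLp v] with x hx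
  rw [hx]
  simp

lemma fourierCoef_sub (u v : L2 d) (k : Fin d → ℤ) :
    fourierCoef (u - v : L2 d) k = fourierCoef u k - fourierCoef v k := by
  simp only [← coefSeq_apply, map_sub, lp.coeFn_sub, Pi.sub_apply]

lemma lp_enorm_sq (c : lp (fun _ : Fin d → ℤ => ℂ) 2) :
    ‖c‖ₑ ^ 2 = ∑' k, ‖(c : (Fin d → ℤ) → ℂ) k‖ₑ ^ 2 := by
  have h2 := lp.norm_rpow_eq_tsum (p := 2) (by norm_num) c
  have h3 := (lp.memℓp c).summable (by norm_num)
  simp only [ENNReal.toReal_ofNat, Real.rpow_ofNat] at h2 h3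
  rw [← ofReal_norm, ← ENNReal.ofReal_pow (norm_nonneg _), h2,
    ENNReal.ofReal_tsum_of_nonneg (fun _ => sq_nonneg _) h3]
  refine tsum_congr fun k => ?_
  rw [ENNReal.ofReal_pow (norm_nonneg _), ofReal_norm]

/-- Parseval's identity. -/
lemma seqE_zero_fourierCoef (v : L2 d) : seqE 0 (fourierCoef v) = ‖v‖ₑ ^ 2 := by
  have h : ‖v‖ₑ = ‖coefSeq d v‖ₑ := by rw [← ofReal_norm, ← ofReal_norm, coefSeq_norm]
  rw [h, lp_enorm_sq]
  simp [seqE, coefSeq_apply]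

lemma lintegral_enorm_sq (v : L2 d) :
    ∫⁻ x, ‖v x‖ₑ ^ 2 ∂(torusMeasure d) = seqE 0 (fourierCoef v) := by
  rw [seqE_zero_fourierCoef, Lp.enorm_def,
    eLpNorm_eq_lintegral_rpow_enorm_toReal (by norm_num) (by norm_num)]
  simp only [ENNReal.toReal_ofNat, ENNReal.rpow_ofNat]
  rw [← ENNReal.rpow_natCast, ← ENNReal.rpow_mul]
  norm_num

lemma L2_ext_coef {u v : L2 d} (h : ∀ k, fourierCoef u k = fourierCoef v k) : u = v := by
  apply coefSeq_injective d
  apply lp.ext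
  funext k
  rw [coefSeq_apply, coefSeq_apply, h]

lemma norm_fourierCoef_le (v : L2 d) (k : Fin d → ℤ) : ‖fourierCoef v k‖ ≤ ‖v‖ := by
  rw [← coefSeq_apply, ← coefSeq_norm]
  exact lp.norm_apply_le_norm (by norm_num) _ k

/-- The `k`-th Fourier coefficient as a continuous real-linear functional on `L²`. -/
def coefL2 (k : Fin d → ℤ) : L2 d →L[ℝ] ℂ :=
  LinearMap.mkContinuous
    { toFun := fun v => fourierCoef v k
      map_add' := fun u v => fourierCoef_add u v k
      map_smul' := fun a v => fourierCoef_smul a v k } 1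
    fun v => by simpa using norm_fourierCoef_le v k

@[simp] lemma coefL2_apply (k : Fin d → ℤ) (v : L2 d) : coefL2 k v = fourierCoef v k := rfl

/-- Every square-summable sequence with `c (-k) = conj (c k)` is the sequence of Fourier
coefficients of a real function: take the real part of the complex function with these
coefficients. -/
lemma exists_L2_of_coef {c : (Fin d → ℤ) → ℂ} (hc : seqE 0 c ≠ ⊤)
    (hsymm : ∀ k, c (-k) = (starRingEnd ℂ) (c k)) : ∃ v : L2 d, ∀ k, fourierCoef v k = c k := by
  have hmem : Memℓp c 2 := by
    rw [memℓp_gen_iff (by norm_num)]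
    have h1 : ∑' k, ENNReal.ofReal (‖c k‖ ^ 2) ≠ ⊤ := by
      simpa [seqE, ENNReal.ofReal_pow] using hc
    have h2 := ENNReal.summable_toReal h1
    refine h2.congr fun k => ?_
    rw [ENNReal.toReal_ofReal (sq_nonneg _)]
    norm_num
  set w : Lp ℂ 2 (torusMeasure d) :=
    (UnitAddTorus.mFourierBasis (d := Fin d)).repr.symm ⟨c, hmem⟩ with hw
  have hwc : ∀ k, UnitAddTorus.mFourierCoeff w k = c k := fun k => by
    refine (UnitAddTorus.mFourierBasis_repr w k).symm.trans ?_
    exact congrArg (fun z : lp (fun _ : Fin d → ℤ => ℂ) 2 => (z : (Fin d → ℤ) → ℂ) k)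
      ((UnitAddTorus.mFourierBasis (d := Fin d)).repr.apply_symm_apply ⟨c, hmem⟩)
  refine ⟨Complex.reCLM.compLp w, fun k => ?_⟩
  have hint : ∀ k : Fin d → ℤ, Integrable (fun x => UnitAddTorus.mFourier (-k) x • w x)
      (torusMeasure d) := fun k => by
    refine ((Lp.memLp w).integrable (by norm_num)).bdd_mul (c := 1)
      (UnitAddTorus.mFourier (-k)).continuous.aestronglyMeasurable (ae_of_all _ fun x => ?_)
    simpa [UnitAddTorus.mFourier_norm] using (UnitAddTorus.mFourier (-k)).norm_coe_le_norm x
  have e1 : fourierCoef (Complex.reCLM.compLp w : L2 d) k =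
      ∫ x, (2 : ℂ)⁻¹ * (UnitAddTorus.mFourier (-k) x • w x +
        (starRingEnd ℂ) (UnitAddTorus.mFourier (- -k) x • w x)) ∂(torusMeasure d) := by
    refine integral_congr_ae ?_
    filter_upwards [Complex.reCLM.coeFn_compLp w] with x hx
    change UnitAddTorus.mFourier (-k) x • (((Complex.reCLM.compLp w : L2 d) x : ℝ) : ℂ) = _
    have h3 : (starRingEnd ℂ) (UnitAddTorus.mFourier (- -k) x) = UnitAddTorus.mFourier (-k) x := by
      rw [UnitAddTorus.mFourier_neg (n := -k), Complex.conj_conj]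
    rw [hx, Complex.reCLM_apply, Complex.re_eq_add_conj, smul_eq_mul, smul_eq_mul, smul_eq_mul,
      map_mul, h3]
    ring
  have hconj : Integrable (fun x => (starRingEnd ℂ) (UnitAddTorus.mFourier (- -k) x • w x))
      (torusMeasure d) := (LinearIsometryEquiv.integrable_comp_iff Complex.conjLIE).2 (hint (-k))
  rw [e1, integral_const_mul, integral_add (hint k) hconj, integral_conj]
  have e2 : ∀ k, ∫ x, UnitAddTorus.mFourier (-k) x • w x ∂(torusMeasure d) = c k := hwc
  rw [e2, e2, hsymm, Complex.conj_conj]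
  ring

/-- Membership in `H^s` in terms of Fourier coefficients. -/
lemma mem_sobolev_iff {s : ℕ} (v : L2 d) :
    v ∈ sobolevSubmodule d s ↔ seqE s (fourierCoef v) ≠ ⊤ := by
  rw [mem_sobolevSubmodule]
  have h0 : ∀ k : Fin d → ℤ, 0 ≤ (1 + freqSq k) ^ s * ‖fourierCoef v k‖ ^ 2 := fun k =>
    mul_nonneg (pow_nonneg (wt_pos k).le s) (sq_nonneg _)
  have h1 : seqE s (fourierCoef v) =
      ∑' k, ENNReal.ofReal ((1 + freqSq k) ^ s * ‖fourierCoef v k‖ ^ 2) := by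
    refine tsum_congr fun k => ?_
    change _ = ENNReal.ofReal (wt k ^ s * _)
    rw [ENNReal.ofReal_mul (pow_nonneg (wt_pos k).le s), ENNReal.ofReal_pow (norm_nonneg _),
      ofReal_norm, Real.rpow_natCast]
  rw [h1]
  refine ⟨fun h => h.tsum_ofReal_ne_top, fun h => ?_⟩
  refine (ENNReal.summable_toReal h).congr fun k => ENNReal.toReal_ofReal (h0 k)

namespace HSp

variable {s : ℕ}

lemma enorm_sq (u : HSp d s) : ‖u‖ₑ ^ 2 = seqE s (fourierCoef u.val) := by
  have h : ‖u‖ₑ = ‖HSp.toSeq u‖ₑ := by rw [← ofReal_norm, ← ofReal_norm]; rfl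
  rw [h, lp_enorm_sq]
  refine tsum_congr fun k => ?_
  change ‖weightedCoef s u.toL2 k‖ₑ ^ 2 = _
  rw [weightedCoef, enorm_smul, mul_pow, Real.enorm_eq_ofReal (Real.sqrt_nonneg _),
    ← ENNReal.ofReal_pow (Real.sqrt_nonneg _), Real.sq_sqrt (pow_nonneg (by linarith [freqSq_nonneg k]) s),
    Real.rpow_natCast]
  rfl

lemma seqE_ne_top (u : HSp d s) : seqE s (fourierCoef u.val) ≠ ⊤ := (mem_sobolev_iff _).1 u.mem

lemma norm_le_iff (u : HSp d s) {R : ℝ} (hR : 0 ≤ R) :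
    ‖u‖ ≤ R ↔ seqE s (fourierCoef u.val) ≤ ENNReal.ofReal (R ^ 2) := by
  rw [← enorm_sq, ENNReal.ofReal_pow hR, ENNReal.pow_le_pow_left_iff (by norm_num),
    ← ofReal_norm, ENNReal.ofReal_le_ofReal_iff hR]

lemma ext_coef {u v : HSp d s} (h : ∀ k, fourierCoef u.val k = fourierCoef v.val k) : u = v :=
  HSp.ext (L2_ext_coef h)

@[simp] lemma val_add (u v : HSp d s) : (u + v).val = u.val + v.val := rfl
@[simp] lemma val_sub (u v : HSp d s) : (u - v).val = u.val - v.val := rfl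
@[simp] lemma val_smul (a : ℝ) (u : HSp d s) : (a • u).val = a • u.val := rfl
@[simp] lemma val_zero : (0 : HSp d s).val = 0 := rfl
@[simp] lemma toL2_apply (u : HSp d s) : u.toL2 = u.val := rfl
@[simp] lemma incl_val {t : ℕ} (h : s ≤ t) (u : HSp d t) : (HSp.incl h u).val = u.val := rfl

lemma norm_val_le (u : HSp d s) : ‖u.val‖ ≤ ‖u‖ := by
  rw [← enorm_le_iff_norm_le, ← ENNReal.pow_le_pow_left_iff (n := 2) (by norm_num), enorm_sq,
    ← seqE_zero_fourierCoef]
  exact seqE_mono (by positivity) _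

lemma norm_incl_le {t : ℕ} (h : s ≤ t) (u : HSp d t) : ‖HSp.incl h u‖ ≤ ‖u‖ := by
  rw [← enorm_le_iff_norm_le, ← ENNReal.pow_le_pow_left_iff (n := 2) (by norm_num), enorm_sq,
    enorm_sq]
  exact seqE_mono (by exact_mod_cast h) _

/-- The inclusion `H^s ⊆ L²` as a continuous linear map. -/
def toL2CLM (d s : ℕ) : HSp d s →L[ℝ] L2 d :=
  LinearMap.mkContinuous HSp.toL2 1 fun u => by simpa using norm_val_le u

/-- The inclusion `H^t ⊆ H^s` as a continuous linear map. -/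
def inclCLM {t : ℕ} (h : s ≤ t) : HSp d t →L[ℝ] HSp d s :=
  LinearMap.mkContinuous (HSp.incl h) 1 fun u => by simpa using norm_incl_le h u

end HSp

/-! ### Sobolev embedding and products -/

/-- A function is bounded by the sum of the moduli of its Fourier coefficients. -/
lemma ae_enorm_le_tsum (v : L2 d) :
    ∀ᵐ x ∂(torusMeasure d), ‖v x‖ₑ ≤ ∑' k, ‖fourierCoef v k‖ₑ := by
  by_cases htop : ∑' k, ‖fourierCoef v k‖ₑ = ⊤
  · simp [htop]
  have hs : Summable fun k => ‖fourierCoef v k‖ := by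
    have := ENNReal.summable_toReal htop
    simpa using this
  set φ : Lp ℂ 2 (torusMeasure d) := Complex.ofRealCLM.compLp v with hφ
  have hco : ∀ k, UnitAddTorus.mFourierCoeff φ k = fourierCoef v k := fun k => by
    refine integral_congr_ae ?_
    filter_upwards [Complex.ofRealCLM.coeFn_compLp v] with x hx
    exact congrArg (UnitAddTorus.mFourier (-k) x • ·) hx
  have hsC : Summable fun k => fourierCoef v k • UnitAddTorus.mFourier (d := Fin d) k := by
    refine Summable.of_norm ?_
    simpa only [norm_smul, UnitAddTorus.mFourier_norm, mul_one] using hs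
  have h1 : HasSum (fun k => UnitAddTorus.mFourierCoeff φ k •
      ContinuousMap.toLp (E := ℂ) 2 (torusMeasure d) ℂ (UnitAddTorus.mFourier k)) φ :=
    UnitAddTorus.hasSum_mFourier_series_L2 (d := Fin d) φ
  have h2 := hsC.hasSum.mapL (ContinuousMap.toLp (E := ℂ) 2 (torusMeasure d) ℂ)
  simp only [hco] at h1
  have h3 : φ = ContinuousMap.toLp (E := ℂ) 2 (torusMeasure d) ℂ
      (∑' k, fourierCoef v k • UnitAddTorus.mFourier (d := Fin d) k) := by
    refine h1.unique ?_
    simpa only [map_smul] using! h2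
  have h4 := ContinuousMap.coeFn_toLp (p := 2) (𝕜 := ℂ) (torusMeasure d)
    (∑' k, fourierCoef v k • UnitAddTorus.mFourier (d := Fin d) k)
  rw [← h3] at h4
  filter_upwards [h4, Complex.ofRealCLM.coeFn_compLp v] with x hx hx'
  have e1 : ‖v x‖ₑ = ‖φ x‖ₑ := by
    rw [hφ, hx', Complex.ofRealCLM_apply, ← ofReal_norm, ← ofReal_norm, Complex.norm_real]
  rw [e1, hx]
  have e2 : ‖(∑' k, fourierCoef v k • UnitAddTorus.mFourier (d := Fin d) k) x‖ ≤
      ∑' k, ‖fourierCoef v k‖ := by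
    refine (ContinuousMap.norm_coe_le_norm _ x).trans ?_
    refine tsum_of_norm_bounded hs.hasSum fun k => ?_
    rw [norm_smul, UnitAddTorus.mFourier_norm, mul_one]
  calc _ ≤ ENNReal.ofReal (∑' k, ‖fourierCoef v k‖) := by
        rw [← ofReal_norm]; exact ENNReal.ofReal_le_ofReal e2
    _ = _ := by
        rw [ENNReal.ofReal_tsum_of_nonneg (fun _ => norm_nonneg _) hs]
        simp only [ofReal_norm]

/-- The Sobolev embedding `H^s ⊆ L^∞` for `s > d/2`. -/
lemma HSp.exists_sup_bound {s : ℕ} (hs : (d : ℝ) / 2 < s) :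
    ∃ C : ℝ, 0 ≤ C ∧ ∀ u : HSp d s, ∀ᵐ x ∂(torusMeasure d), |u.val x| ≤ C * ‖u‖ := by
  refine ⟨Real.sqrt (latticeSum d s).toReal, Real.sqrt_nonneg _, fun u => ?_⟩
  filter_upwards [ae_enorm_le_tsum u.val] with x hx
  have h1 : ‖u.val x‖ₑ ^ 2 ≤ latticeSum d s * ‖u‖ₑ ^ 2 := by
    rw [HSp.enorm_sq]
    exact (pow_le_pow_left₀ zero_le hx 2).trans (tsum_enorm_sq_le _ _)
  have h2 := ENNReal.toReal_mono (ENNReal.mul_ne_top (latticeSum_ne_top hs) (by simp)) h1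
  rw [ENNReal.toReal_mul, ENNReal.toReal_pow, ENNReal.toReal_pow, toReal_enorm, toReal_enorm] at h2
  rw [← Real.norm_eq_abs]
  refine le_of_sq_le_sq ?_ (by positivity)
  rwa [mul_pow, Real.sq_sqrt ENNReal.toReal_nonneg]

lemma enorm_fourierCoef_mul_le (u v : L2 d) (k : Fin d → ℤ) :
    ‖fourierCoef (fun x => u x * v x) k‖ₑ ≤
      ∑' j, ‖fourierCoef u j‖ₑ * ‖fourierCoef v (k - j)‖ₑ := by
  set φ : Lp ℂ 2 (torusMeasure d) := Complex.ofRealCLM.compLp u with hφ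
  have hφx : ∀ᵐ x ∂(torusMeasure d), φ x = ((u x : ℝ) : ℂ) := Complex.ofRealCLM.coeFn_compLp u
  have hmem : MemLp (fun x => UnitAddTorus.mFourier (-k) x * ((v x : ℝ) : ℂ)) 2
      (torusMeasure d) := by
    have h1 : MemLp (fun x => ((v x : ℝ) : ℂ)) 2 (torusMeasure d) := (Lp.memLp v).ofReal
    refine MemLp.of_le h1 ((UnitAddTorus.mFourier (-k)).continuous.aestronglyMeasurable.mul h1.1)
      (ae_of_all _ fun x => ?_)
    rw [norm_mul]
    have : ‖UnitAddTorus.mFourier (-k) x‖ ≤ 1 := by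
      simpa [UnitAddTorus.mFourier_norm] using (UnitAddTorus.mFourier (-k)).norm_coe_le_norm x
    exact mul_le_of_le_one_left (norm_nonneg _) this
  set ψ : Lp ℂ 2 (torusMeasure d) := hmem.toLp with hψ
  have hψx := hmem.coeFn_toLp
  have h : HasSum (fun j => (starRingEnd ℂ) (UnitAddTorus.mFourierCoeff φ j) *
      UnitAddTorus.mFourierCoeff ψ j) (∫ t, (starRingEnd ℂ) (φ t) * ψ t ∂(torusMeasure d)) :=
    UnitAddTorus.hasSum_prod_mFourierCoeff (d := Fin d) φ ψ
  have e1 : ∫ t, (starRingEnd ℂ) (φ t) * ψ t ∂(torusMeasure d) =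
      fourierCoef (fun x => u x * v x) k := by
    refine integral_congr_ae ?_
    filter_upwards [hφx, hψx] with x h1 h2
    rw [h1, hψ, h2, Complex.conj_ofReal, smul_eq_mul]
    push_cast
    ring
  have e2 : ∀ j, UnitAddTorus.mFourierCoeff φ j = fourierCoef u j := fun j => by
    refine integral_congr_ae ?_
    filter_upwards [hφx] with x hx
    simp only [hx]
  have e3 : ∀ j, UnitAddTorus.mFourierCoeff ψ j = fourierCoef v (k + j) := fun j => by
    refine integral_congr_ae ?_
    filter_upwards [hψx] with x hx
    rw [hψ, hx, neg_add, UnitAddTorus.mFourier_add, smul_eq_mul, smul_eq_mul]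
    ring
  have h' : HasSum (fun j => (starRingEnd ℂ) (fourierCoef u j) * fourierCoef v (k + j))
      (fourierCoef (fun x => u x * v x) k) := by
    rw [← e1]
    simpa only [e2, e3] using h
  rw [← h'.tsum_eq, ← (Equiv.neg (Fin d → ℤ)).tsum_eq]
  calc _ ≤ ∑' j, ‖(starRingEnd ℂ) (fourierCoef u (Equiv.neg _ j)) *
        fourierCoef v (k + Equiv.neg _ j)‖ₑ := enorm_tsum_le_tsum_enorm
    _ = _ := by
        refine tsum_congr fun j => ?_
        rw [enorm_mul, Equiv.neg_apply, fourierCoef_neg_freq, Complex.conj_conj, sub_eq_add_neg]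

/-- The constant of the product estimate. -/
def prodConst (d : ℕ) (a b c : ℝ) : ℝ≥0∞ :=
  ENNReal.ofReal (16 * 4 ^ c) * latticeSum d (a + b - c)

lemma prodConst_ne_top {a b c : ℝ} (h : (d : ℝ) / 2 < a + b - c) : prodConst d a b c ≠ ⊤ :=
  ENNReal.mul_ne_top ENNReal.ofReal_ne_top (latticeSum_ne_top h)

/-- The product of `H^a` and `H^b` lies in `H^c` if `0 ≤ c ≤ min a b` and `a + b - c > d/2`. -/
lemma seqE_mul_le {a b c : ℝ} (hc : 0 ≤ c) (hca : c ≤ a) (hcb : c ≤ b) (u v : L2 d) :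
    seqE c (fourierCoef fun x => u x * v x) ≤
      prodConst d a b c * (seqE a (fourierCoef u) * seqE b (fourierCoef v)) := by
  refine le_trans (ENNReal.tsum_le_tsum fun k => ?_) (tsum_weight_conv_sq_le hc hca hcb
    (fun k => ‖fourierCoef u k‖ₑ) fun k => ‖fourierCoef v k‖ₑ)
  gcongr
  exact enorm_fourierCoef_mul_le u v k

end FourierAnalysis

/-! ### Derivatives and the chain rule -/

section ChainRule

variable {d : ℕ}

/-- `D` is the weak derivative `∂v/∂x_j`, expressed through Fourier coefficients. -/
def IsPartial (j : Fin d) (v D : L2 d) : Prop :=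
  ∀ k, fourierCoef D k = (k j : ℂ) * Complex.I * fourierCoef v k

lemma seqE_succ (r : ℝ) (c : (Fin d → ℤ) → ℂ) :
    seqE (r + 1) c =
      seqE r c + ∑ j, seqE r fun k : Fin d → ℤ => (k j : ℂ) * Complex.I * c k := by
  unfold seqE
  rw [← Summable.tsum_finsetSum fun _ _ => ENNReal.summable, ← ENNReal.tsum_add]
  refine tsum_congr fun k => ?_
  have h1 : ∀ j, ENNReal.ofReal (wt k ^ r) * ‖(k j : ℂ) * Complex.I * c k‖ₑ ^ 2 =
      ENNReal.ofReal (wt k ^ r) * ‖c k‖ₑ ^ 2 * ENNReal.ofReal ((k j : ℝ) ^ 2) := fun j => by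
    rw [enorm_mul, enorm_mul, ← sq_abs, ENNReal.ofReal_pow (abs_nonneg _)]
    have : ‖(k j : ℂ)‖ₑ = ENNReal.ofReal |(k j : ℝ)| := by
      rw [← ofReal_norm, Complex.norm_intCast]
    have hI : ‖Complex.I‖ₑ = 1 := by rw [← ofReal_norm]; simp
    rw [this, hI]
    ring
  simp only [h1]
  rw [← Finset.mul_sum, ← ENNReal.ofReal_sum_of_nonneg fun _ _ => sq_nonneg _,
    Real.rpow_add_one (wt_pos k).ne', ENNReal.ofReal_mul (Real.rpow_nonneg (wt_pos k).le _), wt,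
    ENNReal.ofReal_add one_pos.le (freqSq_nonneg k), ENNReal.ofReal_one]
  unfold freqSq
  ring

lemma seqE_partial_le (r : ℝ) (c : (Fin d → ℤ) → ℂ) (j : Fin d) :
    seqE r (fun k : Fin d → ℤ => (k j : ℂ) * Complex.I * c k) ≤ seqE (r + 1) c := by
  rw [seqE_succ]
  exact le_add_left (Finset.single_le_sum
    (f := fun j => seqE r fun k : Fin d → ℤ => (k j : ℂ) * Complex.I * c k)
    (fun _ _ => zero_le) (Finset.mem_univ j))

lemma exists_isPartial (j : Fin d) {v : L2 d} (hv : seqE 1 (fourierCoef v) ≠ ⊤) :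
    ∃ D : L2 d, IsPartial j v D := by
  refine exists_L2_of_coef (ne_top_of_le_ne_top hv ?_) fun k => ?_
  · simpa using seqE_partial_le 0 (fourierCoef v) j
  · rw [fourierCoef_neg_freq]
    simp

lemma IsPartial.seqE_eq {j : Fin d} {v D : L2 d} (h : IsPartial j v D) (r : ℝ) :
    seqE r (fourierCoef D) = seqE r fun k : Fin d → ℤ => (k j : ℂ) * Complex.I * fourierCoef v k :=
  congrArg (seqE r) (funext h)

lemma IsPartial.seqE_le {j : Fin d} {v D : L2 d} (h : IsPartial j v D) (r : ℝ) :
    seqE r (fourierCoef D) ≤ seqE (r + 1) (fourierCoef v) := by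
  rw [h.seqE_eq]
  exact seqE_partial_le r _ j

/-- The point `x_j = t`, `x_i = 0` for `i ≠ j`, of the torus `ℝ^d/2πℤ^d`. -/
def shiftPt (j : Fin d) (t : ℝ) : UnitAddTorus (Fin d) :=
  Pi.single j ((t / (2 * Real.pi) : ℝ) : AddCircle (1 : ℝ))

lemma mFourier_shiftPt (j : Fin d) (t : ℝ) (k : Fin d → ℤ) :
    UnitAddTorus.mFourier k (shiftPt j t) = Complex.exp ((k j : ℂ) * Complex.I * t) := by
  change ∏ i, fourier (k i) (shiftPt j t i) = _
  rw [Finset.prod_eq_single j]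
  · rw [shiftPt, Pi.single_eq_same, fourier_coe_apply]
    congr 1
    have : (Real.pi : ℂ) ≠ 0 := by exact_mod_cast Real.pi_ne_zero
    push_cast
    field_simp
  · intro i _ hi
    rw [shiftPt, Pi.single_eq_of_ne hi]
    simp
  · simp

instance : (torusMeasure d).IsAddRightInvariant := by
  unfold torusMeasure; infer_instance

/-- Translation in the `j`-th coordinate and its Fourier multiplier. -/
lemma exists_translate (v : L2 d) (j : Fin d) (t : ℝ) :
    ∃ w : L2 d, (∀ᵐ x ∂(torusMeasure d), w x = v (x + shiftPt j t)) ∧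
      ∀ k, fourierCoef w k = Complex.exp ((k j : ℂ) * Complex.I * t) * fourierCoef v k := by
  have hmp := measurePreserving_add_right (torusMeasure d) (shiftPt j t)
  refine ⟨Lp.compMeasurePreserving _ hmp v, Lp.coeFn_compMeasurePreserving v hmp, fun k => ?_⟩
  rw [fourierCoef_congr (Lp.coeFn_compMeasurePreserving v hmp)]
  unfold fourierCoef UnitAddTorus.mFourierCoeff
  rw [← mFourier_shiftPt, ← integral_const_mul]
  have h := integral_add_right_eq_self (μ := torusMeasure d)
    (fun x => UnitAddTorus.mFourier k (shiftPt j t) *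
      (UnitAddTorus.mFourier (-k) x • ((v x : ℝ) : ℂ))) (shiftPt j t)
  refine Eq.trans (integral_congr_ae (ae_of_all _ fun x => ?_)) h
  have e : UnitAddTorus.mFourier k (shiftPt j t) * UnitAddTorus.mFourier (-k) (x + shiftPt j t) =
      UnitAddTorus.mFourier (-k) x := by
    have add_apply : ∀ (m : Fin d → ℤ) (x y : UnitAddTorus (Fin d)),
        UnitAddTorus.mFourier m (x + y) = UnitAddTorus.mFourier m x * UnitAddTorus.mFourier m y := by
      intro m x y
      simp [UnitAddTorus.mFourier, Finset.prod_mul_distrib, fourier_apply, smul_add,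
        AddCircle.toCircle_add]
    have h0 : UnitAddTorus.mFourier k (shiftPt j t) * UnitAddTorus.mFourier (-k) (shiftPt j t) =
        1 := by
      rw [mFourier_shiftPt, mFourier_shiftPt, ← Complex.exp_add]
      simp
    rw [add_apply, mul_left_comm, h0, mul_one]
  simp only [Function.comp_apply, smul_eq_mul]
  rw [← mul_assoc, e]

lemma norm_exp_sub_one_div_le (a t : ℝ) (ht : t ≠ 0) :
    ‖(Complex.exp ((a : ℂ) * Complex.I * t) - 1) / t‖ ≤ |a| := by
  have h := Real.norm_exp_I_mul_ofReal_sub_one_le (x := a * t)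
  rw [norm_div, Complex.norm_real, div_le_iff₀ (by simpa using ht)]
  have e : (a : ℂ) * Complex.I * t = Complex.I * ((a * t : ℝ) : ℂ) := by push_cast; ring
  rw [e]
  simpa [abs_mul] using h

lemma tendsto_exp_sub_one_div (a : ℝ) :
    Tendsto (fun t : ℝ => (Complex.exp ((a : ℂ) * Complex.I * t) - 1) / t) (𝓝[≠] 0)
      (𝓝 ((a : ℂ) * Complex.I)) := by
  have h1 : HasDerivAt (fun t : ℝ => Complex.exp ((a : ℂ) * Complex.I * t))
      ((a : ℂ) * Complex.I) 0 := by
    have h := ((hasDerivAt_id (0 : ℝ)).ofReal_comp.const_mul ((a : ℂ) * Complex.I)).cexp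
    simpa using h
  have h2 := h1.tendsto_slope
  refine h2.congr fun t => ?_
  simp only [slope_def_module, sub_zero, Complex.ofReal_zero, mul_zero, Complex.exp_zero,
    Complex.real_smul, Complex.ofReal_inv]
  rw [div_eq_inv_mul]

/-- Difference quotients of `v ∈ H^1` converge in `L²` to the weak derivative. -/
lemma IsPartial.tendsto_quotient {j : Fin d} {v D : L2 d} (h : IsPartial j v D) {q : ℝ → L2 d}
    (hq : ∀ t k, fourierCoef (q t) k =
      (Complex.exp ((k j : ℂ) * Complex.I * t) - 1) / t * fourierCoef v k) :
    Tendsto q (𝓝[≠] 0) (𝓝 D) := by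
  rw [tendsto_iff_norm_sub_tendsto_zero]
  have hsq : ∀ t, ‖q t - D‖ ^ 2 = ∑' k, ‖fourierCoef (q t - D : L2 d) k‖ ^ 2 := fun t => by
    rw [← coefSeq_norm]
    have := lp.norm_rpow_eq_tsum (p := 2) (by norm_num) (coefSeq d (q t - D))
    simp only [ENNReal.toReal_ofNat, Real.rpow_ofNat, coefSeq_apply] at this
    exact this
  have hsum : Summable fun k => ‖fourierCoef D k‖ ^ 2 := by
    have h3 := (lp.memℓp (coefSeq d D)).summable (by norm_num)
    simpa [coefSeq_apply] using h3
  have key : Tendsto (fun t => ‖q t - D‖ ^ 2) (𝓝[≠] 0) (𝓝 0) := by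
    simp only [hsq]
    have h0 : (0 : ℝ) = ∑' _ : Fin d → ℤ, (0 : ℝ) := tsum_zero.symm
    conv => arg 3; rw [h0]
    refine tendsto_tsum_of_dominated_convergence (bound := fun k => 4 * ‖fourierCoef D k‖ ^ 2)
      (hsum.mul_left 4) (fun k => ?_) ?_
    · have h1 := ((tendsto_exp_sub_one_div (k j)).mul_const (fourierCoef v k)).sub_const
        (fourierCoef D k)
      have h2 := (h1.norm).pow 2
      rw [h k] at h2
      simp only [Complex.ofReal_intCast, sub_self, norm_zero, ne_eq, OfNat.ofNat_ne_zero,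
        not_false_eq_true, zero_pow] at h2
      refine h2.congr fun t => ?_
      rw [fourierCoef_sub, hq, h k]
    · filter_upwards [self_mem_nhdsWithin] with t ht k
      rw [fourierCoef_sub, hq]
      have h1 := norm_exp_sub_one_div_le (k j) t ht
      have h2 : ‖(Complex.exp ((k j : ℂ) * Complex.I * t) - 1) / t * fourierCoef v k‖ ≤
          ‖fourierCoef D k‖ := by
        rw [h k, norm_mul, norm_mul, norm_mul, Complex.norm_I, mul_one, Complex.norm_intCast]
        refine mul_le_mul_of_nonneg_right ?_ (norm_nonneg _)
        simpa using h1
      have h3 := norm_sub_le ((Complex.exp ((k j : ℂ) * Complex.I * t) - 1) / t * fourierCoef v k)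
        (fourierCoef D k)
      rw [Real.norm_of_nonneg (sq_nonneg _)]
      nlinarith [norm_nonneg ((Complex.exp ((k j : ℂ) * Complex.I * t) - 1) / t * fourierCoef v k -
        fourierCoef D k), norm_nonneg (fourierCoef D k)]
  have := key.sqrt
  simpa [Real.sqrt_sq (norm_nonneg _)] using this

/-- The chain rule `∂_j (g(v)) = g'(v) ∂_j v` for `v ∈ H^1` and `g` with bounded `g'` and with
quadratic Taylor remainder. The difference quotient of `g(v)` differs from `g'(v)` times that of
`v` by a term whose `L¹` norm is `O(t)`. -/
lemma IsPartial.comp {j : Fin d} {v D G Q : L2 d} (h : IsPartial j v D) {g g' : ℝ → ℝ} {C₁ C₂ : ℝ}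
    (hg' : ∀ x, |g' x| ≤ C₁) (hg : ∀ x y, |g y - g x - g' x * (y - x)| ≤ C₂ * (y - x) ^ 2)
    (hG : ∀ᵐ x ∂(torusMeasure d), G x = g (v x))
    (hQ : ∀ᵐ x ∂(torusMeasure d), Q x = g' (v x) * D x) : IsPartial j G Q := by
  choose vt hvt hvtc using exists_translate v j
  choose Gt hGt hGtc using exists_translate G j
  have hC1 : 0 ≤ C₁ := (abs_nonneg _).trans (hg' 0)
  have hC2 : 0 ≤ C₂ := by
    have := (abs_nonneg _).trans (hg 0 1)
    simpa using this
  set q : ℝ → L2 d := fun t => t⁻¹ • (vt t - v) with hqdef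
  have hq : ∀ t k, fourierCoef (q t) k =
      (Complex.exp ((k j : ℂ) * Complex.I * t) - 1) / t * fourierCoef v k := fun t k => by
    rw [hqdef, fourierCoef_smul, fourierCoef_sub, hvtc, Complex.real_smul]
    push_cast
    ring
  have hqD := h.tendsto_quotient hq
  intro k
  set E : ℝ → L2 d := fun t => t⁻¹ • (Gt t - G) - Q with hE
  have hEc : ∀ t, fourierCoef (E t) k =
      (Complex.exp ((k j : ℂ) * Complex.I * t) - 1) / t * fourierCoef G k - fourierCoef Q k := by
    intro t
    rw [hE, fourierCoef_sub, fourierCoef_smul, fourierCoef_sub, hGtc, Complex.real_smul]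
    push_cast
    ring
  -- `E t = g'(v) (q t - D)` plus the Taylor remainder of `g` divided by `t`
  have hpt : ∀ t : ℝ, t ≠ 0 → ∀ᵐ x ∂(torusMeasure d),
      ‖E t x‖ₑ ≤ ENNReal.ofReal C₁ * ‖(q t - D : L2 d) x‖ₑ +
        ENNReal.ofReal (C₂ * |t|) * ‖q t x‖ₑ ^ 2 := by
    intro t ht
    have hGs : ∀ᵐ x ∂(torusMeasure d), G (x + shiftPt j t) = g (v (x + shiftPt j t)) :=
      (measurePreserving_add_right (torusMeasure d) (shiftPt j t)).quasiMeasurePreserving.ae hG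
    filter_upwards [hG, hQ, hvt t, hGt t, hGs, Lp.coeFn_sub (t⁻¹ • (Gt t - G)) Q,
      Lp.coeFn_smul t⁻¹ (Gt t - G), Lp.coeFn_sub (Gt t) G, Lp.coeFn_sub (q t) D,
      Lp.coeFn_smul t⁻¹ (vt t - v), Lp.coeFn_sub (vt t) v]
      with x h1 h2 h3 h4 h5 h6 h7 h8 h9 h10 h11
    have e1 : E t x = t⁻¹ * (g (vt t x) - g (v x)) - g' (v x) * D x := by
      rw [hE, h6, Pi.sub_apply, h7, Pi.smul_apply, h8, Pi.sub_apply, h4, h5, h1, h2, h3,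
        smul_eq_mul]
    have e2 : q t x = t⁻¹ * (vt t x - v x) := by
      rw [hqdef, h10, Pi.smul_apply, h11, Pi.sub_apply, smul_eq_mul]
    have e3 : (q t - D : L2 d) x = q t x - D x := h9
    have e4 : t * q t x = vt t x - v x := by rw [e2]; field_simp
    have b := hg (v x) (vt t x)
    rw [← e4] at b
    have e5 : E t x = g' (v x) * (q t x - D x) +
        t⁻¹ * (g (vt t x) - g (v x) - g' (v x) * (t * q t x)) := by
      rw [e1]; field_simp; ring
    have b2 : |E t x| ≤ C₁ * |(q t - D : L2 d) x| + C₂ * |t| * |q t x| ^ 2 := by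
      rw [e5, e3]
      refine (abs_add_le _ _).trans (add_le_add ?_ ?_)
      · rw [abs_mul]
        exact mul_le_mul_of_nonneg_right (hg' _) (abs_nonneg _)
      · rw [abs_mul, abs_inv, inv_mul_le_iff₀ (abs_pos.2 ht)]
        refine b.trans (le_of_eq ?_)
        rw [mul_pow, sq_abs, ← sq_abs t]
        ring
    rw [Real.enorm_eq_ofReal_abs, Real.enorm_eq_ofReal_abs, Real.enorm_eq_ofReal_abs,
      ← ENNReal.ofReal_mul hC1, ← ENNReal.ofReal_pow (abs_nonneg _), ← ENNReal.ofReal_mul (by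
        positivity), ← ENNReal.ofReal_add (by positivity) (by positivity)]
    exact ENNReal.ofReal_le_ofReal b2
  have hL1 : ∀ w : L2 d, ∫⁻ x, ‖w x‖ₑ ∂(torusMeasure d) ≤ ‖w‖ₑ := fun w => by
    have := lintegral_mul_sq_le (μ := torusMeasure d) (f := fun x => ‖w x‖ₑ) (g := fun _ => 1)
      (Lp.aestronglyMeasurable w).enorm aemeasurable_const
    simp only [mul_one, one_pow, lintegral_const, measure_univ] at this
    rw [lintegral_enorm_sq, seqE_zero_fourierCoef] at this
    exact (ENNReal.pow_le_pow_left_iff (by norm_num)).1 this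
  have hbd : ∀ t : ℝ, t ≠ 0 → ‖fourierCoef (E t) k‖ₑ ≤
      ENNReal.ofReal C₁ * ‖q t - D‖ₑ + ENNReal.ofReal (C₂ * |t|) * ‖q t‖ₑ ^ 2 := by
    intro t ht
    refine (enorm_fourierCoef_le _ k).trans ((lintegral_mono_ae (hpt t ht)).trans ?_)
    rw [lintegral_add_left' ((Lp.aestronglyMeasurable _).enorm.const_mul _),
      lintegral_const_mul' _ _ ENNReal.ofReal_ne_top, lintegral_const_mul' _ _ ENNReal.ofReal_ne_top,
      lintegral_enorm_sq, seqE_zero_fourierCoef]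
    gcongr
    exact hL1 _
  have hbd' : ∀ t : ℝ, t ≠ 0 → ‖fourierCoef (E t) k‖ ≤
      C₁ * ‖q t - D‖ + C₂ * |t| * ‖q t‖ ^ 2 := by
    intro t ht
    have := hbd t ht
    rw [← ofReal_norm, ← ofReal_norm, ← ofReal_norm, ← ENNReal.ofReal_mul hC1,
      ← ENNReal.ofReal_pow (norm_nonneg _), ← ENNReal.ofReal_mul (by positivity),
      ← ENNReal.ofReal_add (by positivity) (by positivity)] at this
    exact (ENNReal.ofReal_le_ofReal_iff (by positivity)).1 this
  have lim0 : Tendsto (fun t => C₁ * ‖q t - D‖ + C₂ * |t| * ‖q t‖ ^ 2) (𝓝[≠] 0) (𝓝 0) := by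
    have a1 := ((hqD.sub_const D).norm).const_mul C₁
    have a2 : Tendsto (fun t : ℝ => C₂ * |t|) (𝓝[≠] 0) (𝓝 (C₂ * |(0 : ℝ)|)) :=
      ((continuous_const.mul continuous_abs).tendsto 0).mono_left nhdsWithin_le_nhds
    have a3 := a1.add (a2.mul (hqD.norm.pow 2))
    simpa using a3
  -- the two limits of the `k`-th coefficient of `E t` identify `Q` as the derivative of `G`
  have lim1 : Tendsto (fun t => fourierCoef (E t) k) (𝓝[≠] 0) (𝓝 0) := by
    refine squeeze_zero_norm' ?_ lim0
    filter_upwards [self_mem_nhdsWithin] with t ht using hbd' t ht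
  have lim2 : Tendsto (fun t => fourierCoef (E t) k) (𝓝[≠] 0)
      (𝓝 ((k j : ℂ) * Complex.I * fourierCoef G k - fourierCoef Q k)) := by
    simp only [hEc]
    have := ((tendsto_exp_sub_one_div (k j)).mul_const (fourierCoef G k)).sub_const (fourierCoef Q k)
    simpa using this
  exact (sub_eq_zero.1 (tendsto_nhds_unique lim2 lim1)).symm

end ChainRule

/-! ### Growth of the nonlinearity along large shifts -/

section Nonlinearity

variable {d s : ℕ}

lemma HSp.ae_sub (u v : HSp d s) :
    ∀ᵐ x ∂(torusMeasure d), (u - v).val x = u.val x - v.val x := Lp.coeFn_sub u.val v.val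

lemma HSp.ae_add (u v : HSp d s) :
    ∀ᵐ x ∂(torusMeasure d), (u + v).val x = u.val x + v.val x := Lp.coeFn_add u.val v.val

lemma HSp.ae_smul (a : ℝ) (v : HSp d s) :
    ∀ᵐ x ∂(torusMeasure d), (a • v).val x = a * v.val x := Lp.coeFn_smul a v.val

lemma exists_L2_of_memLp {f : UnitAddTorus (Fin d) → ℝ} (hf : MemLp f 2 (torusMeasure d)) :
    ∃ w : L2 d, ∀ᵐ x ∂(torusMeasure d), w x = f x :=
  ⟨hf.toLp, hf.coeFn_toLp⟩

/-- `H^s` is an algebra for `s > d/2`. -/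
lemma HSp.exists_mul (hs : (d : ℝ) / 2 < s) :
    ∃ C : ℝ, 0 ≤ C ∧ ∀ u v : HSp d s, ∃ w : HSp d s,
      (∀ᵐ x ∂(torusMeasure d), w.val x = u.val x * v.val x) ∧ ‖w‖ ≤ C * ‖u‖ * ‖v‖ := by
  obtain ⟨B, hB0, hB⟩ := HSp.exists_sup_bound (d := d) hs
  refine ⟨Real.sqrt (prodConst d s s s).toReal, Real.sqrt_nonneg _, fun u v => ?_⟩
  have hmem : MemLp (fun x => u.val x * v.val x) 2 (torusMeasure d) := by
    refine MemLp.of_le_mul (c := B * ‖u‖) (Lp.memLp v.val)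
      ((Lp.aestronglyMeasurable u.val).mul (Lp.aestronglyMeasurable v.val)) ?_
    filter_upwards [hB u] with x hx
    rw [norm_mul]
    exact mul_le_mul_of_nonneg_right hx (norm_nonneg _)
  obtain ⟨w, hw⟩ := exists_L2_of_memLp hmem
  have hc := prodConst_ne_top (d := d) (a := s) (b := s) (c := s) (by linarith)
  have h1 : seqE s (fourierCoef w) ≤ prodConst d s s s * (‖u‖ₑ ^ 2 * ‖v‖ₑ ^ 2) := by
    rw [fourierCoef_congr hw, HSp.enorm_sq, HSp.enorm_sq]
    exact seqE_mul_le (by positivity) le_rfl le_rfl _ _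
  refine ⟨⟨w, (mem_sobolev_iff w).2 (ne_top_of_le_ne_top (by finiteness) h1)⟩, hw, ?_⟩
  rw [HSp.norm_le_iff _ (by positivity)]
  refine h1.trans (le_of_eq ?_)
  rw [mul_pow, mul_pow, Real.sq_sqrt ENNReal.toReal_nonneg, ENNReal.ofReal_mul (by positivity),
    ENNReal.ofReal_mul (by positivity), ENNReal.ofReal_toReal hc, ENNReal.ofReal_pow (by positivity),
    ENNReal.ofReal_pow (by positivity), ofReal_norm, ofReal_norm, mul_assoc]

/-- Constants belong to `H^s`. -/
lemma HSp.exists_const (d s : ℕ) (a : ℝ) :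
    ∃ w : HSp d s, ∀ᵐ x ∂(torusMeasure d), w.val x = a := by
  obtain ⟨w, hw⟩ := exists_L2_of_memLp (d := d) (f := fun _ => a) (memLp_const a)
  refine ⟨⟨w, (mem_sobolev_iff w).2 ?_⟩, hw⟩
  have h0 : ∀ k : Fin d → ℤ, k ≠ 0 → fourierCoef w k = 0 := by
    intro k hk
    rw [fourierCoef_congr hw]
    have h : inner ℂ (UnitAddTorus.mFourierLp (d := Fin d) 2 k) (UnitAddTorus.mFourierLp 2 0) = 0 :=
      UnitAddTorus.orthonormal_mFourier.2 hk
    rw [ContinuousMap.inner_toLp] at h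
    unfold fourierCoef UnitAddTorus.mFourierCoeff
    have h' : ∫ x, UnitAddTorus.mFourier (-k) x ∂(torusMeasure d) = 0 := by
      refine Eq.trans (integral_congr_ae (ae_of_all _ fun x => ?_)) h
      simp [UnitAddTorus.mFourier_zero, UnitAddTorus.mFourier_neg]
    simp only [smul_eq_mul]
    exact (integral_mul_const _ _).trans ((congrArg (· * (a : ℂ)) h').trans (zero_mul _))
  unfold seqE
  rw [tsum_eq_single 0 fun k hk => by rw [h0 k hk]; simp]
  finiteness

/-- `F lam v`, for `v ∈ H^s` within `R` of `lam • ζ`, is of order `lam ^ m` in `H^s`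
as `lam → ∞`. -/
def Growth (ζ : HSp d s) (R : ℝ) (F : ℝ → HSp d s → UnitAddTorus (Fin d) → ℝ) (m : ℕ) : Prop :=
  ∃ C : ℝ, 0 ≤ C ∧ ∀ lam : ℝ, 1 ≤ lam → ∀ v : HSp d s, ‖v - lam • ζ‖ ≤ R → ∃ w : HSp d s,
    (∀ᵐ x ∂(torusMeasure d), w.val x = F lam v x) ∧ ‖w‖ ≤ C * lam ^ m

namespace Growth

variable {ζ : HSp d s} {R : ℝ} {F F' : ℝ → HSp d s → UnitAddTorus (Fin d) → ℝ} {m m' : ℕ}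

lemma mono (h : Growth ζ R F m) (hm : m ≤ m') : Growth ζ R F m' := by
  obtain ⟨C, hC, h⟩ := h
  refine ⟨C, hC, fun lam hl v hv => ?_⟩
  obtain ⟨w, hw, hwn⟩ := h lam hl v hv
  exact ⟨w, hw, hwn.trans (mul_le_mul_of_nonneg_left (pow_le_pow_right₀ hl hm) hC)⟩

lemma congr (h : Growth ζ R F m)
    (hF : ∀ lam v, ∀ᵐ x ∂(torusMeasure d), F lam v x = F' lam v x) : Growth ζ R F' m := by
  obtain ⟨C, hC, h⟩ := h
  refine ⟨C, hC, fun lam hl v hv => ?_⟩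
  obtain ⟨w, hw, hwn⟩ := h lam hl v hv
  refine ⟨w, ?_, hwn⟩
  filter_upwards [hw, hF lam v] with x h1 h2 using h1.trans h2

lemma add (h : Growth ζ R F m) (h' : Growth ζ R F' m) :
    Growth ζ R (fun lam v x => F lam v x + F' lam v x) m := by
  obtain ⟨C, hC, h⟩ := h
  obtain ⟨C', hC', h'⟩ := h'
  refine ⟨C + C', by positivity, fun lam hl v hv => ?_⟩
  obtain ⟨w, hw, hwn⟩ := h lam hl v hv
  obtain ⟨w', hw', hwn'⟩ := h' lam hl v hv
  refine ⟨w + w', ?_, ?_⟩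
  · filter_upwards [hw, hw', HSp.ae_add w w'] with x h1 h2 h3
    rw [h3, h1, h2]
  · have := norm_add_le w w'
    linarith

lemma const_mul (h : Growth ζ R F m) (a : ℝ) :
    Growth ζ R (fun lam v x => a * F lam v x) m := by
  obtain ⟨C, hC, h⟩ := h
  refine ⟨|a| * C, by positivity, fun lam hl v hv => ?_⟩
  obtain ⟨w, hw, hwn⟩ := h lam hl v hv
  refine ⟨a • w, ?_, ?_⟩
  · filter_upwards [hw, HSp.ae_smul a w] with x h1 h3
    rw [h3, h1]
  · rw [norm_smul, Real.norm_eq_abs, mul_assoc]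
    exact mul_le_mul_of_nonneg_left hwn (abs_nonneg a)

lemma mul (hs : (d : ℝ) / 2 < s) (h : Growth ζ R F m) (h' : Growth ζ R F' m') :
    Growth ζ R (fun lam v x => F lam v x * F' lam v x) (m + m') := by
  obtain ⟨K, hK, hmul⟩ := HSp.exists_mul (d := d) hs
  obtain ⟨C, hC, h⟩ := h
  obtain ⟨C', hC', h'⟩ := h'
  refine ⟨K * C * C', by positivity, fun lam hl v hv => ?_⟩
  obtain ⟨w, hw, hwn⟩ := h lam hl v hv
  obtain ⟨w', hw', hwn'⟩ := h' lam hl v hv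
  obtain ⟨z, hz, hzn⟩ := hmul w w'
  refine ⟨z, ?_, ?_⟩
  · filter_upwards [hw, hw', hz] with x h1 h2 h3
    rw [h3, h1, h2]
  · have : 0 ≤ lam := by linarith
    calc ‖z‖ ≤ K * ‖w‖ * ‖w'‖ := hzn
      _ ≤ K * (C * lam ^ m) * (C' * lam ^ m') := by gcongr
      _ = _ := by ring

lemma const (ζ : HSp d s) (R a : ℝ) : Growth ζ R (fun _ _ _ => a) 0 := by
  obtain ⟨w, hw⟩ := HSp.exists_const d s a
  exact ⟨‖w‖, norm_nonneg _, fun lam _ v _ => ⟨w, hw, by simp⟩⟩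

lemma sub_shift (ζ : HSp d s) (R : ℝ) : Growth ζ R (fun lam v x => v.val x - lam * ζ.val x) 0 := by
  refine ⟨max R 0, le_max_right _ _, fun lam _ v hv => ⟨v - lam • ζ, ?_, by simp [hv]⟩⟩
  filter_upwards [HSp.ae_sub v (lam • ζ), HSp.ae_smul lam ζ] with x h1 h2
  rw [h1, h2]

lemma shift (ζ : HSp d s) (R : ℝ) : Growth ζ R (fun lam _ x => lam * ζ.val x) 1 := by
  refine ⟨‖ζ‖, norm_nonneg _, fun lam hl v _ => ⟨lam • ζ, HSp.ae_smul lam ζ, ?_⟩⟩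
  rw [norm_smul, Real.norm_of_nonneg (by linarith), pow_one, mul_comm]

lemma self (ζ : HSp d s) (R : ℝ) : Growth ζ R (fun _ v x => v.val x) 1 :=
  ((sub_shift ζ R).mono (Nat.zero_le 1)).add (shift ζ R) |>.congr
    fun lam v => ae_of_all _ fun x => by ring

lemma pow (hs : (d : ℝ) / 2 < s) (h : Growth ζ R F 1) (n : ℕ) :
    Growth ζ R (fun lam v x => F lam v x ^ n) n := by
  induction n with
  | zero => exact (const ζ R 1).congr fun lam v => ae_of_all _ fun x => by simp
  | succ n ih => exact (ih.mul hs h).congr fun lam v => ae_of_all _ fun x => by ring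

/-- Subtracting the leading part `lam^n ζ^n` from `v^n` lowers the order of growth by one. -/
lemma pow_sub_pow (hs : (d : ℝ) / 2 < s) (ζ : HSp d s) (R : ℝ) (n : ℕ) :
    Growth ζ R (fun lam v x => v.val x ^ (n + 1) - lam ^ (n + 1) * ζ.val x ^ (n + 1)) n := by
  induction n with
  | zero => exact (sub_shift ζ R).congr fun lam v => ae_of_all _ fun x => by simp
  | succ n ih =>
    have h1 := (self ζ R).mul hs ih
    have h2 := (sub_shift ζ R).mul hs ((shift ζ R).pow hs (n + 1))
    exact ((h1.mono (by omega)).add (h2.mono (by omega))).congr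
      fun lam v => ae_of_all _ fun x => by ring

lemma polynomial (hs : (d : ℝ) / 2 < s) (ζ : HSp d s) (R : ℝ) (P : Polynomial ℝ) {p : ℕ}
    (hp : P.natDegree = p + 1) :
    Growth ζ R (fun lam v x => P.eval (v.val x) -
      P.leadingCoeff * (lam ^ (p + 1) * ζ.val x ^ (p + 1))) p := by
  have hlow : ∀ n ≤ p + 1, Growth ζ R (fun _ v x => ∑ i ∈ Finset.range n, P.coeff i * v.val x ^ i)
      p := by
    intro n hn
    induction n with
    | zero =>
      refine ((const ζ R 0).mono (Nat.zero_le p)).congr fun lam v => ae_of_all _ fun x => ?_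
      simp
    | succ n ih =>
      refine ((ih (by omega)).add ((((self ζ R).pow hs n).mono (by omega : n ≤ p)).const_mul
        (P.coeff n))).congr fun lam v => ae_of_all _ fun x => ?_
      rw [Finset.sum_range_succ]
  refine ((hlow (p + 1) le_rfl).add ((pow_sub_pow hs ζ R p).const_mul P.leadingCoeff)).congr
    fun lam v => ae_of_all _ fun x => ?_
  rw [Polynomial.eval_eq_sum_range, hp, Finset.sum_range_succ _ (p + 1), Polynomial.leadingCoeff, hp]
  ring

end Growth

/-- A bounded smooth function on the line all of whose derivatives are bounded. -/
def BddSmooth (g : ℝ → ℝ) : Prop :=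
  ContDiff ℝ ∞ g ∧ ∀ n : ℕ, ∃ C : ℝ, ∀ y : ℝ, |iteratedDeriv n g y| ≤ C

namespace BddSmooth

variable {g : ℝ → ℝ}

lemma deriv (hg : BddSmooth g) : BddSmooth (deriv g) := by
  refine ⟨(contDiff_infty_iff_deriv.1 hg.1).2, fun n => ?_⟩
  obtain ⟨C, hC⟩ := hg.2 (n + 1)
  refine ⟨C, fun y => ?_⟩
  rw [← iteratedDeriv_succ']
  exact hC y

lemma bdd (hg : BddSmooth g) : ∃ C : ℝ, 0 ≤ C ∧ ∀ y, |g y| ≤ C := by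
  obtain ⟨C, hC⟩ := hg.2 0
  refine ⟨C, (abs_nonneg _).trans (hC 0), fun y => by simpa using hC y⟩

lemma lipschitz (hg : BddSmooth g) : ∃ C : ℝ, 0 ≤ C ∧ ∀ x y, |g x - g y| ≤ C * |x - y| := by
  obtain ⟨C, hC0, hC⟩ := hg.deriv.bdd
  refine ⟨C, hC0, fun x y => ?_⟩
  have := Convex.norm_image_sub_le_of_norm_deriv_le (f := g) (s := univ) (C := C) (x := y) (y := x)
    (fun z _ => (hg.1.differentiable (by simp)).differentiableAt) (fun z _ => hC z)
    convex_univ (mem_univ _) (mem_univ _)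
  simpa using this

lemma taylor (hg : BddSmooth g) :
    ∃ C : ℝ, ∀ x y, |g y - g x - _root_.deriv g x * (y - x)| ≤ C * (y - x) ^ 2 := by
  obtain ⟨C, hC0, hC⟩ := hg.deriv.lipschitz
  refine ⟨C, fun x y => ?_⟩
  have hd : ∀ z, HasDerivAt (fun z => g z - g x - _root_.deriv g x * (z - x))
      (_root_.deriv g z - _root_.deriv g x) z := fun z => by
    have h1 := (hg.1.differentiable (by simp)).differentiableAt (x := z) |>.hasDerivAt
    have h2 := ((hasDerivAt_id z).sub_const x).const_mul (_root_.deriv g x)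
    rw [mul_one] at h2
    exact (h1.sub_const (g x)).sub h2
  have := Convex.norm_image_sub_le_of_norm_hasDerivWithin_le
    (f := fun z => g z - g x - _root_.deriv g x * (z - x)) (s := uIcc x y) (C := C * |y - x|)
    (x := x) (y := y) (fun z _ => (hd z).hasDerivWithinAt)
    (fun z hz => (hC z x).trans (mul_le_mul_of_nonneg_left (abs_sub_left_of_mem_uIcc hz) hC0))
    (convex_uIcc x y) left_mem_uIcc right_mem_uIcc
  simp only [sub_self, mul_zero, sub_zero, Real.norm_eq_abs] at this
  rwa [mul_assoc, ← sq, sq_abs] at this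

end BddSmooth

lemma memLp_comp {g : ℝ → ℝ} (hg : Continuous g) {C : ℝ} (hC : ∀ y, |g y| ≤ C) (v : L2 d) :
    MemLp (fun x => g (v x)) 2 (torusMeasure d) :=
  MemLp.of_bound (hg.comp_aestronglyMeasurable (Lp.aestronglyMeasurable v)) C
    (ae_of_all _ fun _ => hC _)

lemma memLp_comp_mul {g : ℝ → ℝ} (hg : Continuous g) {C : ℝ} (hC : ∀ y, |g y| ≤ C) (v D : L2 d) :
    MemLp (fun x => g (v x) * D x) 2 (torusMeasure d) := by
  refine MemLp.of_le_mul (c := C) (Lp.memLp D)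
    ((hg.comp_aestronglyMeasurable (Lp.aestronglyMeasurable v)).mul (Lp.aestronglyMeasurable D))
    (ae_of_all _ fun x => ?_)
  rw [norm_mul]
  exact mul_le_mul_of_nonneg_right (hC _) (norm_nonneg _)

lemma seqE_zero_comp_mul_le {g : ℝ → ℝ} (hg : Continuous g) {C : ℝ} (hC : ∀ y, |g y| ≤ C)
    (v D : L2 d) : seqE 0 (fourierCoef fun x => g (v x) * D x) ≤
      ENNReal.ofReal C ^ 2 * seqE 0 (fourierCoef D) := by
  obtain ⟨w, hw⟩ := exists_L2_of_memLp (memLp_comp_mul hg hC v D)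
  rw [← fourierCoef_congr hw, ← lintegral_enorm_sq, ← lintegral_enorm_sq,
    ← lintegral_const_mul' _ _ (by finiteness)]
  refine lintegral_mono_ae ?_
  filter_upwards [hw] with x hx
  rw [hx, enorm_mul, mul_pow]
  gcongr
  rw [Real.enorm_eq_ofReal_abs]
  exact ENNReal.ofReal_le_ofReal (hC _)

/-- The derivatives of `g(v)`, with the derivatives of `v = (v - lam ζ) + lam ζ` split into a rough
bounded part and a smooth large part. -/
lemma seqE_comp_succ_le {g : ℝ → ℝ} (hg : BddSmooth g) (hs : 1 ≤ s) (ζ : HSp d (s + 2))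
    (lam : ℝ) (v : HSp d s) :
    ∃ U Z : Fin d → L2 d,
      (∀ j, seqE (s - 1) (fourierCoef (U j)) ≤
        ‖v - lam • HSp.incl (Nat.le_add_right s 2) ζ‖ₑ ^ 2) ∧
      (∀ j, seqE (s + 1) (fourierCoef (Z j)) ≤ ‖ζ‖ₑ ^ 2) ∧
      ∀ r : ℝ, seqE (r + 1) (fourierCoef fun x => g (v.val x)) ≤
        seqE r (fourierCoef fun x => g (v.val x)) +
        ∑ j, (2 * seqE r (fourierCoef fun x => deriv g (v.val x) * U j x) +
          2 * (ENNReal.ofReal (lam ^ 2) *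
            seqE r (fourierCoef fun x => deriv g (v.val x) * Z j x))) := by
  set u : HSp d s := v - lam • HSp.incl (Nat.le_add_right s 2) ζ with hu
  have hu1 : seqE 1 (fourierCoef u.val) ≠ ⊤ :=
    ne_top_of_le_ne_top u.seqE_ne_top (seqE_mono (by exact_mod_cast hs) _)
  have hζ1 : seqE 1 (fourierCoef ζ.val) ≠ ⊤ :=
    ne_top_of_le_ne_top ζ.seqE_ne_top (seqE_mono (by push_cast; linarith) _)
  choose U hU using fun j => exists_isPartial j hu1
  choose Z hZ using fun j => exists_isPartial j hζ1
  obtain ⟨C₀, hC₀, hgb⟩ := hg.bdd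
  obtain ⟨C₁, hC₁, hgb'⟩ := hg.deriv.bdd
  obtain ⟨C₂, hgt⟩ := hg.taylor
  refine ⟨U, Z, fun j => ?_, fun j => ?_, fun r => ?_⟩
  · rw [HSp.enorm_sq]
    simpa using (hU j).seqE_le ((s : ℝ) - 1)
  · rw [HSp.enorm_sq]
    refine ((hZ j).seqE_le _).trans (le_of_eq ?_)
    push_cast
    ring_nf
  obtain ⟨G, hG⟩ := exists_L2_of_memLp (memLp_comp hg.1.continuous hgb v.val)
  choose Q₁ hQ₁ using fun j =>
    exists_L2_of_memLp (memLp_comp_mul hg.deriv.1.continuous hgb' v.val (U j))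
  choose Q₂ hQ₂ using fun j =>
    exists_L2_of_memLp (memLp_comp_mul hg.deriv.1.continuous hgb' v.val (Z j))
  have hD : ∀ j, IsPartial j v.val (U j + lam • Z j) := fun j k => by
    have hv : v.val = u.val + lam • ζ.val := by
      rw [hu, HSp.val_sub, HSp.val_smul, HSp.incl_val]
      abel
    rw [hv, fourierCoef_add, fourierCoef_smul, fourierCoef_add, fourierCoef_smul, hU j k, hZ j k,
      Complex.real_smul, Complex.real_smul]
    ring
  have hQ : ∀ j, IsPartial j G (Q₁ j + lam • Q₂ j) := fun j => by
    refine (hD j).comp hgb' hgt hG ?_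
    filter_upwards [hQ₁ j, hQ₂ j, Lp.coeFn_add (Q₁ j) (lam • Q₂ j), Lp.coeFn_smul lam (Q₂ j),
      Lp.coeFn_add (U j) (lam • Z j), Lp.coeFn_smul lam (Z j)] with x h1 h2 h3 h4 h5 h6
    rw [h3, h5, Pi.add_apply, Pi.add_apply, h4, h6, Pi.smul_apply, Pi.smul_apply, h1, h2,
      smul_eq_mul, smul_eq_mul]
    ring
  rw [← fourierCoef_congr hG, seqE_succ]
  gcongr with j
  rw [← (hQ j).seqE_eq, ← fourierCoef_congr (hQ₁ j), ← fourierCoef_congr (hQ₂ j), ← seqE_smul]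
  have e : fourierCoef (Q₁ j + lam • Q₂ j : L2 d) =
      fourierCoef (Q₁ j) + lam • fourierCoef (Q₂ j) := by
    funext k
    rw [fourierCoef_add, fourierCoef_smul]
    rfl
  rw [e]
  exact seqE_add_le _ _ _

/-- `‖g(v)‖_σ = O(lam ^ σ)` for `v ∈ H^s` within `R` of `lam • ζ`. -/
def CompGrowth (ζ : HSp d (s + 2)) (R : ℝ) (g : ℝ → ℝ) (σ : ℝ) : Prop :=
  ∃ C : ℝ≥0∞, C ≠ ⊤ ∧ ∀ lam : ℝ, 1 ≤ lam → ∀ v : HSp d s,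
    ‖v - lam • HSp.incl (Nat.le_add_right s 2) ζ‖ ≤ R →
      seqE σ (fourierCoef fun x => g (v.val x)) ≤ C * ENNReal.ofReal (lam ^ (2 * σ))

namespace CompGrowth

variable {ζ : HSp d (s + 2)} {R : ℝ} {g : ℝ → ℝ}

lemma zero (hg : BddSmooth g) : CompGrowth ζ R g 0 := by
  obtain ⟨C, hC0, hC⟩ := hg.bdd
  obtain ⟨o, ho⟩ := HSp.exists_const d s 1
  refine ⟨ENNReal.ofReal C ^ 2 * seqE 0 (fourierCoef o.val), ?_, fun lam hl v _ => ?_⟩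
  · rw [seqE_zero_fourierCoef]; finiteness
  · have h := seqE_zero_comp_mul_le hg.1.continuous hC v.val o.val
    have e : fourierCoef (fun x => g (v.val x) * o.val x) = fourierCoef fun x => g (v.val x) := by
      refine fourierCoef_congr ?_
      filter_upwards [ho] with x hx
      rw [hx, mul_one]
    rw [e] at h
    simpa using h

/-- Interpolation with `L²`: `(x / lam²)^{σ'} ≤ 1 + (x / lam²)^σ` for `0 ≤ σ' ≤ σ`. -/
lemma of_le {σ σ' : ℝ} (h0 : CompGrowth ζ R g 0) (h : CompGrowth ζ R g σ) (hσ' : 0 ≤ σ')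
    (hσ : σ' ≤ σ) : CompGrowth ζ R g σ' := by
  obtain ⟨C₀, hC₀, h0⟩ := h0
  obtain ⟨C, hC, h⟩ := h
  refine ⟨C₀ + C, by finiteness, fun lam hl v hv => ?_⟩
  have hl0 : 0 < lam := by linarith
  have key : ∀ k : Fin d → ℤ, ENNReal.ofReal (wt k ^ σ') ≤ ENNReal.ofReal (lam ^ (2 * σ')) *
      (ENNReal.ofReal (wt k ^ (0 : ℝ)) + ENNReal.ofReal (lam ^ (-(2 * σ))) *
        ENNReal.ofReal (wt k ^ σ)) := fun k => by
    have hw := wt_pos k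
    rw [← ENNReal.ofReal_mul (by positivity), ← ENNReal.ofReal_add (by positivity) (by positivity),
      ← ENNReal.ofReal_mul (by positivity)]
    refine ENNReal.ofReal_le_ofReal ?_
    set x := wt k / lam ^ 2 with hx
    have hx0 : 0 < x := by positivity
    have e : ∀ t : ℝ, wt k ^ t = lam ^ (2 * t) * x ^ t := fun t => by
      rw [Real.rpow_mul hl0.le, Real.rpow_two, ← Real.mul_rpow (by positivity) hx0.le, hx]
      congr 1
      field_simp
    have h1 : x ^ σ' ≤ 1 + x ^ σ := by
      rcases le_total x 1 with h | h
      · linarith [Real.rpow_le_one hx0.le h hσ', Real.rpow_nonneg hx0.le σ]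
      · linarith [Real.rpow_le_rpow_of_exponent_le h hσ]
    have h2 : lam ^ (-(2 * σ)) * (lam ^ (2 * σ) * x ^ σ) = x ^ σ := by
      rw [← mul_assoc, ← Real.rpow_add hl0]
      simp
    rw [e σ', e σ, Real.rpow_zero, h2]
    gcongr
  calc seqE σ' (fourierCoef fun x => g (v.val x))
      ≤ ENNReal.ofReal (lam ^ (2 * σ')) * (seqE 0 (fourierCoef fun x => g (v.val x)) +
          ENNReal.ofReal (lam ^ (-(2 * σ))) * seqE σ (fourierCoef fun x => g (v.val x))) := by
        unfold seqE
        rw [← ENNReal.tsum_mul_left, ← ENNReal.tsum_add, ← ENNReal.tsum_mul_left]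
        refine ENNReal.tsum_le_tsum fun k => ?_
        rw [← mul_assoc (ENNReal.ofReal (lam ^ (-(2 * σ)))), ← add_mul, ← mul_assoc]
        gcongr
        exact key k
    _ ≤ ENNReal.ofReal (lam ^ (2 * σ')) * (C₀ * ENNReal.ofReal (lam ^ (2 * (0 : ℝ))) +
          ENNReal.ofReal (lam ^ (-(2 * σ))) * (C * ENNReal.ofReal (lam ^ (2 * σ)))) := by
        gcongr
        · exact h0 lam hl v hv
        · exact h lam hl v hv
    _ = _ := by
        rw [mul_left_comm (ENNReal.ofReal (lam ^ (-(2 * σ)))), ← ENNReal.ofReal_mul (by positivity),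
          ← Real.rpow_add hl0]
        simp [mul_comm]

lemma ofReal_rpow_le {lam a b : ℝ} (hl : 1 ≤ lam) (h : a ≤ b) :
    ENNReal.ofReal (lam ^ a) ≤ ENNReal.ofReal (lam ^ b) :=
  ENNReal.ofReal_le_ofReal (Real.rpow_le_rpow_of_exponent_le hl h)

lemma ofReal_sq_mul_rpow {lam a : ℝ} (hl : 1 ≤ lam) :
    ENNReal.ofReal (lam ^ 2) * ENNReal.ofReal (lam ^ a) = ENNReal.ofReal (lam ^ (a + 2)) := by
  have : 0 < lam := by linarith
  rw [← ENNReal.ofReal_mul (by positivity), Real.rpow_add this, Real.rpow_two, mul_comm]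

lemma enorm_sq_le_of_norm_le {u : HSp d s} (h : ‖u‖ ≤ R) :
    ‖u‖ₑ ^ 2 ≤ ENNReal.ofReal R ^ 2 := by
  rw [← ofReal_norm]
  gcongr

lemma one (hs : 1 ≤ s) (hg : BddSmooth g) : CompGrowth ζ R g 1 := by
  obtain ⟨C₀, hC₀, h0⟩ := zero (ζ := ζ) (R := R) hg
  obtain ⟨C₁, -, hC₁⟩ := hg.deriv.bdd
  refine ⟨C₀ + ∑ _j : Fin d, (2 * (ENNReal.ofReal C₁ ^ 2 * ENNReal.ofReal R ^ 2) +
    2 * (ENNReal.ofReal C₁ ^ 2 * ‖ζ‖ₑ ^ 2)), ?_, fun lam hl v hv => ?_⟩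
  · exact ENNReal.add_ne_top.2 ⟨hC₀, ENNReal.sum_ne_top.2 fun _ _ => by finiteness⟩
  obtain ⟨U, Z, hU, hZ, h⟩ := seqE_comp_succ_le hg hs ζ lam v
  have h1 := h 0
  rw [zero_add] at h1
  refine h1.trans ?_
  rw [add_mul, Finset.sum_mul]
  have h2l : (1 : ℝ≥0∞) ≤ ENNReal.ofReal (lam ^ (2 * (1 : ℝ))) := by
    rw [← ENNReal.ofReal_one]
    exact ENNReal.ofReal_le_ofReal (Real.one_le_rpow hl (by norm_num))
  refine add_le_add ((h0 lam hl v hv).trans (mul_le_mul' le_rfl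
    (ofReal_rpow_le hl (by norm_num)))) (Finset.sum_le_sum fun j _ => ?_)
  rw [add_mul]
  refine add_le_add ?_ ?_
  · calc _ ≤ 2 * (ENNReal.ofReal C₁ ^ 2 * seqE 0 (fourierCoef (U j))) := by
          gcongr
          exact seqE_zero_comp_mul_le hg.deriv.1.continuous hC₁ v.val (U j)
      _ ≤ 2 * (ENNReal.ofReal C₁ ^ 2 * ENNReal.ofReal R ^ 2) * 1 := by
          rw [mul_one]
          gcongr
          refine (seqE_mono ?_ _).trans ((hU j).trans (enorm_sq_le_of_norm_le hv))
          have : (1 : ℝ) ≤ s := by exact_mod_cast hs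
          linarith
      _ ≤ _ := by gcongr
  · calc _ ≤ 2 * (ENNReal.ofReal (lam ^ 2) *
          (ENNReal.ofReal C₁ ^ 2 * seqE 0 (fourierCoef (Z j)))) := by
          gcongr
          exact seqE_zero_comp_mul_le hg.deriv.1.continuous hC₁ v.val (Z j)
      _ ≤ 2 * (ENNReal.ofReal (lam ^ (2 * (1 : ℝ))) *
          (ENNReal.ofReal C₁ ^ 2 * ‖ζ‖ₑ ^ 2)) := by
          gcongr
          · norm_num
          · exact (seqE_mono (by positivity) _).trans (hZ j)
      _ = _ := by ring

/-- Each application of the chain rule gains a quarter of a derivative. Since `s - 1/4 > d/2`, the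
product of `g'(v) ∈ H^σ` and a function of `H^{s-1}` lies in `H^{σ - 3/4}`, while multiplication by
the smooth function `∂_j ζ` loses nothing; the factor `lam` it carries is paid for by the
derivative. -/
lemma step (hs1 : 1 ≤ s) (hs : (d : ℝ) / 2 < s) {σ : ℝ} (hσ1 : 1 ≤ σ) (hσs : σ + 1 / 4 ≤ s)
    (h : ∀ g, BddSmooth g → CompGrowth ζ R g σ) (hg : BddSmooth g) :
    CompGrowth ζ R g (σ + 1 / 4) := by
  -- `d < 2 s` between integers improves to `d + 1 ≤ 2 s`
  have hds : (d : ℝ) / 2 + 1 / 2 ≤ s := by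
    have h1 : (d : ℝ) < 2 * s := by linarith
    have h2 : d < 2 * s := by exact_mod_cast h1
    have h3 : (d : ℝ) + 1 ≤ 2 * s := by exact_mod_cast h2
    linarith
  set r : ℝ := σ - 3 / 4 with hr
  have hr0 : 0 ≤ r := by rw [hr]; linarith
  obtain ⟨C₀, hC₀, hg0⟩ := of_le (zero (ζ := ζ) (R := R) hg) (h g hg) hr0 (by rw [hr]; linarith)
  obtain ⟨C₁, hC₁, hg1⟩ := h _ hg.deriv
  obtain ⟨C₂, hC₂, hg2⟩ := of_le (zero (ζ := ζ) (R := R) hg.deriv) (h _ hg.deriv) hr0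
    (by rw [hr]; linarith)
  obtain ⟨B, -, hB⟩ := hg.deriv.bdd
  have hK₁ := prodConst_ne_top (d := d) (a := σ) (b := s - 1) (c := r) (by rw [hr]; linarith)
  have hK₂ := prodConst_ne_top (d := d) (a := r) (b := s + 1) (c := r) (by linarith)
  set K₁ := prodConst d σ (s - 1) r
  set K₂ := prodConst d r (s + 1) r
  refine ⟨C₀ + ∑ _j : Fin d, (2 * (K₁ * (C₁ * ENNReal.ofReal R ^ 2)) +
    2 * (K₂ * (C₂ * ‖ζ‖ₑ ^ 2))), ?_, fun lam hl v hv => ?_⟩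
  · exact ENNReal.add_ne_top.2 ⟨hC₀, ENNReal.sum_ne_top.2 fun _ _ => by finiteness⟩
  obtain ⟨U, Z, hU, hZ, hle⟩ := seqE_comp_succ_le hg hs1 ζ lam v
  have h1 := hle r
  rw [show r + 1 = σ + 1 / 4 by rw [hr]; ring] at h1
  refine h1.trans ?_
  rw [add_mul, Finset.sum_mul]
  obtain ⟨G', hG'⟩ := exists_L2_of_memLp (memLp_comp hg.deriv.1.continuous hB v.val)
  have hprod : ∀ D : L2 d, fourierCoef (fun x => deriv g (v.val x) * D x) =
      fourierCoef fun x => G' x * D x := fun D => by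
    refine fourierCoef_congr ?_
    filter_upwards [hG'] with x hx
    rw [hx]
  refine add_le_add ((hg0 lam hl v hv).trans (mul_le_mul' le_rfl
    (ofReal_rpow_le hl (by rw [hr]; linarith)))) (Finset.sum_le_sum fun j _ => ?_)
  rw [add_mul, hprod, hprod]
  refine add_le_add ?_ ?_
  · calc _ ≤ 2 * (K₁ * (seqE σ (fourierCoef G') * seqE (s - 1) (fourierCoef (U j)))) := by
          gcongr
          exact seqE_mul_le hr0 (by rw [hr]; linarith) (by rw [hr]; linarith) _ _
      _ ≤ 2 * (K₁ * ((C₁ * ENNReal.ofReal (lam ^ (2 * (σ + 1 / 4)))) * ENNReal.ofReal R ^ 2)) := by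
          gcongr
          · rw [fourierCoef_congr hG']
            exact (hg1 lam hl v hv).trans (mul_le_mul' le_rfl (ofReal_rpow_le hl (by linarith)))
          · exact (hU j).trans (enorm_sq_le_of_norm_le hv)
      _ = _ := by ring
  · calc _ ≤ 2 * (ENNReal.ofReal (lam ^ 2) *
          (K₂ * (seqE r (fourierCoef G') * seqE (s + 1) (fourierCoef (Z j))))) := by
          gcongr
          exact seqE_mul_le hr0 le_rfl (by rw [hr]; linarith) _ _
      _ ≤ 2 * (ENNReal.ofReal (lam ^ 2) *
          (K₂ * ((C₂ * ENNReal.ofReal (lam ^ (2 * r))) * ‖ζ‖ₑ ^ 2))) := by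
          gcongr
          · rw [fourierCoef_congr hG']
            exact hg2 lam hl v hv
          · exact hZ j
      _ = 2 * (K₂ * (C₂ * ‖ζ‖ₑ ^ 2)) *
          (ENNReal.ofReal (lam ^ 2) * ENNReal.ofReal (lam ^ (2 * r))) := by ring
      _ = _ := by
          rw [ofReal_sq_mul_rpow hl]
          congr 4
          rw [hr]; ring

lemma top (hs1 : 1 ≤ s) (hs : (d : ℝ) / 2 < s) (hg : BddSmooth g) : CompGrowth ζ R g s := by
  have h : ∀ n : ℕ, (1 : ℝ) + n / 4 ≤ s → ∀ g, BddSmooth g → CompGrowth ζ R g (1 + n / 4) := by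
    intro n
    induction n with
    | zero => intro _ g hg; simpa using one hs1 hg
    | succ n ih =>
      intro hn g hg
      have hn' : (1 : ℝ) + n / 4 + 1 / 4 ≤ s := by push_cast at hn; linarith
      have := step hs1 hs (σ := 1 + n / 4) (by linarith [show (0 : ℝ) ≤ n / 4 by positivity]) hn'
        (ih (by linarith)) hg
      convert this using 1
      push_cast
      ring
  have e : (1 : ℝ) + (4 * (s - 1) : ℕ) / 4 = s := by
    push_cast [Nat.cast_sub hs1]
    ring
  have := h (4 * (s - 1)) e.le g hg
  rwa [e] at this

end CompGrowth

lemma Growth.bddSmooth (hs1 : 1 ≤ s) (hs : (d : ℝ) / 2 < s) {g : ℝ → ℝ} (hg : BddSmooth g)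
    (ζ : HSp d (s + 2)) (R : ℝ) :
    Growth (HSp.incl (Nat.le_add_right s 2) ζ) R (fun _ v x => g (v.val x)) s := by
  obtain ⟨C, hC, h⟩ := CompGrowth.top (ζ := ζ) (R := R) hs1 hs hg
  obtain ⟨B, -, hB⟩ := hg.bdd
  refine ⟨Real.sqrt C.toReal, Real.sqrt_nonneg _, fun lam hl v hv => ?_⟩
  obtain ⟨w, hw⟩ := exists_L2_of_memLp (memLp_comp hg.1.continuous hB v.val)
  have h1 := h lam hl v hv
  have hl0 : 0 < lam := by linarith
  rw [← fourierCoef_congr hw] at h1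
  refine ⟨⟨w, (mem_sobolev_iff w).2 (ne_top_of_le_ne_top (by finiteness) h1)⟩, hw, ?_⟩
  rw [HSp.norm_le_iff _ (by positivity)]
  refine h1.trans (le_of_eq ?_)
  rw [mul_pow, Real.sq_sqrt ENNReal.toReal_nonneg, ENNReal.ofReal_mul (by positivity),
    ENNReal.ofReal_toReal hC, mul_comm 2 (s : ℝ), Real.rpow_mul hl0.le, Real.rpow_two,
    Real.rpow_natCast]

end Nonlinearity

/-! ### The scalar Duhamel formula -/

section ScalarDuhamel

/-- The kernel `e^{-x(t-τ)}` of the scalar equation `z' = -x z + w`, extended by zero to `τ > t`. -/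
def kern (x t τ : ℝ) : ℝ≥0∞ := if τ ≤ t then ENNReal.ofReal (Real.exp (-(x * (t - τ)))) else 0

/-- The solution `∫_a^t e^{-x(t-τ)} w(τ) dτ` of `z' = -x z + w`, `z(a) = 0`. -/
def duh (x a : ℝ) (w : ℝ → ℂ) (t : ℝ) : ℂ := ∫ τ in a..t, Real.exp (-(x * (t - τ))) • w τ

variable {a b x ν q t : ℝ} {w : ℝ → ℂ}

lemma measurable_kern (x : ℝ) : Measurable fun z : ℝ × ℝ => kern x z.1 z.2 := by
  unfold kern
  refine Measurable.ite (measurableSet_le measurable_snd measurable_fst) ?_ measurable_const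
  fun_prop

lemma kern_le_one (hx : 0 ≤ x) (t τ : ℝ) : kern x t τ ≤ 1 := by
  unfold kern
  split_ifs with h
  · rw [← ENNReal.ofReal_one]
    refine ENNReal.ofReal_le_ofReal (Real.exp_le_one_iff.2 ?_)
    nlinarith [mul_nonneg hx (sub_nonneg.2 h)]
  · exact zero_le

lemma integral_exp_bound (hν : 0 < ν) (hq : 0 ≤ q) {l : ℝ} (hl : 0 ≤ l) :
    (1 + q) * ∫ τ in (0 : ℝ)..l, Real.exp (-(ν * q * τ)) ≤ l + 1 / ν := by
  have hx : 0 ≤ ν * q := by positivity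
  have h1 : ∫ τ in (0 : ℝ)..l, Real.exp (-(ν * q * τ)) ≤ l := by
    calc _ ≤ ∫ _τ in (0 : ℝ)..l, (1 : ℝ) := by
          refine intervalIntegral.integral_mono_on hl
            (Continuous.intervalIntegrable (by fun_prop) _ _) (by simp) fun τ hτ => ?_
          refine Real.exp_le_one_iff.2 ?_
          nlinarith [mul_nonneg hx hτ.1]
      _ = l := by simp
  have h2 : ν * q * ∫ τ in (0 : ℝ)..l, Real.exp (-(ν * q * τ)) ≤ 1 := by
    have hd : ∀ τ ∈ uIcc 0 l, HasDerivAt (fun τ => -Real.exp (-(ν * q * τ)))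
        (ν * q * Real.exp (-(ν * q * τ))) τ := fun τ _ => by
      have := (((hasDerivAt_id τ).const_mul (ν * q)).neg.exp).neg
      exact this.congr_deriv (by simp; ring)
    rw [← intervalIntegral.integral_const_mul, intervalIntegral.integral_eq_sub_of_hasDerivAt hd
      (Continuous.intervalIntegrable (by fun_prop) _ _)]
    simp only [mul_zero, neg_zero, Real.exp_zero]
    linarith [Real.exp_pos (-(ν * q * l))]
  have h3 : q * ∫ τ in (0 : ℝ)..l, Real.exp (-(ν * q * τ)) ≤ 1 / ν := by
    rw [le_div_iff₀ hν]
    linarith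
  linarith

lemma lintegral_exp_bound (hν : 0 < ν) (hq : 0 ≤ q) {l : ℝ} (hl : 0 ≤ l) :
    ENNReal.ofReal (1 + q) * ∫⁻ τ in Icc 0 l, ENNReal.ofReal (Real.exp (-(ν * q * τ))) ≤
      ENNReal.ofReal (l + 1 / ν) := by
  rw [← ofReal_integral_eq_lintegral_ofReal
    ((Continuous.continuousOn (by fun_prop)).integrableOn_Icc) (ae_of_all _ fun τ => (Real.exp_pos _).le),
    ← ENNReal.ofReal_mul (by positivity), integral_Icc_eq_integral_Ioc,
    ← intervalIntegral.integral_of_le hl]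
  exact ENNReal.ofReal_le_ofReal (integral_exp_bound hν hq hl)

lemma lintegral_kern_left (hν : 0 < ν) (hq : 0 ≤ q) (hab : a ≤ b) (t : ℝ) (ht : t ∈ Icc a b) :
    ENNReal.ofReal (1 + q) * ∫⁻ τ in Icc a b, kern (ν * q) t τ ≤
      ENNReal.ofReal (b - a + 1 / ν) := by
  refine le_trans (mul_le_mul' le_rfl ?_) (lintegral_exp_bound hν hq (sub_nonneg.2 hab))
  rw [← lintegral_indicator measurableSet_Icc, ← lintegral_indicator measurableSet_Icc,
    ← lintegral_sub_left_eq_self _ t]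
  refine lintegral_mono fun σ => ?_
  by_cases hσ : t - σ ∈ Icc a b
  · by_cases h0 : 0 ≤ σ
    · have hσ' : σ ∈ Icc 0 (b - a) := ⟨h0, by linarith [hσ.1, ht.2]⟩
      rw [indicator_of_mem hσ, indicator_of_mem hσ', kern, if_pos (by linarith)]
      simp
    · rw [indicator_of_mem hσ, kern, if_neg (by linarith)]
      exact zero_le
  · rw [indicator_of_notMem hσ]
    exact zero_le

lemma lintegral_kern_right (hν : 0 < ν) (hq : 0 ≤ q) (hab : a ≤ b) (τ : ℝ) (hτ : τ ∈ Icc a b) :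
    ENNReal.ofReal (1 + q) * ∫⁻ t in Icc a b, kern (ν * q) t τ ≤
      ENNReal.ofReal (b - a + 1 / ν) := by
  refine le_trans (mul_le_mul' le_rfl ?_) (lintegral_exp_bound hν hq (sub_nonneg.2 hab))
  rw [← lintegral_indicator measurableSet_Icc, ← lintegral_indicator measurableSet_Icc,
    ← lintegral_add_right_eq_self _ τ]
  refine lintegral_mono fun σ => ?_
  by_cases hσ : σ + τ ∈ Icc a b
  · by_cases h0 : 0 ≤ σ
    · have hσ' : σ ∈ Icc 0 (b - a) := ⟨h0, by linarith [hσ.2, hτ.1]⟩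
      rw [indicator_of_mem hσ, indicator_of_mem hσ', kern, if_pos (by linarith)]
      simp
    · rw [indicator_of_mem hσ, kern, if_neg (by linarith)]
      exact zero_le
  · rw [indicator_of_notMem hσ]
    exact zero_le

lemma enorm_duh_le (ht : t ∈ Icc a b) :
    ‖duh x a w t‖ₑ ≤ ∫⁻ τ in Icc a b, kern x t τ * ‖w τ‖ₑ := by
  unfold duh
  rw [intervalIntegral.integral_of_le ht.1]
  refine (enorm_integral_le_lintegral_enorm _).trans ?_
  calc ∫⁻ τ in Ioc a t, ‖Real.exp (-(x * (t - τ))) • w τ‖ₑ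
      = ∫⁻ τ in Ioc a t, kern x t τ * ‖w τ‖ₑ := by
        refine setLIntegral_congr_fun measurableSet_Ioc fun τ hτ => ?_
        rw [enorm_smul, kern, if_pos hτ.2, Real.enorm_eq_ofReal (Real.exp_pos _).le]
    _ ≤ _ := lintegral_mono_set (Ioc_subset_Icc_self.trans (Icc_subset_Icc_right ht.2))

/-- Cauchy–Schwarz with respect to the measure `e^{-x(t-τ)} dτ`, as in Schur's test. -/
lemma enorm_duh_sq_le (hw : AEStronglyMeasurable w (volume.restrict (Icc a b)))
    (ht : t ∈ Icc a b) : ‖duh x a w t‖ₑ ^ 2 ≤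
      (∫⁻ τ in Icc a b, kern x t τ) * ∫⁻ τ in Icc a b, kern x t τ * ‖w τ‖ₑ ^ 2 := by
  have hk : Measurable fun τ => kern x t τ :=
    (measurable_kern x).comp (measurable_const.prodMk measurable_id)
  have h := lintegral_mul_sq_le (μ := volume.restrict (Icc a b))
    (f := fun τ => kern x t τ ^ (1 / 2 : ℝ)) (g := fun τ => kern x t τ ^ (1 / 2 : ℝ) * ‖w τ‖ₑ)
    (hk.pow_const _).aemeasurable ((hk.pow_const _).aemeasurable.mul hw.enorm)
  have h2 : ∀ y : ℝ≥0∞, y ^ (1 / 2 : ℝ) * y ^ (1 / 2 : ℝ) = y := fun y => by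
    rw [← ENNReal.rpow_add_of_nonneg _ _ (by norm_num) (by norm_num)]; norm_num
  simp only [← mul_assoc, mul_pow, sq (kern x t _ ^ (1 / 2 : ℝ)), h2] at h
  exact (pow_le_pow_left₀ zero_le (enorm_duh_le ht) 2).trans h

/-- `|z(t)|² ≤ (b-a) ∫ |w|²`. -/
lemma enorm_duh_sq_le_length (hx : 0 ≤ x) (hw : AEStronglyMeasurable w (volume.restrict (Icc a b)))
    (ht : t ∈ Icc a b) :
    ‖duh x a w t‖ₑ ^ 2 ≤ ENNReal.ofReal (b - a) * ∫⁻ τ in Icc a b, ‖w τ‖ₑ ^ 2 := by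
  refine (enorm_duh_sq_le hw ht).trans (mul_le_mul' ?_ (lintegral_mono fun τ => ?_))
  · calc ∫⁻ τ in Icc a b, kern x t τ ≤ ∫⁻ _τ in Icc a b, 1 :=
          lintegral_mono fun τ => kern_le_one hx t τ
      _ = _ := by simp
  · exact mul_le_of_le_one_left zero_le (kern_le_one hx t τ)

/-- The parabolic gain of one derivative, pointwise in time. -/
lemma enorm_duh_sq_le_smoothing (hν : 0 < ν) (hq : 0 ≤ q) (hab : a ≤ b)
    (hw : AEStronglyMeasurable w (volume.restrict (Icc a b))) (ht : t ∈ Icc a b) :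
    ENNReal.ofReal (1 + q) * ‖duh (ν * q) a w t‖ₑ ^ 2 ≤
      ENNReal.ofReal (b - a + 1 / ν) * ∫⁻ τ in Icc a b, ‖w τ‖ₑ ^ 2 := by
  calc _ ≤ ENNReal.ofReal (1 + q) * ((∫⁻ τ in Icc a b, kern (ν * q) t τ) *
        ∫⁻ τ in Icc a b, kern (ν * q) t τ * ‖w τ‖ₑ ^ 2) :=
        mul_le_mul' le_rfl (enorm_duh_sq_le hw ht)
    _ = (ENNReal.ofReal (1 + q) * ∫⁻ τ in Icc a b, kern (ν * q) t τ) *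
        ∫⁻ τ in Icc a b, kern (ν * q) t τ * ‖w τ‖ₑ ^ 2 := by ring
    _ ≤ _ := mul_le_mul' (lintegral_kern_left hν hq hab t ht) (lintegral_mono fun τ =>
        mul_le_of_le_one_left zero_le (kern_le_one (by positivity) t τ))

/-- The parabolic gain of two derivatives, square-integrated in time. -/
lemma lintegral_duh_sq_le (hν : 0 < ν) (hq : 0 ≤ q) (hab : a ≤ b)
    (hw : AEStronglyMeasurable w (volume.restrict (Icc a b))) :
    ENNReal.ofReal (1 + q) ^ 2 * ∫⁻ t in Icc a b, ‖duh (ν * q) a w t‖ₑ ^ 2 ≤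
      ENNReal.ofReal (b - a + 1 / ν) ^ 2 * ∫⁻ τ in Icc a b, ‖w τ‖ₑ ^ 2 := by
  set M := ENNReal.ofReal (b - a + 1 / ν) with hM
  set Q := ENNReal.ofReal (1 + q) with hQ
  have h1 : ∀ t ∈ Icc a b, Q ^ 2 * ‖duh (ν * q) a w t‖ₑ ^ 2 ≤
      M * (Q * ∫⁻ τ in Icc a b, kern (ν * q) t τ * ‖w τ‖ₑ ^ 2) := fun t ht => by
    calc _ ≤ Q ^ 2 * ((∫⁻ τ in Icc a b, kern (ν * q) t τ) *
          ∫⁻ τ in Icc a b, kern (ν * q) t τ * ‖w τ‖ₑ ^ 2) :=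
          mul_le_mul' le_rfl (enorm_duh_sq_le hw ht)
      _ = (Q * ∫⁻ τ in Icc a b, kern (ν * q) t τ) *
          (Q * ∫⁻ τ in Icc a b, kern (ν * q) t τ * ‖w τ‖ₑ ^ 2) := by ring
      _ ≤ _ := mul_le_mul' (lintegral_kern_left hν hq hab t ht) le_rfl
  have hmeas : AEMeasurable (Function.uncurry fun t τ => kern (ν * q) t τ * ‖w τ‖ₑ ^ 2)
      ((volume.restrict (Icc a b)).prod (volume.restrict (Icc a b))) :=
    (measurable_kern _).aemeasurable.mul ((hw.enorm.pow_const 2).comp_quasiMeasurePreserving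
      Measure.quasiMeasurePreserving_snd)
  rw [← lintegral_const_mul' _ _ (by finiteness)]
  calc _ ≤ ∫⁻ t in Icc a b, M * (Q * ∫⁻ τ in Icc a b, kern (ν * q) t τ * ‖w τ‖ₑ ^ 2) :=
        setLIntegral_mono' measurableSet_Icc h1
    _ = M * (Q * ∫⁻ τ in Icc a b, ∫⁻ t in Icc a b, kern (ν * q) t τ * ‖w τ‖ₑ ^ 2) := by
        rw [lintegral_const_mul' _ _ (by finiteness), lintegral_const_mul' _ _ (by finiteness),
          lintegral_lintegral_swap hmeas]
    _ = M * ∫⁻ τ in Icc a b, (Q * ∫⁻ t in Icc a b, kern (ν * q) t τ) * ‖w τ‖ₑ ^ 2 := by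
        rw [← lintegral_const_mul' _ _ (by finiteness)]
        congr 2
        funext τ
        rw [lintegral_mul_const' _ _ (by finiteness), mul_assoc]
    _ ≤ M * ∫⁻ τ in Icc a b, M * ‖w τ‖ₑ ^ 2 := by
        refine mul_le_mul' le_rfl (setLIntegral_mono' measurableSet_Icc fun τ hτ => ?_)
        exact mul_le_mul' (lintegral_kern_right hν hq hab τ hτ) le_rfl
    _ = _ := by
        rw [lintegral_const_mul' _ _ (by finiteness)]
        ring

lemma duh_eq (x a : ℝ) (w : ℝ → ℂ) (t : ℝ) :
    duh x a w t = Real.exp (-(x * t)) • ∫ τ in a..t, Real.exp (x * τ) • w τ := by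
  unfold duh
  rw [← intervalIntegral.integral_smul]
  refine intervalIntegral.integral_congr fun τ _ => ?_
  simp only [smul_smul, ← Real.exp_add]
  ring_nf

lemma integrableOn_exp_smul (hw : IntegrableOn w (Icc a b)) (f : ℝ → ℝ) (hf : Continuous f) :
    IntegrableOn (fun τ => f τ • w τ) (Icc a b) :=
  hw.continuousOn_smul hf.continuousOn isCompact_Icc

lemma continuousOn_duh (x : ℝ) (hw : IntegrableOn w (Icc a b)) :
    ContinuousOn (duh x a w) (Icc a b) := by
  rcases lt_or_ge b a with h | h
  · rw [Icc_eq_empty_of_lt h]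
    exact continuousOn_empty _
  have h1 : ContinuousOn (fun t => ∫ τ in a..t, Real.exp (x * τ) • w τ) (Icc a b) := by
    rw [← uIcc_of_le h] at hw ⊢
    refine intervalIntegral.continuousOn_primitive_interval ?_
    rw [uIcc_of_le h] at hw ⊢
    exact integrableOn_exp_smul hw (fun τ => Real.exp (x * τ)) (by fun_prop)
  refine ContinuousOn.congr ?_ fun t _ => duh_eq x a w t
  exact (by fun_prop : Continuous fun t => Real.exp (-(x * t))).continuousOn.smul h1

lemma intervalIntegrable_of_integrableOn_Icc {t : ℝ} (hw : IntegrableOn w (Icc a b))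
    (ht : t ∈ Icc a b) : IntervalIntegrable w volume a t :=
  (intervalIntegrable_iff_integrableOn_Ioc_of_le ht.1).2
    (hw.mono_set fun _ hτ => ⟨hτ.1.le, hτ.2.trans ht.2⟩)

lemma duh_add {w' : ℝ → ℂ} (hw : IntegrableOn w (Icc a b)) (hw' : IntegrableOn w' (Icc a b))
    (ht : t ∈ Icc a b) :
    duh x a (fun τ => w τ + w' τ) t = duh x a w t + duh x a w' t := by
  unfold duh
  simp only [smul_add]
  exact intervalIntegral.integral_add
    (intervalIntegrable_of_integrableOn_Icc
      (integrableOn_exp_smul hw (fun τ => Real.exp (-(x * (t - τ)))) (by fun_prop)) ht)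
    (intervalIntegrable_of_integrableOn_Icc
      (integrableOn_exp_smul hw' (fun τ => Real.exp (-(x * (t - τ)))) (by fun_prop)) ht)

lemma duh_conj (x a : ℝ) (w : ℝ → ℂ) (t : ℝ) :
    duh x a (fun τ => (starRingEnd ℂ) (w τ)) t = (starRingEnd ℂ) (duh x a w t) := by
  unfold duh
  rw [← intervalIntegral.intervalIntegral_conj]
  simp only [Complex.real_smul, map_mul, Complex.conj_ofReal]

/-- The Duhamel formula solves the integrated equation, for merely integrable `w`: exchange the order
of integration in `∫_a^t x z`. -/
lemma duh_integral_eq (hw : IntegrableOn w (Icc a b)) (ht : t ∈ Icc a b) :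
    duh x a w t = ∫ τ in a..t, (-(x : ℂ) * duh x a w τ + w τ) := by
  have hwt : IntegrableOn w (Ioc a t) := hw.mono_set fun _ hτ => ⟨hτ.1.le, hτ.2.trans ht.2⟩
  have hduh : IntervalIntegrable (duh x a w) volume a t :=
    ((continuousOn_duh x hw).mono (by
      rw [uIcc_of_le ht.1]
      exact Icc_subset_Icc_right ht.2)).intervalIntegrable
  rw [intervalIntegral.integral_add (hduh.const_mul _)
    (intervalIntegrable_of_integrableOn_Icc hw ht), intervalIntegral.integral_const_mul]
  set μ := volume.restrict (Ioc a t) with hμ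
  -- the integrand of the double integral, on the triangle `τ ≤ σ`
  set K : ℝ → ℝ → ℝ := fun σ τ => if τ ≤ σ then Real.exp (-(x * (σ - τ))) else 0 with hK
  have hKm : Measurable (Function.uncurry K) := by
    refine Measurable.ite (measurableSet_le measurable_snd measurable_fst) ?_ measurable_const
    fun_prop
  have hKb : ∀ᵐ z ∂(μ.prod μ), ‖(Function.uncurry K z : ℝ)‖ ≤ Real.exp (|x| * (t - a)) := by
    have hm : ∀ᵐ z ∂(μ.prod μ), z ∈ Ioc a t ×ˢ Ioc a t := by
      rw [hμ, Measure.prod_restrict]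
      exact ae_restrict_mem (measurableSet_Ioc.prod measurableSet_Ioc)
    filter_upwards [hm] with z hz
    simp only [Function.uncurry, hK]
    split_ifs with h
    · rw [Real.norm_of_nonneg (Real.exp_pos _).le]
      refine Real.exp_le_exp.2 ?_
      have h1 : -x * (z.1 - z.2) ≤ |x| * (z.1 - z.2) :=
        mul_le_mul_of_nonneg_right (neg_le_abs x) (by linarith)
      have h2 : |x| * (z.1 - z.2) ≤ |x| * (t - a) :=
        mul_le_mul_of_nonneg_left (by linarith [hz.1.2, hz.2.1]) (abs_nonneg x)
      linarith
    · simpa using (Real.exp_pos _).le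
  have hint : Integrable (Function.uncurry fun σ τ => K σ τ • w τ) (μ.prod μ) := by
    have h1 : Integrable (fun z : ℝ × ℝ => w z.2) (μ.prod μ) := Integrable.comp_snd hwt μ
    exact h1.bdd_smul (Real.exp (|x| * (t - a))) hKm.aestronglyMeasurable hKb
  have e1 : ∫ τ in a..t, duh x a w τ = ∫ σ, ∫ τ, K σ τ • w τ ∂μ ∂μ := by
    rw [intervalIntegral.integral_of_le ht.1]
    refine setIntegral_congr_fun measurableSet_Ioc fun σ hσ => ?_
    simp only [duh]
    rw [intervalIntegral.integral_of_le hσ.1.le, hμ,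
      ← integral_indicator measurableSet_Ioc, ← integral_indicator measurableSet_Ioc]
    congr 1
    funext τ
    by_cases h : τ ∈ Ioc a σ
    · rw [indicator_of_mem h, indicator_of_mem (s := Ioc a t) ⟨h.1, h.2.trans hσ.2⟩]
      simp only [hK]
      rw [if_pos h.2]
    · rw [indicator_of_notMem h]
      by_cases h' : τ ∈ Ioc a t
      · rw [indicator_of_mem h']
        simp only [hK]
        rw [if_neg fun h2 => h ⟨h'.1, h2⟩, zero_smul]
      · rw [indicator_of_notMem h']
  have e2 : ∀ τ ∈ Ioc a t, (x : ℂ) * ∫ σ, K σ τ • w τ ∂μ =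
      w τ - Real.exp (-(x * (t - τ))) • w τ := fun τ hτ => by
    have h1 : ∫ σ, K σ τ ∂μ = ∫ σ in τ..t, Real.exp (-(x * (σ - τ))) := by
      rw [intervalIntegral.integral_of_le hτ.2, hμ, ← integral_Icc_eq_integral_Ioc (x := τ),
        ← integral_indicator measurableSet_Ioc, ← integral_indicator measurableSet_Icc]
      congr 1
      funext σ
      by_cases h : σ ∈ Icc τ t
      · rw [indicator_of_mem h, indicator_of_mem (s := Ioc a t) ⟨hτ.1.trans_le h.1, h.2⟩]
        simp only [hK]
        rw [if_pos h.1]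
      · rw [indicator_of_notMem h]
        by_cases h' : σ ∈ Ioc a t
        · rw [indicator_of_mem h']
          simp only [hK]
          rw [if_neg fun h2 => h ⟨h2, h'.2⟩]
        · rw [indicator_of_notMem h']
    have h2 : x * ∫ σ in τ..t, Real.exp (-(x * (σ - τ))) = 1 - Real.exp (-(x * (t - τ))) := by
      have hd : ∀ σ ∈ uIcc τ t, HasDerivAt (fun σ => -Real.exp (-(x * (σ - τ))))
          (x * Real.exp (-(x * (σ - τ)))) σ := fun σ _ => by
        have := ((((hasDerivAt_id σ).sub_const τ).const_mul x).neg.exp).neg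
        exact this.congr_deriv (by simp; ring)
      rw [← intervalIntegral.integral_const_mul, intervalIntegral.integral_eq_sub_of_hasDerivAt hd
        (Continuous.intervalIntegrable (by fun_prop) _ _)]
      simp
      ring
    rw [integral_smul_const, h1, ← Complex.real_smul, smul_smul, h2, sub_smul, one_smul]
  rw [e1, integral_integral_swap hint, neg_mul, ← integral_const_mul, hμ,
    setIntegral_congr_fun measurableSet_Ioc e2, integral_sub hwt, ← intervalIntegral.integral_of_le
    ht.1, ← intervalIntegral.integral_of_le ht.1]
  · unfold duh
    ring
  · exact (integrableOn_exp_smul hw (fun τ => Real.exp (-(x * (t - τ)))) (by fun_prop)).mono_set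
      fun _ hτ => ⟨hτ.1.le, hτ.2.trans ht.2⟩

lemma mild_integral_eq (hw : IntegrableOn w (Icc a b)) (ht : t ∈ Icc a b) (c : ℂ) :
    Real.exp (-(x * (t - a))) • c + duh x a w t =
      c + ∫ τ in a..t, (-(x : ℂ) * (Real.exp (-(x * (τ - a))) • c + duh x a w τ) + w τ) := by
  have hd : ∀ σ ∈ uIcc a t, HasDerivAt (fun σ => Real.exp (-(x * (σ - a))) • c)
      (-(x : ℂ) * (Real.exp (-(x * (σ - a))) • c)) σ := fun σ _ => by
    have := (((((hasDerivAt_id σ).sub_const a).const_mul x).neg.exp)).smul_const c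
    refine this.congr_deriv ?_
    simp only [Complex.real_smul, id_eq, mul_one, Pi.neg_apply]
    push_cast
    ring
  have hc : Continuous fun σ : ℝ => -(x : ℂ) * (Real.exp (-(x * (σ - a))) • c) := by fun_prop
  have h1 := intervalIntegral.integral_eq_sub_of_hasDerivAt hd (hc.intervalIntegrable _ _)
  have hduh : IntervalIntegrable (duh x a w) volume a t :=
    ((continuousOn_duh x hw).mono (by
      rw [uIcc_of_le ht.1]
      exact Icc_subset_Icc_right ht.2)).intervalIntegrable
  have h2 := duh_integral_eq (x := x) hw ht
  have h3 : ∫ τ in a..t, (-(x : ℂ) * (Real.exp (-(x * (τ - a))) • c + duh x a w τ) + w τ) =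
      (∫ τ in a..t, -(x : ℂ) * (Real.exp (-(x * (τ - a))) • c)) +
        ∫ τ in a..t, (-(x : ℂ) * duh x a w τ + w τ) := by
    rw [← intervalIntegral.integral_add (hc.intervalIntegrable _ _)
      ((hduh.const_mul _).add (intervalIntegrable_of_integrableOn_Icc hw ht))]
    congr 1
    funext τ
    ring
  rw [h3, h1, ← h2]
  simp
  ring

end ScalarDuhamel

/-! ### Mild solutions of the linear equation -/

section Linear

variable {d s : ℕ}

/-- The `k`-th Fourier coefficient as a continuous linear functional on `H^s`. -/
def HSp.coefCLM (s : ℕ) (k : Fin d → ℤ) : HSp d s →L[ℝ] ℂ := (coefL2 k).comp (HSp.toL2CLM d s)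

lemma HSp.isometry_toSeq :
    Isometry (HSp.toSeq : HSp d s → lp (fun _ : Fin d → ℤ => ℂ) 2) :=
  AddMonoidHomClass.isometry_of_norm _ fun _ => rfl

/-- An `H^s`-valued curve is strongly measurable once its Fourier coefficients are measurable: it is
a limit of finite Fourier sums. -/
lemma HSp.aestronglyMeasurable {μ : Measure ℝ} {v : ℝ → HSp d s}
    (h : ∀ k, AEStronglyMeasurable (fun t => fourierCoef (v t).val k) μ) :
    AEStronglyMeasurable v μ := by
  rw [← HSp.isometry_toSeq.isEmbedding.aestronglyMeasurable_comp_iff]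
  refine aestronglyMeasurable_of_tendsto_ae (u := (atTop : Filter (Finset (Fin d → ℤ))))
    (f := fun A t => ∑ k ∈ A, lp.singleContinuousLinearMap ℝ (fun _ : Fin d → ℤ => ℂ) 2 k
      (Real.sqrt (wt k ^ s) • fourierCoef (v t).val k)) (fun A => ?_) (ae_of_all _ fun t => ?_)
  · refine Finset.aestronglyMeasurable_fun_sum A fun k _ => ?_
    exact (ContinuousLinearMap.continuous _).comp_aestronglyMeasurable ((h k).const_smul (Real.sqrt (wt k ^ s)))
  · exact lp.hasSum_single (by norm_num) (HSp.toSeq (v t))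

/-- A curve in `H^s` whose Fourier coefficients are continuous, with uniformly small tails, is
continuous. -/
lemma HSp.continuousOn_of_coef {S : Set ℝ} {u : ℝ → HSp d s}
    (hc : ∀ k, ContinuousOn (fun t => fourierCoef (u t).val k) S) {m : (Fin d → ℤ) → ℝ≥0∞}
    (hm : ∑' k, m k ≠ ⊤)
    (hb : ∀ t ∈ S, ∀ k, ENNReal.ofReal (wt k ^ (s : ℝ)) * ‖fourierCoef (u t).val k‖ₑ ^ 2 ≤ m k) :
    ContinuousOn u S := by
  intro t₀ ht₀
  have hmk : ∀ k, m k ≠ ⊤ := ENNReal.ne_top_of_tsum_ne_top hm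
  have hb' : ∀ t ∈ S, ∀ k, wt k ^ (s : ℝ) * ‖fourierCoef (u t).val k‖ ^ 2 ≤ (m k).toReal := by
    intro t ht k
    have := ENNReal.toReal_mono (hmk k) (hb t ht k)
    rwa [ENNReal.toReal_mul, ENNReal.toReal_ofReal (Real.rpow_nonneg (wt_pos k).le _),
      ENNReal.toReal_pow, toReal_enorm] at this
  have hsq : ∀ t, ‖u t - u t₀‖ ^ 2 = ∑' k : Fin d → ℤ,
      wt k ^ (s : ℝ) * ‖fourierCoef (u t).val k - fourierCoef (u t₀).val k‖ ^ 2 := fun t => by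
    rw [HSp.norm_sq]
    refine tsum_congr fun k => ?_
    rw [HSp.toL2_apply, HSp.val_sub, fourierCoef_sub, Real.rpow_natCast]
    rfl
  have key : Tendsto (fun t => ‖u t - u t₀‖ ^ 2) (𝓝[S] t₀) (𝓝 0) := by
    simp only [hsq]
    have h0 : (0 : ℝ) = ∑' _ : Fin d → ℤ, (0 : ℝ) := tsum_zero.symm
    conv => arg 3; rw [h0]
    refine tendsto_tsum_of_dominated_convergence (bound := fun k => 4 * (m k).toReal)
      ((ENNReal.summable_toReal hm).mul_left 4) (fun k => ?_) ?_
    · have h1 := (((hc k t₀ ht₀).tendsto.sub_const (fourierCoef (u t₀).val k)).norm.pow 2).const_mul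
        (wt k ^ (s : ℝ))
      simpa using h1
    · filter_upwards [self_mem_nhdsWithin] with t ht k
      have h1 := hb' t ht k
      have h2 := hb' t₀ ht₀ k
      have hw := Real.rpow_nonneg (wt_pos k).le (s : ℝ)
      rw [Real.norm_of_nonneg (by positivity)]
      have h3 := norm_sub_le (fourierCoef (u t).val k) (fourierCoef (u t₀).val k)
      have h4 : ‖fourierCoef (u t).val k - fourierCoef (u t₀).val k‖ ^ 2 ≤
          2 * ‖fourierCoef (u t).val k‖ ^ 2 + 2 * ‖fourierCoef (u t₀).val k‖ ^ 2 := by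
        nlinarith [norm_nonneg (fourierCoef (u t).val k - fourierCoef (u t₀).val k),
          sq_nonneg (‖fourierCoef (u t).val k‖ - ‖fourierCoef (u t₀).val k‖)]
      nlinarith [mul_le_mul_of_nonneg_left h4 hw]
  have := key.sqrt
  rw [ContinuousWithinAt, tendsto_iff_norm_sub_tendsto_zero]
  simpa [Real.sqrt_sq (norm_nonneg _)] using this

variable {ν a b : ℝ} {w : ℝ → L2 d}

/-- The Fourier coefficients of the mild solution of `∂ₜu = νΔu + w` with coefficients `c` at time
`a`. -/
def mildCoef (ν a : ℝ) (c : (Fin d → ℤ) → ℂ) (w : ℝ → L2 d) (t : ℝ) (k : Fin d → ℤ) : ℂ :=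
  Real.exp (-(ν * freqSq k * (t - a))) • c k + duh (ν * freqSq k) a (fun τ => fourierCoef (w τ) k) t

lemma aestronglyMeasurable_coef {μ : Measure ℝ} (hw : AEStronglyMeasurable w μ)
    (k : Fin d → ℤ) : AEStronglyMeasurable (fun τ => fourierCoef (w τ) k) μ :=
  (coefL2 k).continuous.comp_aestronglyMeasurable hw

lemma lintegral_seqE {μ : Measure ℝ} (hw : AEStronglyMeasurable w μ) (r : ℝ) :
    ∫⁻ τ, seqE r (fourierCoef (w τ)) ∂μ =
      ∑' k : Fin d → ℤ, ENNReal.ofReal (wt k ^ r) * ∫⁻ τ, ‖fourierCoef (w τ) k‖ₑ ^ 2 ∂μ := by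
  unfold seqE
  rw [lintegral_tsum fun k => ((aestronglyMeasurable_coef hw k).enorm.pow_const 2).const_mul _]
  refine tsum_congr fun k => ?_
  rw [lintegral_const_mul' _ _ (by finiteness)]

lemma lintegral_coef_sq_ne_top {μ : Measure ℝ} (hw : AEStronglyMeasurable w μ) {r : ℝ}
    (h : ∫⁻ τ, seqE r (fourierCoef (w τ)) ∂μ ≠ ⊤) (k : Fin d → ℤ) :
    ∫⁻ τ, ‖fourierCoef (w τ) k‖ₑ ^ 2 ∂μ ≠ ⊤ := by
  rw [lintegral_seqE hw] at h
  intro htop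
  refine ENNReal.ne_top_of_tsum_ne_top h k ?_
  rw [htop, ENNReal.mul_top]
  simpa using Real.rpow_pos_of_pos (wt_pos k) r

lemma integrableOn_coef (hw : AEStronglyMeasurable w (volume.restrict (Icc a b))) {r : ℝ}
    (h : ∫⁻ τ in Icc a b, seqE r (fourierCoef (w τ)) ≠ ⊤) (k : Fin d → ℤ) :
    IntegrableOn (fun τ => fourierCoef (w τ) k) (Icc a b) := by
  have h1 : MemLp (fun τ => fourierCoef (w τ) k) 2 (volume.restrict (Icc a b)) := by
    refine ⟨aestronglyMeasurable_coef hw k, ?_⟩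
    rw [eLpNorm_lt_top_iff_lintegral_rpow_enorm_lt_top (by norm_num) (by norm_num)]
    simp only [ENNReal.toReal_ofNat, ENNReal.rpow_ofNat]
    exact (lintegral_coef_sq_ne_top hw h k).lt_top
  exact h1.integrable (by norm_num)

lemma mildCoef_conj {c : (Fin d → ℤ) → ℂ} (hc : ∀ k, c (-k) = (starRingEnd ℂ) (c k)) (t : ℝ)
    (k : Fin d → ℤ) : mildCoef ν a c w t (-k) = (starRingEnd ℂ) (mildCoef ν a c w t k) := by
  unfold mildCoef
  rw [freqSq_neg, hc, map_add, ← duh_conj]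
  simp only [fourierCoef_neg_freq, Complex.real_smul, map_mul, Complex.conj_ofReal]

lemma exp_heat_le_one (hν : 0 ≤ ν) {t : ℝ} (ht : a ≤ t) (k : Fin d → ℤ) :
    Real.exp (-(ν * freqSq k * (t - a))) ≤ 1 := by
  refine Real.exp_le_one_iff.2 ?_
  have := mul_nonneg (mul_nonneg hν (freqSq_nonneg k)) (sub_nonneg.2 ht)
  linarith

lemma seqE_duh_le (hν : 0 ≤ ν) (hw : AEStronglyMeasurable w (volume.restrict (Icc a b)))
    {t : ℝ} (ht : t ∈ Icc a b) (r : ℝ) :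
    seqE r (fun k : Fin d → ℤ => duh (ν * freqSq k) a (fun τ => fourierCoef (w τ) k) t) ≤
      ENNReal.ofReal (b - a) * ∫⁻ τ in Icc a b, seqE r (fourierCoef (w τ)) := by
  rw [lintegral_seqE hw, ← ENNReal.tsum_mul_left]
  refine ENNReal.tsum_le_tsum fun k => ?_
  rw [mul_left_comm]
  gcongr
  exact enorm_duh_sq_le_length (mul_nonneg hν (freqSq_nonneg k)) (aestronglyMeasurable_coef hw k) ht

lemma weight_duh_le (hν : 0 < ν) (hab : a ≤ b)
    (hw : AEStronglyMeasurable w (volume.restrict (Icc a b))) {t : ℝ} (ht : t ∈ Icc a b) (r : ℝ)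
    (k : Fin d → ℤ) :
    ENNReal.ofReal (wt k ^ (r + 1)) *
        ‖duh (ν * freqSq k) a (fun τ => fourierCoef (w τ) k) t‖ₑ ^ 2 ≤
      ENNReal.ofReal (b - a + 1 / ν) *
        (ENNReal.ofReal (wt k ^ r) * ∫⁻ τ in Icc a b, ‖fourierCoef (w τ) k‖ₑ ^ 2) := by
  rw [Real.rpow_add_one (wt_pos k).ne', ENNReal.ofReal_mul (Real.rpow_nonneg (wt_pos k).le _),
    mul_assoc, mul_left_comm (ENNReal.ofReal (b - a + 1 / ν))]
  refine mul_le_mul' le_rfl ?_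
  exact enorm_duh_sq_le_smoothing hν (freqSq_nonneg k) hab (aestronglyMeasurable_coef hw k) ht

/-- The Duhamel term lies in `H^{r+1}`, pointwise in time, for forcing in `L²(H^r)`. -/
lemma seqE_duh_smoothing (hν : 0 < ν) (hab : a ≤ b)
    (hw : AEStronglyMeasurable w (volume.restrict (Icc a b))) {t : ℝ} (ht : t ∈ Icc a b) (r : ℝ) :
    seqE (r + 1) (fun k : Fin d → ℤ => duh (ν * freqSq k) a (fun τ => fourierCoef (w τ) k) t) ≤
      ENNReal.ofReal (b - a + 1 / ν) * ∫⁻ τ in Icc a b, seqE r (fourierCoef (w τ)) := by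
  rw [lintegral_seqE hw, ← ENNReal.tsum_mul_left]
  exact ENNReal.tsum_le_tsum fun k => weight_duh_le hν hab hw ht r k

lemma continuousOn_mildCoef {c : (Fin d → ℤ) → ℂ}
    (hw : AEStronglyMeasurable w (volume.restrict (Icc a b))) {r : ℝ}
    (h : ∫⁻ τ in Icc a b, seqE r (fourierCoef (w τ)) ≠ ⊤) (k : Fin d → ℤ) :
    ContinuousOn (fun t => mildCoef ν a c w t k) (Icc a b) :=
  ContinuousOn.add (by fun_prop) (continuousOn_duh _ (integrableOn_coef hw h k))

lemma enorm_mildCoef_sq_le (hν : 0 ≤ ν) (c : (Fin d → ℤ) → ℂ) {t : ℝ} (ht : a ≤ t)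
    (k : Fin d → ℤ) : ‖mildCoef ν a c w t k‖ₑ ^ 2 ≤
      2 * (ENNReal.ofReal (Real.exp (-(ν * freqSq k * (t - a)))) * ‖c k‖ₑ ^ 2) +
      2 * ‖duh (ν * freqSq k) a (fun τ => fourierCoef (w τ) k) t‖ₑ ^ 2 := by
  unfold mildCoef
  refine (pow_le_pow_left₀ zero_le (enorm_add_le _ _) 2).trans
    ((ennreal_add_sq_le _ _).trans ?_)
  gcongr
  rw [enorm_smul, mul_pow, Real.enorm_eq_ofReal (Real.exp_pos _).le]
  gcongr
  rw [sq]
  refine mul_le_of_le_one_left zero_le ?_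
  rw [← ENNReal.ofReal_one]
  exact ENNReal.ofReal_le_ofReal (exp_heat_le_one hν ht k)

/-- Parabolic regularity: for `u₀ ∈ H^s` and `w ∈ L²(H^{s-1})` the mild solution of
`∂ₜu = νΔu + w` lies in `C(H^s) ∩ L²(H^{s+1})`. -/
lemma exists_mild (hν : 0 < ν) (hab : a ≤ b) (u₀ : HSp d s)
    (hw : AEStronglyMeasurable w (volume.restrict (Icc a b)))
    (h : ∫⁻ τ in Icc a b, seqE ((s : ℝ) - 1) (fourierCoef (w τ)) ≠ ⊤) :
    ∃ u : ℝ → HSp d s,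
      (∀ t ∈ Icc a b, ∀ k, fourierCoef (u t).val k = mildCoef ν a (fourierCoef u₀.val) w t k) ∧
      ContinuousOn u (Icc a b) ∧
      ∃ v : ℝ → HSp d (s + 1), MemLp v 2 (volume.restrict (Icc a b)) ∧
        ∀ᵐ t ∂(volume.restrict (Icc a b)), HSp.incl (Nat.le_succ s) (v t) = u t := by
  set c := fourierCoef u₀.val with hc
  set m : (Fin d → ℤ) → ℝ≥0∞ := fun k =>
    2 * (ENNReal.ofReal (wt k ^ (s : ℝ)) * ‖c k‖ₑ ^ 2) + 2 * (ENNReal.ofReal (b - a + 1 / ν) *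
      (ENNReal.ofReal (wt k ^ ((s : ℝ) - 1)) * ∫⁻ τ in Icc a b, ‖fourierCoef (w τ) k‖ₑ ^ 2)) with hm
  have hmsum : ∑' k, m k ≠ ⊤ := by
    rw [hm, ENNReal.tsum_add, ENNReal.tsum_mul_left, ENNReal.tsum_mul_left, ENNReal.tsum_mul_left,
      ← lintegral_seqE hw]
    have := u₀.seqE_ne_top
    rw [seqE] at this
    finiteness
  have hmb : ∀ t ∈ Icc a b, ∀ k,
      ENNReal.ofReal (wt k ^ (s : ℝ)) * ‖mildCoef ν a c w t k‖ₑ ^ 2 ≤ m k := fun t ht k => by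
    have h1 := weight_duh_le hν hab hw ht ((s : ℝ) - 1) k
    rw [sub_add_cancel] at h1
    refine (mul_le_mul' le_rfl (enorm_mildCoef_sq_le hν.le c ht.1 k)).trans ?_
    rw [mul_add, mul_left_comm, mul_left_comm _ (2 : ℝ≥0∞)]
    refine add_le_add (mul_le_mul' le_rfl (mul_le_mul' le_rfl ?_)) (mul_le_mul' le_rfl h1)
    refine mul_le_of_le_one_left zero_le ?_
    rw [← ENNReal.ofReal_one]
    exact ENNReal.ofReal_le_ofReal (exp_heat_le_one hν.le ht.1 k)
  have hex : ∀ t, ∃ u : HSp d s, t ∈ Icc a b → ∀ k, fourierCoef u.val k = mildCoef ν a c w t k := by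
    intro t
    by_cases ht : t ∈ Icc a b
    · have hfin : seqE s (mildCoef ν a c w t) ≠ ⊤ :=
        ne_top_of_le_ne_top hmsum (ENNReal.tsum_le_tsum fun k => hmb t ht k)
      obtain ⟨u, hu⟩ := exists_L2_of_coef (c := mildCoef ν a c w t)
        (ne_top_of_le_ne_top hfin (seqE_mono (by positivity) _))
        (mildCoef_conj (fun k => fourierCoef_neg_freq _ k) t)
      refine ⟨⟨u, (mem_sobolev_iff u).2 ?_⟩, fun _ => hu⟩
      rwa [show fourierCoef u = mildCoef ν a c w t from funext hu]
    · exact ⟨0, fun h => absurd h ht⟩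
  choose u hu using hex
  refine ⟨u, hu, HSp.continuousOn_of_coef (m := m) (fun k => ?_) hmsum fun t ht k => ?_, ?_⟩
  · exact (continuousOn_mildCoef hw h k).congr fun t ht => hu t ht k
  · rw [hu t ht k]
    exact hmb t ht k
  -- square integrability in time with values in `H^{s+1}`
  set B := ENNReal.ofReal (b - a + 1 / ν) with hB
  have hcont : ∀ k, ContinuousOn (fun t => fourierCoef (u t).val k) (Icc a b) := fun k =>
    (continuousOn_mildCoef hw h k).congr fun t ht => hu t ht k
  have hcoefm : ∀ k, AEStronglyMeasurable (fun t => fourierCoef (u t).val k)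
      (volume.restrict (Icc a b)) := fun k => (hcont k).aestronglyMeasurable measurableSet_Icc
  have hexp : ∀ k : Fin d → ℤ, ENNReal.ofReal (wt k) *
      ∫⁻ t in Icc a b, ENNReal.ofReal (Real.exp (-(ν * freqSq k * (t - a)))) ≤ B := fun k => by
    refine le_trans (mul_le_mul' le_rfl ?_)
      (lintegral_kern_right hν (freqSq_nonneg k) hab a (left_mem_Icc.2 hab))
    refine setLIntegral_mono' measurableSet_Icc fun t ht => ?_
    rw [kern, if_pos ht.1]
  have hbd : ∀ k, ENNReal.ofReal (wt k ^ ((s : ℝ) + 1)) *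
      ∫⁻ t in Icc a b, ‖fourierCoef (u t).val k‖ₑ ^ 2 ≤
      2 * (B * (ENNReal.ofReal (wt k ^ (s : ℝ)) * ‖c k‖ₑ ^ 2)) + 2 * (B ^ 2 *
        (ENNReal.ofReal (wt k ^ ((s : ℝ) - 1)) * ∫⁻ τ in Icc a b, ‖fourierCoef (w τ) k‖ₑ ^ 2)) := by
    intro k
    have hwk := aestronglyMeasurable_coef hw k
    have h1 : ∫⁻ t in Icc a b, ‖fourierCoef (u t).val k‖ₑ ^ 2 ≤
        2 * ((∫⁻ t in Icc a b, ENNReal.ofReal (Real.exp (-(ν * freqSq k * (t - a))))) * ‖c k‖ₑ ^ 2) +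
        2 * ∫⁻ t in Icc a b, ‖duh (ν * freqSq k) a (fun τ => fourierCoef (w τ) k) t‖ₑ ^ 2 := by
      rw [← lintegral_mul_const' _ _ (by finiteness), ← lintegral_const_mul' _ _ (by finiteness),
        ← lintegral_const_mul' _ _ (by finiteness), ← lintegral_add_left (by fun_prop)]
      refine setLIntegral_mono' measurableSet_Icc fun t ht => ?_
      rw [hu t ht k]
      exact enorm_mildCoef_sq_le hν.le c ht.1 k
    have h2 := lintegral_duh_sq_le hν (freqSq_nonneg k) hab hwk
    have e1 : ENNReal.ofReal (wt k ^ ((s : ℝ) + 1)) =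
        ENNReal.ofReal (wt k ^ (s : ℝ)) * ENNReal.ofReal (wt k) := by
      rw [Real.rpow_add_one (wt_pos k).ne', ENNReal.ofReal_mul (Real.rpow_nonneg (wt_pos k).le _)]
    have e2 : ENNReal.ofReal (wt k ^ (s : ℝ)) * ENNReal.ofReal (wt k) =
        ENNReal.ofReal (wt k ^ ((s : ℝ) - 1)) * ENNReal.ofReal (wt k) ^ 2 := by
      rw [sq, ← mul_assoc, ← ENNReal.ofReal_mul (Real.rpow_nonneg (wt_pos k).le ((s : ℝ) - 1)),
        ← Real.rpow_add_one (wt_pos k).ne', sub_add_cancel]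
    calc _ ≤ ENNReal.ofReal (wt k ^ ((s : ℝ) + 1)) * _ := mul_le_mul' le_rfl h1
      _ = 2 * ((ENNReal.ofReal (wt k) * ∫⁻ t in Icc a b,
            ENNReal.ofReal (Real.exp (-(ν * freqSq k * (t - a))))) *
              (ENNReal.ofReal (wt k ^ (s : ℝ)) * ‖c k‖ₑ ^ 2)) +
          2 * (ENNReal.ofReal (wt k ^ ((s : ℝ) - 1)) * (ENNReal.ofReal (wt k) ^ 2 *
            ∫⁻ t in Icc a b, ‖duh (ν * freqSq k) a (fun τ => fourierCoef (w τ) k) t‖ₑ ^ 2)) := by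
          rw [mul_add, e1, ← mul_assoc _ (ENNReal.ofReal (wt k) ^ 2), ← e2]
          ring
      _ ≤ 2 * (B * (ENNReal.ofReal (wt k ^ (s : ℝ)) * ‖c k‖ₑ ^ 2)) +
          2 * (ENNReal.ofReal (wt k ^ ((s : ℝ) - 1)) * (B ^ 2 *
            ∫⁻ τ in Icc a b, ‖fourierCoef (w τ) k‖ₑ ^ 2)) := by
          refine add_le_add (mul_le_mul' le_rfl (mul_le_mul' (hexp k) le_rfl))
            (mul_le_mul' le_rfl (mul_le_mul' le_rfl h2))
      _ = _ := by ring
  have hum : AEStronglyMeasurable (fun t => (u t).val) (volume.restrict (Icc a b)) :=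
    (HSp.toL2CLM d s).continuous.comp_aestronglyMeasurable (HSp.aestronglyMeasurable hcoefm)
  have hint : ∫⁻ t in Icc a b, seqE ((s : ℝ) + 1) (fourierCoef (u t).val) ≠ ⊤ := by
    rw [lintegral_seqE hum]
    refine ne_top_of_le_ne_top ?_ (ENNReal.tsum_le_tsum hbd)
    rw [ENNReal.tsum_add, ENNReal.tsum_mul_left, ENNReal.tsum_mul_left, ENNReal.tsum_mul_left,
      ENNReal.tsum_mul_left, ← lintegral_seqE hw]
    have := u₀.seqE_ne_top
    rw [seqE] at this
    finiteness
  have hseqm : AEMeasurable (fun t => seqE ((s : ℝ) + 1) (fourierCoef (u t).val))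
      (volume.restrict (Icc a b)) :=
    AEMeasurable.tsum fun k => ((hcoefm k).enorm.pow_const 2).const_mul _
  have hae := ae_lt_top' hseqm hint
  classical
  have hcast : (((s + 1 : ℕ) : ℝ)) = (s : ℝ) + 1 := by push_cast; ring
  set v : ℝ → HSp d (s + 1) := fun t =>
    if ht : seqE ((s : ℝ) + 1) (fourierCoef (u t).val) < ⊤ then
      ⟨(u t).val, (mem_sobolev_iff _).2 (by rw [hcast]; exact ht.ne)⟩ else 0 with hv
  have hvu : ∀ᵐ t ∂(volume.restrict (Icc a b)), (v t).val = (u t).val := by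
    filter_upwards [hae] with t ht
    simp only [hv]
    rw [dif_pos ht]
  refine ⟨v, ⟨HSp.aestronglyMeasurable fun k => ?_, ?_⟩, ?_⟩
  · refine (hcoefm k).congr ?_
    filter_upwards [hvu] with t ht
    rw [ht]
  · rw [eLpNorm_lt_top_iff_lintegral_rpow_enorm_lt_top (by norm_num) (by norm_num)]
    simp only [ENNReal.toReal_ofNat, ENNReal.rpow_ofNat]
    refine lt_of_le_of_lt (le_of_eq (lintegral_congr_ae ?_)) hint.lt_top
    filter_upwards [hvu] with t ht
    rw [HSp.enorm_sq, ht, hcast]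
  · filter_upwards [hvu] with t ht
    exact HSp.ext ht

end Linear

/-! ### Short-time asymptotics of the linear equation -/

section Asymptotics

variable {d s : ℕ} {ν a b : ℝ}

/-- The heat semigroup is strongly continuous at time zero. -/
lemma tendsto_seqE_heat (ν : ℝ) {σ : ℝ} {c : (Fin d → ℤ) → ℂ} (hν : 0 ≤ ν) (hc : seqE σ c ≠ ⊤) :
    Tendsto (fun δ : ℝ => seqE σ fun k => (1 - Real.exp (-(ν * freqSq k * δ))) • c k) (𝓝[≥] 0)
      (𝓝 0) := by
  let _ : MeasurableSpace (Fin d → ℤ) := ⊤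
  have h0 : (0 : ℝ≥0∞) = ∫⁻ _ : Fin d → ℤ, 0 ∂Measure.count := by simp
  simp only [seqE]
  simp only [← lintegral_count]
  rw [h0]
  refine tendsto_lintegral_filter_of_dominated_convergence
    (fun k => ENNReal.ofReal (wt k ^ σ) * ‖c k‖ₑ ^ 2)
    (Eventually.of_forall fun δ => measurable_from_top) ?_ (by simpa [lintegral_count, seqE] using hc)
    (ae_of_all _ fun k => ?_)
  · filter_upwards [self_mem_nhdsWithin] with δ hδ
    refine ae_of_all _ fun k => ?_
    gcongr
    rw [enorm_le_iff_norm_le, norm_smul]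
    refine mul_le_of_le_one_left (norm_nonneg _) ?_
    have h1 := exp_heat_le_one (a := 0) hν (t := δ) hδ k
    rw [sub_zero] at h1
    rw [Real.norm_of_nonneg (by linarith)]
    linarith [Real.exp_pos (-(ν * freqSq k * δ))]
  · have h1 : Continuous fun δ : ℝ =>
        ENNReal.ofReal (wt k ^ σ) * ‖(1 - Real.exp (-(ν * freqSq k * δ))) • c k‖ₑ ^ 2 := by
      refine (ENNReal.continuous_const_mul ENNReal.ofReal_ne_top).comp ?_
      have : Continuous fun δ : ℝ => (1 - Real.exp (-(ν * freqSq k * δ))) • c k := by fun_prop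
      fun_prop
    have h2 := (h1.tendsto 0).mono_left (nhdsWithin_le_nhds (s := Ici 0))
    simpa using h2

lemma one_sub_exp_heat_mono (hν : 0 ≤ ν) {t l : ℝ} (hl : t ≤ l) (k : Fin d → ℤ) :
    1 - Real.exp (-(ν * freqSq k * t)) ≤ 1 - Real.exp (-(ν * freqSq k * l)) := by
  have : Real.exp (-(ν * freqSq k * l)) ≤ Real.exp (-(ν * freqSq k * t)) :=
    Real.exp_le_exp.2 (neg_le_neg (mul_le_mul_of_nonneg_left hl (mul_nonneg hν (freqSq_nonneg k))))
  linarith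

lemma norm_exp_heat_sub_one_smul (hν : 0 ≤ ν) {t l : ℝ} (ht : 0 ≤ t) (hl : t ≤ l) (k : Fin d → ℤ)
    (c : ℂ) : ‖(Real.exp (-(ν * freqSq k * t)) - 1) • c‖ ≤
      ‖(1 - Real.exp (-(ν * freqSq k * l))) • c‖ := by
  have h1 := exp_heat_le_one (a := 0) hν ht k
  rw [sub_zero] at h1
  have h2 := one_sub_exp_heat_mono hν hl k
  rw [norm_smul, norm_smul, norm_sub_rev, Real.norm_of_nonneg (by linarith),
    Real.norm_of_nonneg (by linarith)]
  gcongr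

/-- For constant forcing `c`, the Duhamel term differs from `(t - a) c` by the effect of the heat
semigroup on `c`. -/
lemma norm_duh_const_sub_le (hν : 0 ≤ ν) {t : ℝ} (ht : t ∈ Icc a b) (k : Fin d → ℤ) (c : ℂ) :
    ‖duh (ν * freqSq k) a (fun _ => c) t - (t - a) • c‖ ≤
      (b - a) * ‖(1 - Real.exp (-(ν * freqSq k * (b - a)))) • c‖ := by
  have hc : Continuous fun τ : ℝ => Real.exp (-(ν * freqSq k * (t - τ))) • c := by fun_prop
  have e : duh (ν * freqSq k) a (fun _ => c) t - (t - a) • c =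
      ∫ τ in a..t, (Real.exp (-(ν * freqSq k * (t - τ))) - 1) • c := by
    simp only [sub_smul, one_smul]
    rw [intervalIntegral.integral_sub (hc.intervalIntegrable _ _) (by simp)]
    simp only [duh, intervalIntegral.integral_const]
    rw [sub_smul]
  rw [e]
  refine (intervalIntegral.norm_integral_le_of_norm_le_const
    (C := ‖(1 - Real.exp (-(ν * freqSq k * (b - a)))) • c‖) fun τ hτ => ?_).trans ?_
  · rw [uIoc_of_le ht.1] at hτ
    exact norm_exp_heat_sub_one_smul hν (by linarith [hτ.2]) (by linarith [hτ.1, ht.2]) k c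
  · rw [mul_comm, abs_of_nonneg (by linarith [ht.1])]
    gcongr
    exact ht.2

lemma duh_smul (x a r : ℝ) (w : ℝ → ℂ) (t : ℝ) :
    duh x a (fun τ => r • w τ) t = r • duh x a w t := by
  unfold duh
  rw [← intervalIntegral.integral_smul]
  refine intervalIntegral.integral_congr fun τ _ => ?_
  simp only [smul_comm r]

lemma duh_neg (x a : ℝ) (w : ℝ → ℂ) (t : ℝ) : duh x a (fun τ => -w τ) t = -duh x a w t := by
  unfold duh
  rw [← intervalIntegral.integral_neg]
  simp only [smul_neg]

lemma duh_sub {x t : ℝ} {w w' : ℝ → ℂ} (hw : IntegrableOn w (Icc a b))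
    (hw' : IntegrableOn w' (Icc a b)) (ht : t ∈ Icc a b) :
    duh x a (fun τ => w τ - w' τ) t = duh x a w t - duh x a w' t := by
  simp only [sub_eq_add_neg]
  rw [← duh_neg]
  exact duh_add hw hw'.neg ht

/-- The remainder in the short-time asymptotics of the linear equation on a time interval of
length `δ`: `H` bounds the square norm of the forcing in `L²(H^{s-1})`, and `M` the norm of the
nonlinear remainder in `H^s`. -/
def remainder (ν : ℝ) (s : ℕ) (v W : HSp d s) (ζ : HSp d (s + 2)) (lam δ : ℝ) (H : ℝ≥0∞)
    (M : ℝ) : ℝ≥0∞ :=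
  4 * seqE s (fun k => (1 - Real.exp (-(ν * freqSq k * δ))) • fourierCoef v.val k) +
  8 * (ENNReal.ofReal ((lam * ν * δ) ^ 2) * ‖ζ‖ₑ ^ 2) +
  16 * (ENNReal.ofReal (δ + 1 / ν) * H) +
  32 * seqE s (fun k => (1 - Real.exp (-(ν * freqSq k * δ))) • fourierCoef W.val k) +
  32 * ENNReal.ofReal ((δ * M) ^ 2)

/-- Over a time interval of length `δ = m⁻¹`, the mild solution starting at `v' + lam ζ` with
forcing `h + m W - F` stays close to `lam ζ + v + m (t - a) W`. -/
lemma mild_close (hν : 0 < ν) (hab : a < b) {m lam M : ℝ} (hm : m * (b - a) = 1) (hlam : 0 ≤ lam)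
    (hM : 0 ≤ M)
    {v v' W : HSp d s} {ζ : HSp d (s + 2)} {h : ℝ → L2 d} {F : ℝ → HSp d s}
    (hh : AEStronglyMeasurable h (volume.restrict (Icc a b)))
    (hhi : ∫⁻ τ in Icc a b, seqE ((s : ℝ) - 1) (fourierCoef (h τ)) ≠ ⊤)
    (hF : AEStronglyMeasurable (fun τ => (F τ).val) (volume.restrict (Icc a b)))
    (hFM : ∀ τ, ‖F τ‖ ≤ M) {t : ℝ} (ht : t ∈ Icc a b) {u : HSp d s}
    (hu : ∀ k, fourierCoef u.val k = mildCoef ν a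
      (fourierCoef (v' + lam • HSp.incl (Nat.le_add_right s 2) ζ).val)
      (fun τ => h τ + (m • W.val - (F τ).val)) t k) :
    ‖u - lam • HSp.incl (Nat.le_add_right s 2) ζ - v - (m * (t - a)) • W‖ₑ ^ 2 ≤
      2 * ‖v' - v‖ₑ ^ 2 + remainder ν s v W ζ lam (b - a)
        (∫⁻ τ in Icc a b, seqE ((s : ℝ) - 1) (fourierCoef (h τ))) M := by
  set δ := b - a with hδ
  have hδ0 : 0 < δ := by rw [hδ]; linarith
  have hm0 : 0 < m := pos_of_mul_pos_left (by rw [hm]; norm_num) hδ0.le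
  have hFi : ∫⁻ τ in Icc a b, seqE s (fourierCoef (F τ).val) ≤
      ENNReal.ofReal δ * ENNReal.ofReal (M ^ 2) := by
    calc _ ≤ ∫⁻ _τ in Icc a b, ENNReal.ofReal (M ^ 2) := lintegral_mono fun τ =>
          ((F τ).norm_le_iff hM).1 (hFM τ)
      _ = _ := by rw [setLIntegral_const, Real.volume_Icc, mul_comm]
  have hFi' : ∫⁻ τ in Icc a b, seqE s (fourierCoef (F τ).val) ≠ ⊤ :=
    ne_top_of_le_ne_top (by finiteness) hFi
  -- the six contributions
  set e : (Fin d → ℤ) → ℝ := fun k => Real.exp (-(ν * freqSq k * (t - a))) with he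
  set c₁ : (Fin d → ℤ) → ℂ := fun k => e k • fourierCoef (v' - v).val k with hc₁
  set c₂ : (Fin d → ℤ) → ℂ := fun k => (e k - 1) • fourierCoef v.val k with hc₂
  set c₃ : (Fin d → ℤ) → ℂ := fun k => (lam * (e k - 1)) • fourierCoef ζ.val k with hc₃
  set c₄ : (Fin d → ℤ) → ℂ := fun k => duh (ν * freqSq k) a (fun τ => fourierCoef (h τ) k) t with hc₄
  set c₅ : (Fin d → ℤ) → ℂ := fun k => m • (duh (ν * freqSq k) a (fun _ => fourierCoef W.val k) t -
    (t - a) • fourierCoef W.val k) with hc₅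
  set c₆ : (Fin d → ℤ) → ℂ := fun k =>
    duh (ν * freqSq k) a (fun τ => fourierCoef (F τ).val k) t with hc₆
  have hsplit : fourierCoef (u - lam • HSp.incl (Nat.le_add_right s 2) ζ - v -
      (m * (t - a)) • W).val = c₁ + (c₂ + (c₃ + (c₄ + (c₅ + -c₆)))) := by
    funext k
    have i1 := integrableOn_coef hh hhi k
    have i3 := integrableOn_coef hF hFi' k
    have i2 : IntegrableOn (fun _ : ℝ => m • fourierCoef W.val k) (Icc a b) :=
      integrableOn_const (by simp)
    have hd : duh (ν * freqSq k) a (fun τ => fourierCoef (h τ + (m • W.val - (F τ).val) : L2 d) k) t =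
        c₄ k + (m • duh (ν * freqSq k) a (fun _ => fourierCoef W.val k) t - c₆ k) := by
      simp only [fourierCoef_add, fourierCoef_sub, fourierCoef_smul]
      refine (duh_add (w' := fun τ => m • fourierCoef W.val k - fourierCoef (F τ).val k) i1
        (i2.sub i3) ht).trans ?_
      rw [duh_sub i2 i3 ht, duh_smul]
    have huk := hu k
    rw [mildCoef, hd] at huk
    simp only [HSp.val_sub, HSp.val_smul, HSp.incl_val, fourierCoef_sub, fourierCoef_smul, huk,
      HSp.val_add, fourierCoef_add, Pi.add_apply, Pi.neg_apply, hc₁, hc₂, hc₃, hc₅, he,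
      Complex.real_smul]
    push_cast
    ring
  have b₁ : seqE s c₁ ≤ ‖v' - v‖ₑ ^ 2 := by
    rw [HSp.enorm_sq]
    refine seqE_mono_of_le fun k => ?_
    rw [hc₁, norm_smul, Real.norm_of_nonneg (Real.exp_pos _).le]
    exact mul_le_of_le_one_left (norm_nonneg _) (exp_heat_le_one hν.le ht.1 k)
  have b₂ : seqE s c₂ ≤ seqE s fun k => (1 - Real.exp (-(ν * freqSq k * δ))) • fourierCoef v.val k :=
    seqE_mono_of_le fun k => norm_exp_heat_sub_one_smul hν.le (by linarith [ht.1])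
      (by linarith [ht.2]) k _
  have b₃ : seqE s c₃ ≤ ENNReal.ofReal ((lam * ν * δ) ^ 2) * ‖ζ‖ₑ ^ 2 := by
    rw [HSp.enorm_sq, ← seqE_smul]
    refine ENNReal.tsum_le_tsum fun k => ?_
    have hw := wt_pos k
    have h1 : ‖c₃ k‖ ≤ wt k * ‖((lam * ν * δ) • fourierCoef ζ.val) k‖ := by
      have h2 : 1 - e k ≤ ν * freqSq k * δ := by
        have h3 := Real.add_one_le_exp (-(ν * freqSq k * (t - a)))
        have h4 : ν * freqSq k * (t - a) ≤ ν * freqSq k * δ :=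
          mul_le_mul_of_nonneg_left (by linarith [ht.2]) (mul_nonneg hν.le (freqSq_nonneg k))
        simp only [he]
        linarith
      have h0 : e k ≤ 1 := exp_heat_le_one hν.le ht.1 k
      have h5 : ν * freqSq k * δ ≤ wt k * (ν * δ) := by
        have : freqSq k ≤ wt k := by unfold wt; linarith
        nlinarith [mul_pos hν hδ0]
      rw [hc₃, Pi.smul_apply, norm_smul, norm_smul, norm_mul, ← mul_assoc,
        Real.norm_of_nonneg hlam, norm_sub_rev, Real.norm_of_nonneg (by linarith : 0 ≤ 1 - e k),
        Real.norm_of_nonneg (by positivity : 0 ≤ lam * ν * δ)]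
      refine mul_le_mul_of_nonneg_right ?_ (norm_nonneg _)
      nlinarith
    calc ENNReal.ofReal (wt k ^ (s : ℝ)) * ‖c₃ k‖ₑ ^ 2
        ≤ ENNReal.ofReal (wt k ^ (s : ℝ)) *
          (ENNReal.ofReal (wt k) * ‖((lam * ν * δ) • fourierCoef ζ.val) k‖ₑ) ^ 2 := by
          gcongr
          rw [← ofReal_norm, ← ofReal_norm, ← ENNReal.ofReal_mul hw.le]
          exact ENNReal.ofReal_le_ofReal h1
      _ = _ := by
          rw [mul_pow, ← mul_assoc, ← ENNReal.ofReal_pow hw.le,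
            ← ENNReal.ofReal_mul (Real.rpow_nonneg hw.le _), ← Real.rpow_natCast (wt k) 2,
            ← Real.rpow_add hw]
          push_cast
          rfl
  have b₄ : seqE s c₄ ≤ ENNReal.ofReal (δ + 1 / ν) *
      ∫⁻ τ in Icc a b, seqE ((s : ℝ) - 1) (fourierCoef (h τ)) := by
    have := seqE_duh_smoothing hν hab.le hh ht ((s : ℝ) - 1)
    rwa [sub_add_cancel] at this
  have b₅ : seqE s c₅ ≤
      seqE s fun k => (1 - Real.exp (-(ν * freqSq k * δ))) • fourierCoef W.val k := by
    refine seqE_mono_of_le fun k => ?_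
    have := norm_duh_const_sub_le hν.le ht k (fourierCoef W.val k)
    rw [hc₅, norm_smul, Real.norm_of_nonneg hm0.le]
    calc _ ≤ m * ((b - a) * ‖(1 - Real.exp (-(ν * freqSq k * (b - a)))) • fourierCoef W.val k‖) :=
          mul_le_mul_of_nonneg_left this hm0.le
      _ = _ := by rw [← mul_assoc, hm, one_mul]
  have b₆ : seqE s (-c₆) ≤ ENNReal.ofReal ((δ * M) ^ 2) := by
    rw [seqE_neg]
    refine (seqE_duh_le hν.le hF ht s).trans ((mul_le_mul' le_rfl hFi).trans (le_of_eq ?_))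
    rw [← ENNReal.ofReal_mul hδ0.le, ← ENNReal.ofReal_mul hδ0.le]
    ring_nf
  rw [HSp.enorm_sq, hsplit]
  refine (seqE_add_le _ _ _).trans ?_
  have r₅ := seqE_add_le s c₅ (-c₆)
  have r₄ := seqE_add_le s c₄ (c₅ + -c₆)
  have r₃ := seqE_add_le s c₃ (c₄ + (c₅ + -c₆))
  have r₂ := seqE_add_le s c₂ (c₃ + (c₄ + (c₅ + -c₆)))
  unfold remainder
  calc 2 * seqE s c₁ + 2 * seqE s (c₂ + (c₃ + (c₄ + (c₅ + -c₆))))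
      ≤ 2 * seqE s c₁ + 2 * (2 * seqE s c₂ + 2 * (2 * seqE s c₃ + 2 * (2 * seqE s c₄ +
        2 * (2 * seqE s c₅ + 2 * seqE s (-c₆))))) := by
        refine add_le_add le_rfl (mul_le_mul' le_rfl (r₂.trans ?_))
        refine add_le_add le_rfl (mul_le_mul' le_rfl (r₃.trans ?_))
        refine add_le_add le_rfl (mul_le_mul' le_rfl (r₄.trans ?_))
        exact add_le_add le_rfl (mul_le_mul' le_rfl r₅)
    _ = 2 * seqE s c₁ + (4 * seqE s c₂ + 8 * seqE s c₃ + 16 * seqE s c₄ + 32 * seqE s c₅ +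
        32 * seqE s (-c₆)) := by ring
    _ ≤ _ := by gcongr

end Asymptotics

/-! ### Local solutions of the nonlinear equation -/

section LocalSolutions

variable {d s : ℕ}

/-- `u` solves `∂ₜu - νΔu + f(u) = φ`, `u(a) = u₀` on `[a, b]`, in the sense of `IsSolution`. -/
structure SolvesOn (ν : ℝ) (f : ℝ → ℝ) (a b : ℝ) (u₀ : HSp d s) (φ : ℝ → HSp d (s - 1))
    (u : ℝ → HSp d s) : Prop where
  continuousOn : ContinuousOn u (Icc a b)
  memL2 : ∃ v : ℝ → HSp d (s + 1), MemLp v 2 (volume.restrict (Icc a b)) ∧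
    ∀ᵐ t ∂(volume.restrict (Icc a b)), HSp.incl (Nat.le_succ s) (v t) = u t
  initial : u a = u₀
  equation : ∀ k : Fin d → ℤ, ∀ t ∈ Icc a b,
    fourierCoef (u t).val k = fourierCoef u₀.val k +
      ∫ τ in a..t, (-((ν * freqSq k : ℝ) : ℂ) * fourierCoef (u τ).val k
          - fourierCoef (fun x => f ((u τ).val x)) k + fourierCoef (φ τ).val k)

/-- The properties of the nonlinearity used below: its order of growth is `q + 1`, with leading
part `A y^(q+1)`, both for its Lipschitz constants and for its action on `H^s`. -/
structure HasLeadingPart (d s : ℕ) (f : ℝ → ℝ) (A : ℝ) (q : ℕ) : Prop where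
  lipschitz : ∃ L : ℝ, 0 ≤ L ∧ ∀ x y, |f x - f y| ≤ L * (1 + |x| + |y|) ^ q * |x - y|
  growth : ∀ (ζ : HSp d (s + 2)) (R : ℝ), Growth (HSp.incl (Nat.le_add_right s 2) ζ) R
    (fun lam v x => f (v.val x) - A * (lam ^ (q + 1) * (HSp.incl (Nat.le_add_right s 2) ζ).val x
      ^ (q + 1))) q

open Classical in
/-- The composition `f ∘ y` as an element of `L²`, or `0` if it is not square-integrable. -/
def nem (f : ℝ → ℝ) (y : L2 d) : L2 d :=
  if h : MemLp (fun x => f (y x)) 2 (torusMeasure d) then h.toLp else 0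

lemma nem_ae {f : ℝ → ℝ} {y : L2 d} (h : MemLp (fun x => f (y x)) 2 (torusMeasure d)) :
    ∀ᵐ x ∂(torusMeasure d), nem f y x = f (y x) := by
  unfold nem
  rw [dif_pos h]
  exact h.coeFn_toLp

/-- The closed `H^s`-ball of radius `R` about `c`, as a subset of `L²`. -/
def ballL2 (c : HSp d s) (R : ℝ) : Set (L2 d) := {y | ∃ z : HSp d s, z.val = y ∧ ‖z - c‖ ≤ R}

/-- `H^s`-balls are closed in `L²`, by Fatou's lemma for the series defining the norm. -/
lemma isClosed_ballL2 (c : HSp d s) {R : ℝ} (hR : 0 ≤ R) : IsClosed (ballL2 c R) := by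
  have e : ballL2 c R = {y | seqE s (fourierCoef (y - c.val : L2 d)) ≤ ENNReal.ofReal (R ^ 2)} := by
    ext y
    constructor
    · rintro ⟨z, rfl, hz⟩
      exact ((z - c).norm_le_iff hR).1 hz
    · intro hy
      have hmem : y - c.val ∈ sobolevSubmodule d s :=
        (mem_sobolev_iff _).2 (ne_top_of_le_ne_top ENNReal.ofReal_ne_top hy)
      have hym : y ∈ sobolevSubmodule d s := by
        have := Submodule.add_mem _ hmem c.mem
        rwa [sub_add_cancel] at this
      exact ⟨⟨y, hym⟩, rfl, (HSp.norm_le_iff _ hR).2 hy⟩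
  rw [e]
  have hlsc : LowerSemicontinuous fun y : L2 d => seqE s (fourierCoef (y - c.val : L2 d)) := by
    refine lowerSemicontinuous_tsum fun k => Continuous.lowerSemicontinuous ?_
    refine (ENNReal.continuous_const_mul ENNReal.ofReal_ne_top).comp ?_
    have : Continuous fun y : L2 d => coefL2 k (y - c.val) := by fun_prop
    simp only [coefL2_apply] at this
    fun_prop
  exact hlsc.isClosed_preimage _

/-- The `n`-th power of a function in `H^s`, `s > d/2`. -/
lemma HSp.exists_pow (hs : (d : ℝ) / 2 < s) (ζ : HSp d s) (n : ℕ) :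
    ∃ w : HSp d s, ∀ᵐ x ∂(torusMeasure d), w.val x = ζ.val x ^ n := by
  obtain ⟨C, -, h⟩ := (Growth.shift ζ 0).pow hs n
  obtain ⟨w, hw, -⟩ := h 1 le_rfl ζ (by simp)
  exact ⟨w, by simpa using hw⟩

variable {f : ℝ → ℝ} {A : ℝ} {q : ℕ}

lemma HasLeadingPart.memLp (hf : HasLeadingPart d s f A q) (hs : (d : ℝ) / 2 < s) (u : HSp d s) :
    MemLp (fun x => f (u.val x)) 2 (torusMeasure d) := by
  obtain ⟨C, -, hg⟩ := hf.growth 0 ‖u‖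
  obtain ⟨w, hw, -⟩ := hg 1 le_rfl u (by simp)
  obtain ⟨z, hz⟩ := HSp.exists_pow hs (HSp.incl (Nat.le_add_right s 2) (0 : HSp d (s + 2))) (q + 1)
  refine MemLp.ae_eq ?_ ((Lp.memLp w.val).add ((Lp.memLp z.val).const_mul A))
  filter_upwards [hw, hz] with x h1 h2
  simp only [Pi.add_apply, h1, h2]
  ring

/-- On an `H^s`-ball about `lam ζ`, subtracting the leading part from `f` leaves a remainder of
order `lam^q` in `H^s`. -/
lemma HasLeadingPart.exists_remainder (hf : HasLeadingPart d s f A q) (hs : (d : ℝ) / 2 < s)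
    (ζ : HSp d (s + 2)) {Z : HSp d s}
    (hZ : ∀ᵐ x ∂(torusMeasure d), Z.val x = ζ.val x ^ (q + 1)) (R : ℝ) :
    ∃ C : ℝ, 0 ≤ C ∧ ∀ lam : ℝ, 1 ≤ lam →
      ∀ y ∈ ballL2 (lam • HSp.incl (Nat.le_add_right s 2) ζ) R, ∃ F : HSp d s,
        F.val = nem f y - (lam ^ (q + 1) * A) • Z.val ∧ ‖F‖ ≤ C * lam ^ q := by
  obtain ⟨C, hC, hg⟩ := hf.growth ζ R
  refine ⟨C, hC, fun lam hl y hy => ?_⟩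
  obtain ⟨u, rfl, hu⟩ := hy
  obtain ⟨F, hF, hFn⟩ := hg lam hl u hu
  refine ⟨F, Lp.ext ?_, hFn⟩
  filter_upwards [hF, hZ, nem_ae (hf.memLp hs u), Lp.coeFn_sub (nem f u.val)
    ((lam ^ (q + 1) * A) • Z.val), Lp.coeFn_smul (lam ^ (q + 1) * A) Z.val] with x h1 h2 h3 h4 h5
  rw [h1, h4, Pi.sub_apply, h3, h5, Pi.smul_apply, h2, smul_eq_mul, HSp.incl_val]
  ring

/-- On an `H^s`-ball about `lam ζ`, the nonlinearity is Lipschitz in `L²` with constant of order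
`lam^q`. -/
lemma HasLeadingPart.nem_lipschitz (hf : HasLeadingPart d s f A q) (hs : (d : ℝ) / 2 < s)
    (ζ : HSp d s) {R : ℝ} (hR : 0 ≤ R) :
    ∃ K : ℝ, 0 ≤ K ∧ ∀ lam : ℝ, 1 ≤ lam → ∀ y ∈ ballL2 (lam • ζ) R, ∀ y' ∈ ballL2 (lam • ζ) R,
      ‖nem f y - nem f y'‖ ≤ K * lam ^ q * ‖y - y'‖ := by
  obtain ⟨L, hL0, hL⟩ := hf.lipschitz
  obtain ⟨B, hB0, hB⟩ := HSp.exists_sup_bound (d := d) hs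
  refine ⟨L * (1 + 2 * (B * (R + ‖ζ‖))) ^ q, by positivity, fun lam hl y hy y' hy' => ?_⟩
  have hsup : ∀ u : HSp d s, ‖u - lam • ζ‖ ≤ R →
      ∀ᵐ x ∂(torusMeasure d), |u.val x| ≤ lam * (B * (R + ‖ζ‖)) := by
    intro u hu
    filter_upwards [hB u] with x hx
    have h1 : ‖u‖ ≤ R + lam * ‖ζ‖ := by
      have := norm_le_norm_add_norm_sub (lam • ζ) u
      rw [norm_smul, Real.norm_of_nonneg (by linarith), norm_sub_rev] at this
      linarith
    have h2 : R ≤ lam * R := le_mul_of_one_le_left hR hl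
    calc |u.val x| ≤ B * ‖u‖ := hx
      _ ≤ B * (lam * R + lam * ‖ζ‖) := mul_le_mul_of_nonneg_left (by linarith) hB0
      _ = _ := by ring
  obtain ⟨u, rfl, hu⟩ := hy
  obtain ⟨u', rfl, hu'⟩ := hy'
  refine Lp.norm_le_mul_norm_of_ae_le_mul ?_
  filter_upwards [nem_ae (hf.memLp hs u), nem_ae (hf.memLp hs u'),
    Lp.coeFn_sub (nem f u.val) (nem f u'.val), Lp.coeFn_sub u.val u'.val, hsup u hu, hsup u' hu']
    with x h1 h2 h3 h4 h5 h6
  rw [h3, h4, Pi.sub_apply, Pi.sub_apply, h1, h2, Real.norm_eq_abs, Real.norm_eq_abs]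
  refine (hL _ _).trans (mul_le_mul_of_nonneg_right ?_ (abs_nonneg _))
  rw [mul_assoc, ← mul_pow]
  refine mul_le_mul_of_nonneg_left (pow_le_pow_left₀ (by positivity) ?_ q) hL0
  nlinarith

lemma continuous_comp_of_lipschitz {N : L2 d → L2 d} {S : Set (L2 d)} {K : ℝ}
    (hN : ∀ y ∈ S, ∀ y' ∈ S, ‖N y - N y'‖ ≤ K * ‖y - y'‖) {x : ℝ → L2 d} (hx : Continuous x)
    (hxS : ∀ τ, x τ ∈ S) : Continuous fun τ => N (x τ) := by
  have h : LipschitzOnWith K.toNNReal N S := LipschitzOnWith.of_dist_le_mul fun y hy y' hy' => by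
    rw [dist_eq_norm, dist_eq_norm]
    exact (hN y hy y' hy').trans
      (mul_le_mul_of_nonneg_right (Real.le_coe_toNNReal K) (norm_nonneg _))
  exact h.continuousOn.comp_continuous hx hxS

/-- Existence by contraction, on a short interval, of a mild solution that stays within `R` of
`c = lam ζ` in `H^s`. The contraction takes place in `C([a,b], L²)`, on the set of curves that stay
in the `H^s`-ball, which is closed there. -/
lemma exists_mild_nonlinear {ν a b : ℝ} (hν : 0 < ν) (hab : a ≤ b) {c u₀ : HSp d s} {R K M : ℝ}
    (hR : 0 ≤ R) (hK0 : 0 ≤ K)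
    {h : ℝ → L2 d} (hh : AEStronglyMeasurable h (volume.restrict (Icc a b)))
    (hhi : ∫⁻ τ in Icc a b, seqE ((s : ℝ) - 1) (fourierCoef (h τ)) ≠ ⊤)
    {N : L2 d → L2 d}
    (hNM : ∀ y ∈ ballL2 c R, seqE s (fourierCoef (N y)) ≤ ENNReal.ofReal M)
    (hNK : ∀ y ∈ ballL2 c R, ∀ y' ∈ ballL2 c R, ‖N y - N y'‖ ≤ K * ‖y - y'‖)
    (hcontr : (b - a) * K < 1)
    (hball : ∀ x : ℝ → L2 d, Continuous x → (∀ τ, x τ ∈ ballL2 c R) → ∀ t ∈ Icc a b,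
      ∀ u : HSp d s, (∀ k, fourierCoef u.val k =
        mildCoef ν a (fourierCoef u₀.val) (fun τ => h τ + N (x τ)) t k) → ‖u - c‖ ≤ R) :
    ∃ (x : ℝ → L2 d) (u : ℝ → HSp d s), Continuous x ∧ (∀ τ, x τ ∈ ballL2 c R) ∧
      (∀ t ∈ Icc a b, (u t).val = x t) ∧
      (∀ t ∈ Icc a b, ∀ k, fourierCoef (u t).val k =
        mildCoef ν a (fourierCoef u₀.val) (fun τ => h τ + N (x τ)) t k) ∧
      ContinuousOn u (Icc a b) ∧
      ∃ v : ℝ → HSp d (s + 1), MemLp v 2 (volume.restrict (Icc a b)) ∧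
        ∀ᵐ t ∂(volume.restrict (Icc a b)), HSp.incl (Nat.le_succ s) (v t) = u t := by
  -- continuity of `N ∘ x` and integrability of the forcing
  have hNc : ∀ x : ℝ → L2 d, Continuous x → (∀ τ, x τ ∈ ballL2 c R) →
      Continuous fun τ => N (x τ) := fun x hx hxb => continuous_comp_of_lipschitz hNK hx hxb
  have hwm : ∀ x : ℝ → L2 d, Continuous x → (∀ τ, x τ ∈ ballL2 c R) →
      AEStronglyMeasurable (fun τ => h τ + N (x τ)) (volume.restrict (Icc a b)) :=
    fun x hx hxb => hh.add (hNc x hx hxb).aestronglyMeasurable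
  have hwi : ∀ x : ℝ → L2 d, Continuous x → (∀ τ, x τ ∈ ballL2 c R) →
      ∫⁻ τ in Icc a b, seqE ((s : ℝ) - 1) (fourierCoef (h τ + N (x τ) : L2 d)) ≠ ⊤ := by
    intro x hx hxb
    have hle : ∀ τ, seqE ((s : ℝ) - 1) (fourierCoef (h τ + N (x τ) : L2 d)) ≤
        2 * seqE ((s : ℝ) - 1) (fourierCoef (h τ)) + 2 * ENNReal.ofReal M := fun τ => by
      have e : fourierCoef (h τ + N (x τ) : L2 d) = fourierCoef (h τ) + fourierCoef (N (x τ)) :=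
        funext fun k => fourierCoef_add _ _ k
      rw [e]
      refine (seqE_add_le _ _ _).trans (add_le_add le_rfl (mul_le_mul' le_rfl ?_))
      exact (seqE_mono (by linarith) _).trans (hNM _ (hxb τ))
    refine ne_top_of_le_ne_top ?_ (lintegral_mono hle)
    rw [lintegral_add_right _ measurable_const, lintegral_const_mul' _ _ (by finiteness),
      setLIntegral_const, Real.volume_Icc]
    finiteness
  -- the curves in the ball, a complete space for the `L²` sup metric
  set X : Set C(Icc a b, L2 d) := {x | ∀ t, x t ∈ ballL2 c R} with hX
  have hXc : IsClosed X := by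
    simp only [hX, Set.ofPred_forall]
    exact isClosed_iInter fun t =>
      (isClosed_ballL2 c hR).preimage (continuous_eval_const t)
  have : CompleteSpace X := hXc.completeSpace_coe
  have : Nonempty X := ⟨⟨ContinuousMap.const _ c.val, fun t => ⟨c, rfl, by simpa using hR⟩⟩⟩
  have hext : ∀ x : X, Continuous (IccExtend hab x.1) := fun x => x.1.continuous.Icc_extend'
  have hextb : ∀ (x : X) (τ : ℝ), IccExtend hab x.1 τ ∈ ballL2 c R := fun x τ => x.2 _
  choose U hU hUc hUL using fun x : X =>
    exists_mild hν hab u₀ (hwm _ (hext x) (hextb x)) (hwi _ (hext x) (hextb x))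
  set Φ : X → X := fun x => ⟨⟨fun t => (U x t).val, by
      have h1 := (HSp.toL2CLM d s).continuous.comp_continuousOn (hUc x)
      exact continuousOn_iff_continuous_domRestrict.1 h1⟩, fun t =>
    ⟨U x t, rfl, hball _ (hext x) (hextb x) t t.2 _ (hU x t t.2)⟩⟩ with hΦ
  have hba : 0 ≤ b - a := by linarith
  have hΦc : ContractingWith ⟨(b - a) * K, mul_nonneg hba hK0⟩ Φ := by
    refine ⟨by exact_mod_cast hcontr, LipschitzWith.of_dist_le_mul fun x y => ?_⟩
    rw [Subtype.dist_eq, Subtype.dist_eq]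
    refine (ContinuousMap.dist_le (mul_nonneg (mul_nonneg hba hK0) dist_nonneg)).2 fun t => ?_
    change dist (U x t).val (U y t).val ≤ (b - a) * K * dist x.1 y.1
    rw [dist_eq_norm]
    set G : ℝ → L2 d := fun τ => N (IccExtend hab x.1 τ) - N (IccExtend hab y.1 τ) with hG
    have hGc : Continuous G := (hNc _ (hext x) (hextb x)).sub (hNc _ (hext y) (hextb y))
    have hGb : ∀ τ, ‖G τ‖ ≤ K * dist x.1 y.1 := fun τ => by
      refine (hNK _ (hextb x τ) _ (hextb y τ)).trans (mul_le_mul_of_nonneg_left ?_ hK0)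
      rw [← dist_eq_norm]
      exact ContinuousMap.dist_apply_le_dist _
    have hco : fourierCoef ((U x t).val - (U y t).val : L2 d) = fun k : Fin d → ℤ =>
        duh (ν * freqSq k) a (fun τ => fourierCoef (G τ) k) t := by
      funext k
      rw [fourierCoef_sub, hU x t t.2, hU y t t.2, mildCoef, mildCoef, add_sub_add_left_eq_sub,
        ← duh_sub (integrableOn_coef (hwm _ (hext x) (hextb x)) (hwi _ (hext x) (hextb x)) k)
          (integrableOn_coef (hwm _ (hext y) (hextb y)) (hwi _ (hext y) (hextb y)) k) t.2]
      congr 1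
      funext τ
      rw [← fourierCoef_sub, hG]
      rw [add_sub_add_left_eq_sub]
    have h1 : ‖(U x t).val - (U y t).val‖ₑ ^ 2 ≤
        ENNReal.ofReal (((b - a) * K * dist x.1 y.1) ^ 2) := by
      rw [← seqE_zero_fourierCoef, hco]
      refine (seqE_duh_le hν.le hGc.aestronglyMeasurable t.2 0).trans ?_
      calc _ ≤ ENNReal.ofReal (b - a) *
            ∫⁻ _τ in Icc a b, ENNReal.ofReal ((K * dist x.1 y.1) ^ 2) := by
            refine mul_le_mul' le_rfl (lintegral_mono fun τ => ?_)
            rw [seqE_zero_fourierCoef, ← ofReal_norm, ← ENNReal.ofReal_pow (norm_nonneg _)]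
            exact ENNReal.ofReal_le_ofReal (pow_le_pow_left₀ (norm_nonneg _) (hGb τ) 2)
        _ = _ := by
            rw [setLIntegral_const, Real.volume_Icc, ← ENNReal.ofReal_mul (by positivity),
              ← ENNReal.ofReal_mul (by positivity)]
            congr 1
            ring
    rw [ENNReal.ofReal_pow (by positivity), ENNReal.pow_le_pow_left_iff (by norm_num),
      ← ofReal_norm, ENNReal.ofReal_le_ofReal_iff (by positivity)] at h1
    exact h1
  set x := ContractingWith.fixedPoint Φ hΦc with hx
  have hfix : Φ x = x := hΦc.fixedPoint_isFixedPt
  refine ⟨IccExtend hab x.1, U x, hext x, hextb x, fun t ht => ?_, hU x, hUc x, hUL x⟩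
  rw [IccExtend_of_mem hab _ ht]
  have := congrArg (fun z : X => z.1 ⟨t, ht⟩) hfix
  exact this

end LocalSolutions

/-! ### Response to large, short impulses -/

section Impulse

variable {d s q : ℕ} {ν A : ℝ} {f : ℝ → ℝ}

lemma remainder_mono (v W : HSp d s) (ζ : HSp d (s + 2)) (lam δ M : ℝ) {H H' : ℝ≥0∞}
    (hH : H ≤ H') : remainder ν s v W ζ lam δ H M ≤ remainder ν s v W ζ lam δ H' M := by
  unfold remainder
  gcongr

/-- With `δ = lam^{-(q+1)}` and `M` of order `lam^q`, the remainder is governed by the forcing. -/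
lemma tendsto_remainder (hν : 0 < ν) (hq : 1 ≤ q) (v W : HSp d s) (ζ : HSp d (s + 2)) {H : ℝ≥0∞}
    (hH : H ≠ ⊤) (C : ℝ) :
    Tendsto (fun lam : ℝ => remainder ν s v W ζ lam (lam ^ (q + 1))⁻¹ H (C * lam ^ q)) atTop
      (𝓝 (16 * (ENNReal.ofReal (1 / ν) * H))) := by
  have hδ : Tendsto (fun lam : ℝ => (lam ^ (q + 1))⁻¹) atTop (𝓝 0) :=
    (tendsto_pow_atTop (by omega)).inv_tendsto_atTop
  have hδ' : Tendsto (fun lam : ℝ => (lam ^ (q + 1))⁻¹) atTop (𝓝[≥] 0) := by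
    refine tendsto_nhdsWithin_iff.2 ⟨hδ, ?_⟩
    filter_upwards [eventually_ge_atTop 0] with lam hl
    exact inv_nonneg.2 (pow_nonneg hl _)
  have h1 := (tendsto_seqE_heat ν hν.le v.seqE_ne_top).comp hδ'
  have h4 := (tendsto_seqE_heat ν hν.le W.seqE_ne_top).comp hδ'
  have e2 : Tendsto (fun lam : ℝ => lam * ν * (lam ^ (q + 1))⁻¹) atTop (𝓝 0) := by
    have : Tendsto (fun lam : ℝ => ν * (lam ^ q)⁻¹) atTop (𝓝 (ν * 0)) :=
      (tendsto_pow_atTop (by omega)).inv_tendsto_atTop.const_mul ν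
    rw [mul_zero] at this
    refine this.congr' ?_
    filter_upwards [eventually_gt_atTop 0] with lam hl
    field_simp
    ring
  have e5 : Tendsto (fun lam : ℝ => (lam ^ (q + 1))⁻¹ * (C * lam ^ q)) atTop (𝓝 0) := by
    have : Tendsto (fun lam : ℝ => C * lam⁻¹) atTop (𝓝 (C * 0)) :=
      tendsto_inv_atTop_zero.const_mul C
    rw [mul_zero] at this
    refine this.congr' ?_
    filter_upwards [eventually_gt_atTop 0] with lam hl
    field_simp
    ring
  have h2 := ENNReal.tendsto_ofReal (e2.pow 2)
  have h5 := ENNReal.tendsto_ofReal (e5.pow 2)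
  have h3 := ENNReal.tendsto_ofReal (hδ.add_const (1 / ν))
  simp only [ne_eq, OfNat.ofNat_ne_zero, not_false_eq_true, zero_pow, ENNReal.ofReal_zero,
    zero_add] at h2 h3 h5
  have g1 := ENNReal.Tendsto.const_mul (a := 4) h1 (Or.inr (by finiteness))
  have g2 := ENNReal.Tendsto.const_mul (a := 8)
    (ENNReal.Tendsto.mul_const (b := ‖ζ‖ₑ ^ 2) h2 (Or.inr (by finiteness))) (Or.inr (by finiteness))
  have g3 := ENNReal.Tendsto.const_mul (a := 16)
    (ENNReal.Tendsto.mul_const (b := H) h3 (Or.inr hH)) (Or.inr (by finiteness))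
  have g4 := ENNReal.Tendsto.const_mul (a := 32) h4 (Or.inr (by finiteness))
  have g5 := ENNReal.Tendsto.const_mul (a := 32) h5 (Or.inr (by finiteness))
  have := (((g1.add g2).add g3).add g4).add g5
  simp only [mul_zero, zero_mul, add_zero, zero_add] at this
  exact this

/-- The remainder is small, uniformly in the position of the time interval. -/
lemma eventually_remainder_lt (hν : 0 < ν) (hq : 1 ≤ q) (v W : HSp d s) (ζ : HSp d (s + 2))
    {G : ℝ → ℝ≥0∞} (hG : ∫⁻ τ, G τ ≠ ⊤) (C : ℝ) {κ : ℝ≥0∞} (hκ : 0 < κ) :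
    ∀ᶠ lam : ℝ in atTop, ∀ a b : ℝ, b - a = (lam ^ (q + 1))⁻¹ →
      remainder ν s v W ζ lam (b - a) (∫⁻ τ in Icc a b, G τ) (C * lam ^ q) < κ := by
  -- a level `H` for the forcing at which the limit of the remainder is still below `κ`
  have h0 : Tendsto (fun H : ℝ≥0∞ => 16 * (ENNReal.ofReal (1 / ν) * H)) (𝓝 0) (𝓝 0) := by
    have : Continuous fun H : ℝ≥0∞ => 16 * (ENNReal.ofReal (1 / ν) * H) :=
      (ENNReal.continuous_const_mul (by finiteness)).comp
        (ENNReal.continuous_const_mul ENNReal.ofReal_ne_top)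
    simpa using this.tendsto 0
  have h1 := ((h0.mono_left (nhdsWithin_le_nhds (s := Ioi 0))).eventually_lt_const hκ).and
    (((eventually_lt_nhds (ENNReal.zero_lt_top)).filter_mono nhdsWithin_le_nhds).and
      self_mem_nhdsWithin)
  obtain ⟨H, hH, hHt, hH0⟩ := h1.exists
  obtain ⟨μ, hμ, hμG⟩ := exists_pos_setLIntegral_lt_of_measure_lt hG (ne_of_gt hH0)
  have hδ : Tendsto (fun lam : ℝ => ENNReal.ofReal (lam ^ (q + 1))⁻¹) atTop (𝓝 0) := by
    have := ENNReal.tendsto_ofReal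
      ((tendsto_pow_atTop (α := ℝ) (n := q + 1) (by omega)).inv_tendsto_atTop)
    simpa using this
  filter_upwards [(tendsto_remainder hν hq v W ζ hHt.ne C).eventually_lt_const hH,
    hδ.eventually_lt_const hμ] with lam hl1 hl2 a b hab
  rw [hab]
  refine (remainder_mono v W ζ _ _ _ (hμG _ ?_).le).trans_lt hl1
  rwa [Real.volume_Icc, hab]

/-- If the initial datum `v'` near `v` is shifted by `lam ζ` and the control `lam^(q+1) η` acts for
time `lam^{-(q+1)}`, where `f` has leading part `A y^(q+1)`, then for large `lam` the solution stays
near `lam ζ + v + θ (η - A ζ^(q+1))`, with `θ ∈ [0, 1]` the rescaled time. The threshold for `lam`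
does not depend on the starting time. -/
lemma HasLeadingPart.exists_impulse_response (hf : HasLeadingPart d s f A q) (hq : 1 ≤ q)
    (hs1 : 1 ≤ s) (hs : (d : ℝ) / 2 < s) (hν : 0 < ν) {h : ℝ → HSp d (s - 1)}
    (hh : MemLp h 2 volume) (ζ η : HSp d (s + 2)) {Z W : HSp d s}
    (hZ : ∀ᵐ x ∂(torusMeasure d), Z.val x = ζ.val x ^ (q + 1))
    (hW : W = HSp.incl (Nat.le_add_right s 2) η - A • Z) (v : HSp d s) {ε : ℝ} (hε : 0 < ε) :
    ∃ ρ : ℝ, 0 < ρ ∧ ∃ Λ : ℝ, 1 ≤ Λ ∧ ∀ lam : ℝ, Λ ≤ lam → ∀ a : ℝ, ∀ v' : HSp d s, ‖v' - v‖ ≤ ρ →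
      ∃ u : ℝ → HSp d s,
        SolvesOn ν f a (a + (lam ^ (q + 1))⁻¹) (v' + lam • HSp.incl (Nat.le_add_right s 2) ζ)
          (fun t => h t + HSp.incl (by omega) (lam ^ (q + 1) • η)) u ∧
        ∀ t ∈ Icc a (a + (lam ^ (q + 1))⁻¹),
          ‖u t - lam • HSp.incl (Nat.le_add_right s 2) ζ - v - (lam ^ (q + 1) * (t - a)) • W‖ < ε := by
  -- the expected solution, up to an error `ε`, stays within `R` of `lam ζ`
  set R : ℝ := ‖v‖ + ‖W‖ + ε with hR
  have hR0 : 0 ≤ R := by positivity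
  obtain ⟨C, hC, hFex⟩ := hf.exists_remainder hs ζ hZ R
  obtain ⟨K, hK, hKL⟩ := hf.nem_lipschitz hs (HSp.incl (Nat.le_add_right s 2) ζ) hR0
  have hE : ∀ τ, seqE ((s : ℝ) - 1) (fourierCoef (h τ).val) = ‖h τ‖ₑ ^ 2 := fun τ => by
    rw [HSp.enorm_sq, Nat.cast_sub hs1, Nat.cast_one]
  have hhi : ∫⁻ τ, seqE ((s : ℝ) - 1) (fourierCoef (h τ).val) ≠ ⊤ := by
    simp only [hE]
    have := hh.2
    rw [eLpNorm_lt_top_iff_lintegral_rpow_enorm_lt_top (by norm_num) (by norm_num)] at this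
    simpa using this.ne
  have hhm : AEStronglyMeasurable (fun τ => (h τ).val) volume :=
    (HSp.toL2CLM d (s - 1)).continuous.comp_aestronglyMeasurable hh.1
  have hKδ : ∀ᶠ lam : ℝ in atTop, K * lam⁻¹ < 1 := by
    have : Tendsto (fun lam : ℝ => K * lam⁻¹) atTop (𝓝 (K * 0)) :=
      tendsto_inv_atTop_zero.const_mul K
    rw [mul_zero] at this
    exact this.eventually_lt_const one_pos
  have hrem := eventually_remainder_lt hν hq v W ζ hhi C
    (κ := ENNReal.ofReal (ε ^ 2 / 2)) (ENNReal.ofReal_pos.2 (by positivity))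
  obtain ⟨Λ, hΛ⟩ := eventually_atTop.1 (hrem.and hKδ)
  refine ⟨ε / 2, by positivity, max Λ 1, le_max_right _ _, fun lam hl a v' hv' => ?_⟩
  obtain ⟨hrl, hkl⟩ := hΛ lam ((le_max_left _ _).trans hl)
  have hl1 : 1 ≤ lam := (le_max_right _ _).trans hl
  have hl0 : 0 < lam := by linarith
  set m : ℝ := lam ^ (q + 1) with hm
  have hm0 : 0 < m := by positivity
  set b : ℝ := a + m⁻¹ with hb
  have hba : b - a = m⁻¹ := by rw [hb]; ring
  have hab : a < b := by rw [hb]; linarith [inv_pos.2 hm0]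
  have hmb : m * (b - a) = 1 := by rw [hba]; exact mul_inv_cancel₀ hm0.ne'
  set c : HSp d s := lam • HSp.incl (Nat.le_add_right s 2) ζ with hc
  set N : L2 d → L2 d := fun y => m • η.val - nem f y with hN
  have hrem' := hrl a b hba
  -- on the ball, `N` is `m W` up to a remainder bounded in `H^s`
  have hNF : ∀ y ∈ ballL2 c R, ∃ F : HSp d s, F.val = m • W.val - N y ∧ ‖F‖ ≤ C * lam ^ q := by
    intro y hy
    obtain ⟨F, hF, hFn⟩ := hFex lam hl1 y hy
    refine ⟨F, ?_, hFn⟩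
    simp only [hF, hN, hW, HSp.val_sub, HSp.incl_val, HSp.val_smul, smul_sub, smul_smul, ← hm]
    abel
  have hclose : ∀ x : ℝ → L2 d, Continuous (fun τ => N (x τ)) → (∀ τ, x τ ∈ ballL2 c R) →
      ∀ t ∈ Icc a b, ∀ u : HSp d s, (∀ k, fourierCoef u.val k =
        mildCoef ν a (fourierCoef (v' + c).val) (fun τ => (h τ).val + N (x τ)) t k) →
        ‖u - c - v - (m * (t - a)) • W‖ < ε := by
    intro x hNx hxb t ht u hu
    choose F hF hFn using fun τ => hNF (x τ) (hxb τ)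
    have hFm : AEStronglyMeasurable (fun τ => (F τ).val) (volume.restrict (Icc a b)) := by
      simp only [hF]
      exact (continuous_const.sub hNx).aestronglyMeasurable
    have hu' : ∀ k, fourierCoef u.val k = mildCoef ν a (fourierCoef (v' + c).val)
        (fun τ => (h τ).val + (m • W.val - (F τ).val)) t k := by
      intro k
      rw [hu k]
      simp only [hF, sub_sub_cancel]
    have h1 := mild_close (v := v) hν hab hmb hl0.le (by positivity) hhm.restrict
      (ne_top_of_le_ne_top hhi (setLIntegral_le_lintegral _ _)) hFm hFn ht hu'
    have h2 : ‖u - c - v - (m * (t - a)) • W‖ₑ ^ 2 < ENNReal.ofReal (ε ^ 2) := by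
      refine h1.trans_lt ?_
      have h3 : 2 * ‖v' - v‖ₑ ^ 2 ≤ ENNReal.ofReal (ε ^ 2 / 2) := by
        calc 2 * ‖v' - v‖ₑ ^ 2 ≤ ENNReal.ofReal 2 * ENNReal.ofReal (ε / 2) ^ 2 := by
              rw [← ofReal_norm]
              gcongr
              simp
          _ = _ := by
              rw [← ENNReal.ofReal_pow (by positivity), ← ENNReal.ofReal_mul (by norm_num)]
              congr 1
              ring
      calc _ < ENNReal.ofReal (ε ^ 2 / 2) + ENNReal.ofReal (ε ^ 2 / 2) :=
            ENNReal.add_lt_add_of_le_of_lt (by finiteness) h3 hrem'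
        _ = _ := by
            rw [← ENNReal.ofReal_add (by positivity) (by positivity)]
            congr 1
            ring
    rw [ENNReal.ofReal_pow hε.le, ENNReal.pow_lt_pow_left_iff (by norm_num), ← ofReal_norm,
      ENNReal.ofReal_lt_ofReal_iff hε] at h2
    exact h2
  have hNK : ∀ y ∈ ballL2 c R, ∀ y' ∈ ballL2 c R, ‖N y - N y'‖ ≤ K * lam ^ q * ‖y - y'‖ := by
    intro y hy y' hy'
    simp only [hN, sub_sub_sub_cancel_left]
    rw [norm_sub_rev y]
    exact hKL lam hl1 y' hy' y hy
  have hNM : ∀ y ∈ ballL2 c R, seqE s (fourierCoef (N y)) ≤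
      ENNReal.ofReal ((m * ‖W‖ + C * lam ^ q) ^ 2) := by
    intro y hy
    obtain ⟨F, hF, hFn⟩ := hNF y hy
    have e : N y = (m • W - F).val := by
      rw [HSp.val_sub, HSp.val_smul, hF, sub_sub_cancel]
    rw [e, ← HSp.norm_le_iff _ (by positivity)]
    refine (norm_sub_le _ _).trans (add_le_add ?_ hFn)
    rw [norm_smul, Real.norm_of_nonneg hm0.le]
  have hcontr : (b - a) * (K * lam ^ q) < 1 := by
    rw [hba, hm]
    calc _ = K * lam⁻¹ := by field_simp; ring
      _ < 1 := hkl
  obtain ⟨x, u, hx, hxb, hux, hu, huc, huL⟩ := exists_mild_nonlinear hν hab.le (u₀ := v' + c) hR0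
    (by positivity) (hhm.restrict (s := Icc a b))
    (ne_top_of_le_ne_top hhi (setLIntegral_le_lintegral _ _)) hNM hNK hcontr
    (fun x hx hxb t ht u hu => by
      have h1 := hclose x (continuous_comp_of_lipschitz hNK hx hxb) hxb t ht u hu
      have h2 : u - c = (u - c - v - (m * (t - a)) • W) + v + (m * (t - a)) • W := by abel
      have h3 : m * (t - a) ≤ 1 := by
        rw [← hmb]
        exact mul_le_mul_of_nonneg_left (by linarith [ht.2]) hm0.le
      have h4 : 0 ≤ m * (t - a) := mul_nonneg hm0.le (by linarith [ht.1])
      have h5 : ‖(m * (t - a)) • W‖ ≤ ‖W‖ := by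
        rw [norm_smul, Real.norm_of_nonneg h4]
        exact mul_le_of_le_one_left (norm_nonneg _) h3
      rw [h2]
      refine (norm_add₃_le).trans ?_
      rw [hR]
      linarith)
  have hNx := continuous_comp_of_lipschitz hNK hx hxb
  refine ⟨u, ⟨huc, huL, ?_, ?_⟩, fun t ht => hclose x hNx hxb t ht _ (hu t ht)⟩
  · refine HSp.ext_coef fun k => ?_
    rw [hu a (left_mem_Icc.2 hab.le) k]
    simp [mildCoef, duh]
  · intro k t ht
    have hwm : AEStronglyMeasurable (fun τ => (h τ).val + N (x τ)) (volume.restrict (Icc a b)) :=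
      hhm.restrict.add hNx.aestronglyMeasurable
    have hwi : IntegrableOn (fun τ => fourierCoef ((h τ).val + N (x τ) : L2 d) k) (Icc a b) := by
      have i1 := integrableOn_coef (hhm.restrict (s := Icc a b))
        (ne_top_of_le_ne_top hhi (setLIntegral_le_lintegral _ _)) k
      have i2 : Continuous fun τ => fourierCoef (N (x τ)) k := by
        have := (coefL2 k).continuous.comp hNx
        exact this
      simp only [fourierCoef_add]
      exact i1.add i2.continuousOn.integrableOn_Icc
    rw [hu t ht k, mildCoef, mild_integral_eq hwi ht]
    congr 1
    refine intervalIntegral.integral_congr fun τ hτ => ?_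
    rw [uIcc_of_le ht.1] at hτ
    have hτ' : τ ∈ Icc a b := ⟨hτ.1, hτ.2.trans ht.2⟩
    have e1 := hu τ hτ' k
    rw [mildCoef] at e1
    have e2 : fourierCoef (nem f (x τ)) = fourierCoef fun y => f ((u τ).val y) := by
      rw [← hux τ hτ']
      exact fourierCoef_congr (nem_ae (hf.memLp hs (u τ)))
    rw [← e1, hN, fourierCoef_add, fourierCoef_sub, e2, HSp.val_add, fourierCoef_add, HSp.incl_val,
      HSp.val_smul]
    ring

end Impulse

/-! ### Concatenation and uniqueness of solutions -/

section Solutions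

variable {d s q : ℕ} {ν A a b c : ℝ} {f : ℝ → ℝ}

lemma HasLeadingPart.exists_lipschitz_on_ball (hf : HasLeadingPart d s f A q)
    (hs : (d : ℝ) / 2 < s) {R : ℝ} (hR : 0 ≤ R) :
    ∃ K : ℝ, 0 ≤ K ∧ ∀ u u' : HSp d s, ‖u‖ ≤ R → ‖u'‖ ≤ R →
      ‖nem f u.val - nem f u'.val‖ ≤ K * ‖u.val - u'.val‖ := by
  obtain ⟨K, hK, h⟩ := hf.nem_lipschitz hs 0 hR
  refine ⟨K, hK, fun u u' hu hu' => ?_⟩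
  simpa using h 1 le_rfl u.val ⟨u, rfl, by simpa using hu⟩ u'.val ⟨u', rfl, by simpa using hu'⟩

lemma HasLeadingPart.continuousOn_nem (hf : HasLeadingPart d s f A q) (hs : (d : ℝ) / 2 < s)
    {u : ℝ → HSp d s} (hu : ContinuousOn u (Icc a b)) :
    ContinuousOn (fun t => nem f (u t).val) (Icc a b) := by
  obtain ⟨R, hR⟩ := isCompact_Icc.exists_bound_of_continuousOn hu
  obtain ⟨K, hK, h⟩ := hf.exists_lipschitz_on_ball hs (le_max_right R 0)
  intro t ht
  rw [ContinuousWithinAt, tendsto_iff_norm_sub_tendsto_zero]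
  have h1 : ContinuousOn (fun τ => K * ‖(u τ).val - (u t).val‖) (Icc a b) := by
    have := (HSp.toL2CLM d s).continuous.comp_continuousOn hu
    exact ((this.sub continuousOn_const).norm).const_smul K
  have h2 := h1 t ht
  simp only [ContinuousWithinAt, sub_self, norm_zero, mul_zero] at h2
  refine squeeze_zero' (Eventually.of_forall fun _ => norm_nonneg _) ?_ h2
  filter_upwards [self_mem_nhdsWithin] with τ hτ
  exact h _ _ ((hR τ hτ).trans (le_max_left _ _)) ((hR t ht).trans (le_max_left _ _))

lemma HasLeadingPart.fourierCoef_nem (hf : HasLeadingPart d s f A q) (hs : (d : ℝ) / 2 < s)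
    (u : HSp d s) : fourierCoef (nem f u.val) = fourierCoef fun x => f (u.val x) :=
  fourierCoef_congr (nem_ae (hf.memLp hs u))

lemma HasLeadingPart.continuousOn_fourierCoef (hf : HasLeadingPart d s f A q)
    (hs : (d : ℝ) / 2 < s) {u : ℝ → HSp d s} (hu : ContinuousOn u (Icc a b)) (k : Fin d → ℤ) :
    ContinuousOn (fun t => fourierCoef (fun x => f ((u t).val x)) k) (Icc a b) := by
  have := (coefL2 k).continuous.comp_continuousOn (hf.continuousOn_nem hs hu)
  refine this.congr fun t _ => ?_
  simp only [Function.comp_apply, coefL2_apply, hf.fourierCoef_nem hs]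

lemma HSp.continuousOn_fourierCoef {u : ℝ → HSp d s} (hu : ContinuousOn u (Icc a b))
    (k : Fin d → ℤ) : ContinuousOn (fun t => fourierCoef (u t).val k) (Icc a b) :=
  (HSp.coefCLM s k).continuous.comp_continuousOn hu

lemma HasLeadingPart.integrableOn_equation (hf : HasLeadingPart d s f A q) (hs : (d : ℝ) / 2 < s)
    {u : ℝ → HSp d s} (hu : ContinuousOn u (Icc a b)) {φ : ℝ → HSp d (s - 1)}
    (hφ : MemLp φ 2 (volume.restrict (Icc a b))) (k : Fin d → ℤ) :
    IntegrableOn (fun τ => -((ν * freqSq k : ℝ) : ℂ) * fourierCoef (u τ).val k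
      - fourierCoef (fun x => f ((u τ).val x)) k + fourierCoef (φ τ).val k) (Icc a b) := by
  refine Integrable.add ?_ ?_
  · exact ((continuousOn_const.mul (HSp.continuousOn_fourierCoef hu k)).sub
      (hf.continuousOn_fourierCoef hs hu k)).integrableOn_Icc
  · exact ((HSp.coefCLM (s - 1) k).comp_memLp' hφ).integrable (by norm_num)

lemma memLp_piecewise {E : Type*} [NormedAddCommGroup E] {v v' : ℝ → E}
    (hv : MemLp v 2 (volume.restrict (Icc a b))) (hv' : MemLp v' 2 (volume.restrict (Icc b c))) :
    MemLp ((Iic b).piecewise v v') 2 (volume.restrict (Icc a c)) := by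
  have h1 : Iic b ∩ Icc a c ⊆ Icc a b := fun t ht => ⟨ht.2.1, ht.1⟩
  have h2 : (Iic b)ᶜ ∩ Icc a c ⊆ Icc b c := fun t ht => ⟨(notMem_Iic.1 ht.1).le, ht.2.2⟩
  refine MemLp.piecewise measurableSet_Iic ?_ ?_
  · rw [Measure.restrict_restrict measurableSet_Iic]
    exact hv.mono_measure (Measure.restrict_mono h1 le_rfl)
  · rw [Measure.restrict_restrict measurableSet_Iic.compl]
    exact hv'.mono_measure (Measure.restrict_mono h2 le_rfl)

/-- Solutions on adjacent time intervals fit together. -/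
lemma SolvesOn.concat (hf : HasLeadingPart d s f A q) (hs : (d : ℝ) / 2 < s) (hab : a ≤ b)
    (hbc : b ≤ c) {u₀ : HSp d s} {u u' : ℝ → HSp d s} {φ φ' : ℝ → HSp d (s - 1)}
    (hu : SolvesOn ν f a b u₀ φ u) (hu' : SolvesOn ν f b c (u b) φ' u')
    (hφ : MemLp φ 2 (volume.restrict (Icc a b))) (hφ' : MemLp φ' 2 (volume.restrict (Icc b c))) :
    SolvesOn ν f a c u₀ ((Iic b).piecewise φ φ') ((Iic b).piecewise u u') := by
  have hle : ∀ {E : Type _} (g g' : ℝ → E) {t : ℝ}, t ≤ b → (Iic b).piecewise g g' t = g t :=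
    fun g g' _ ht => piecewise_eq_of_mem _ _ _ ht
  have hgt : ∀ {E : Type _} (g g' : ℝ → E) {t : ℝ}, b < t → (Iic b).piecewise g g' t = g' t :=
    fun g g' _ ht => piecewise_eq_of_notMem _ _ _ (not_le.2 ht)
  have hge : ∀ {t : ℝ}, b ≤ t → (Iic b).piecewise u u' t = u' t := fun {t} ht => by
    rcases ht.eq_or_lt with rfl | h
    · rw [hle _ _ le_rfl, hu'.initial]
    · exact hgt _ _ h
  have hcont : ContinuousOn ((Iic b).piecewise u u') (Icc a c) := by
    rw [← Icc_union_Icc_eq_Icc hab hbc]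
    exact (hu.continuousOn.congr fun t ht => hle _ _ ht.2).union_of_isClosed
      (hu'.continuousOn.congr fun t ht => hge ht.1) isClosed_Icc isClosed_Icc
  have hint := hf.integrableOn_equation (ν := ν) hs hcont (memLp_piecewise hφ hφ')
  refine ⟨hcont, ?_, ?_, ?_⟩
  · obtain ⟨v, hv, hvu⟩ := hu.memL2
    obtain ⟨v', hv', hvu'⟩ := hu'.memL2
    refine ⟨(Iic b).piecewise v v', memLp_piecewise hv hv', ?_⟩
    rw [ae_restrict_iff' measurableSet_Icc] at hvu hvu' ⊢
    filter_upwards [hvu, hvu'] with t h1 h2 ht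
    rcases le_or_gt t b with h | h
    · rw [hle _ _ h, hle _ _ h, h1 ⟨ht.1, h⟩]
    · rw [hgt _ _ h, hgt _ _ h, h2 ⟨h.le, ht.2⟩]
  · rw [hle _ _ hab, hu.initial]
  · intro k
    -- the equation up to time `b`
    have h1 : ∀ t ∈ Icc a b, fourierCoef (u t).val k = fourierCoef u₀.val k +
        ∫ τ in a..t, (-((ν * freqSq k : ℝ) : ℂ) * fourierCoef ((Iic b).piecewise u u' τ).val k
          - fourierCoef (fun x => f (((Iic b).piecewise u u' τ).val x)) k
          + fourierCoef ((Iic b).piecewise φ φ' τ).val k) := by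
      intro t ht
      rw [hu.equation k t ht]
      congr 1
      refine intervalIntegral.integral_congr_ae (ae_of_all _ fun τ hτ => ?_)
      rw [uIoc_of_le ht.1] at hτ
      rw [hle _ _ (hτ.2.trans ht.2), hle _ _ (hτ.2.trans ht.2)]
    intro t ht
    rcases le_total t b with h | h
    · rw [hle _ _ h]
      exact h1 t ⟨ht.1, h⟩
    · have i1 := intervalIntegrable_of_integrableOn_Icc (hint k) (t := b) ⟨hab, hbc⟩
      have i2 := intervalIntegrable_of_integrableOn_Icc (hint k) (t := t) ht
      rw [hge h, hu'.equation k t ⟨h, ht.2⟩, h1 b ⟨hab, le_rfl⟩, add_assoc]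
      congr 1
      rw [← intervalIntegral.integral_add_adjacent_intervals i1 (i1.symm.trans i2)]
      congr 1
      refine intervalIntegral.integral_congr_ae (ae_of_all _ fun τ hτ => ?_)
      rw [uIoc_of_le h] at hτ
      rw [hgt _ _ hτ.1, hgt _ _ hτ.1]

/-- The scalar integral equation `z(t) = ∫ (-x z + w)` with continuous `w` is solved by the Duhamel
formula. -/
lemma eq_duh_of_integral_eq {x : ℝ} {z w : ℝ → ℂ} (hz : ContinuousOn z (Icc a b))
    (hw : ContinuousOn w (Icc a b))
    (h : ∀ t ∈ Icc a b, z t = ∫ τ in a..t, (-(x : ℂ) * z τ + w τ)) {t : ℝ} (ht : t ∈ Icc a b) :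
    z t = duh x a w t := by
  have hG : ContinuousOn (fun τ => -(x : ℂ) * z τ + w τ) (Icc a b) :=
    (continuousOn_const.mul hz).add hw
  have hd : ∀ τ ∈ Ioo a b, HasDerivAt z (-(x : ℂ) * z τ + w τ) τ := by
    intro τ hτ
    have h1 := intervalIntegral.integral_hasDerivAt_right (a := a) (b := τ)
      (intervalIntegrable_of_integrableOn_Icc hG.integrableOn_Icc ⟨hτ.1.le, hτ.2.le⟩)
      ((hG.mono Ioo_subset_Icc_self).stronglyMeasurableAtFilter isOpen_Ioo τ hτ)
      (hG.continuousAt (Icc_mem_nhds hτ.1 hτ.2))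
    refine h1.congr_of_eventuallyEq ?_
    filter_upwards [Icc_mem_nhds hτ.1 hτ.2] with σ hσ
    exact h σ hσ
  have hsub : Icc a t ⊆ Icc a b := Icc_subset_Icc_right ht.2
  have hE : Continuous fun τ : ℝ => Real.exp (-(x * (t - τ))) := by fun_prop
  have key := intervalIntegral.integral_eq_sub_of_hasDerivAt_of_le
    (f := fun τ => Real.exp (-(x * (t - τ))) • z τ)
    (f' := fun τ => Real.exp (-(x * (t - τ))) • w τ) ht.1
    (hE.continuousOn.smul (hz.mono hsub)) (fun τ hτ => by
      have h1 : HasDerivAt (fun τ : ℝ => Real.exp (-(x * (t - τ))))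
          (x * Real.exp (-(x * (t - τ)))) τ := by
        refine ((((hasDerivAt_id τ).const_sub t).const_mul x).neg.exp).congr_deriv ?_
        simp only [id_eq, Pi.neg_apply]
        ring
      refine (h1.smul (hd τ ⟨hτ.1, hτ.2.trans_le ht.2⟩)).congr_deriv ?_
      simp only [Complex.real_smul]
      push_cast
      ring)
    (by
      refine ContinuousOn.intervalIntegrable ?_
      rw [uIcc_of_le ht.1]
      exact hE.continuousOn.smul (hw.mono hsub))
  have h0 : z a = 0 := by
    rw [h a ⟨le_rfl, ht.1.trans ht.2⟩, intervalIntegral.integral_same]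
  rw [duh, key, h0]
  simp

/-- Grönwall's inequality in integral form, with zero initial value. -/
lemma eq_zero_of_le_integral {y : ℝ → ℝ} {C : ℝ} (hy : ContinuousOn y (Icc a b))
    (hy0 : ∀ t ∈ Icc a b, 0 ≤ y t) (h : ∀ t ∈ Icc a b, y t ≤ C * ∫ τ in a..t, y τ) {t : ℝ}
    (ht : t ∈ Icc a b) : y t = 0 := by
  have hab : a ≤ b := ht.1.trans ht.2
  -- the primitive `Y` of `y` satisfies `Y' ≤ C Y`, `Y(a) = 0`
  set Y : ℝ → ℝ := fun t => ∫ τ in a..t, y τ with hY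
  have hYc : ContinuousOn Y (Icc a b) := by
    have := intervalIntegral.continuousOn_primitive_interval (μ := volume) (a := a) (b := b)
      (f := y) (by rw [uIcc_of_le hab]; exact hy.integrableOn_Icc)
    rwa [uIcc_of_le hab] at this
  have hYd : ∀ τ ∈ Ico a b, HasDerivWithinAt Y (y τ) (Ici τ) τ := by
    intro τ hτ
    have h1 : ContinuousWithinAt y (Ici τ) τ :=
      (hy τ ⟨hτ.1, hτ.2.le⟩).mono_of_mem_nhdsWithin
        (mem_of_superset (Icc_mem_nhdsGE hτ.2) (Icc_subset_Icc_left hτ.1))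
    refine intervalIntegral.integral_hasDerivWithinAt_right (f := y) (s := Ici τ) (t := Ioi τ)
      ((hy.mono (Icc_subset_Icc_right hτ.2.le)).intervalIntegrable_of_Icc hτ.1)
      ?_ (h1.mono Ioi_subset_Ici_self)
    refine (hy.stronglyMeasurableAtFilter_nhdsWithin measurableSet_Icc τ).filter_mono ?_
    exact nhdsWithin_le_of_mem (mem_of_superset (Icc_mem_nhdsGT hτ.2) (Icc_subset_Icc_left hτ.1))
  have hY0 : ∀ τ ∈ Icc a b, 0 ≤ Y τ := fun τ hτ =>
    intervalIntegral.integral_nonneg hτ.1 fun σ hσ => hy0 σ ⟨hσ.1, hσ.2.trans hτ.2⟩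
  have := norm_le_gronwallBound_of_norm_deriv_right_le (δ := 0) (K := C) (ε := 0) hYc hYd
    (by simp [hY]) (fun τ hτ => by
      rw [Real.norm_of_nonneg (hy0 τ ⟨hτ.1, hτ.2.le⟩), Real.norm_of_nonneg (hY0 τ ⟨hτ.1, hτ.2.le⟩),
        add_zero]
      exact h τ ⟨hτ.1, hτ.2.le⟩) t ht
  rw [gronwallBound_ε0, zero_mul] at this
  have hYt : Y t = 0 := norm_le_zero_iff.1 this
  have h2 := h t ht
  rw [show ∫ τ in a..t, y τ = Y t from rfl, hYt, mul_zero] at h2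
  exact le_antisymm h2 (hy0 t ht)

/-- Uniqueness: `f` is Lipschitz in `L²` along bounded curves in `H^s`, so Grönwall's inequality
applies to the `L²` distance of two solutions. -/
lemma SolvesOn.eqOn (hf : HasLeadingPart d s f A q) (hs : (d : ℝ) / 2 < s) (hν : 0 ≤ ν)
    {u₀ : HSp d s} {u u' : ℝ → HSp d s} {φ : ℝ → HSp d (s - 1)}
    (hφ : MemLp φ 2 (volume.restrict (Icc a b)))
    (hu : SolvesOn ν f a b u₀ φ u) (hu' : SolvesOn ν f a b u₀ φ u') : EqOn u' u (Icc a b) := by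
  obtain ⟨R, hR⟩ := isCompact_Icc.exists_bound_of_continuousOn hu.continuousOn
  obtain ⟨R', hR'⟩ := isCompact_Icc.exists_bound_of_continuousOn hu'.continuousOn
  obtain ⟨K, hK, hL⟩ := hf.exists_lipschitz_on_ball hs (R := max (max R R') 0) (le_max_right _ _)
  have hcd : ContinuousOn (fun t => (u' t).val - (u t).val) (Icc a b) :=
    ((HSp.toL2CLM d s).continuous.comp_continuousOn hu'.continuousOn).sub
      ((HSp.toL2CLM d s).continuous.comp_continuousOn hu.continuousOn)
  set e : ℝ → L2 d := fun t => nem f (u t).val - nem f (u' t).val with he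
  have hec : ContinuousOn e (Icc a b) :=
    (hf.continuousOn_nem hs hu.continuousOn).sub (hf.continuousOn_nem hs hu'.continuousOn)
  have heL : ∀ t ∈ Icc a b, ‖e t‖ ≤ K * ‖(u' t).val - (u t).val‖ := fun t ht => by
    rw [norm_sub_rev (u' t).val]
    exact hL _ _ ((hR t ht).trans ((le_max_left _ _).trans (le_max_left _ _)))
      ((hR' t ht).trans ((le_max_right _ _).trans (le_max_left _ _)))
  -- the difference satisfies the linear equation with forcing `e`
  have hdiff : ∀ t ∈ Icc a b, fourierCoef ((u' t).val - (u t).val : L2 d) = fun k : Fin d → ℤ =>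
      duh (ν * freqSq k) a (fun τ => fourierCoef (e τ) k) t := by
    intro t ht
    funext k
    refine eq_duh_of_integral_eq (b := b)
      (z := fun t => fourierCoef ((u' t).val - (u t).val : L2 d) k)
      ((coefL2 k).continuous.comp_continuousOn hcd) ((coefL2 k).continuous.comp_continuousOn hec)
      (fun t ht => ?_) ht
    have i1 := hf.integrableOn_equation (ν := ν) hs hu.continuousOn hφ k
    have i2 := hf.integrableOn_equation (ν := ν) hs hu'.continuousOn hφ k
    rw [fourierCoef_sub, hu.equation k t ht, hu'.equation k t ht, add_sub_add_left_eq_sub,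
      ← intervalIntegral.integral_sub (intervalIntegrable_of_integrableOn_Icc i2 ht)
        (intervalIntegrable_of_integrableOn_Icc i1 ht)]
    refine intervalIntegral.integral_congr fun τ _ => ?_
    simp only [he, Function.comp_apply, coefL2_apply, fourierCoef_sub, hf.fourierCoef_nem hs]
    ring
  have hy : ∀ t ∈ Icc a b, ‖(u' t).val - (u t).val‖ ^ 2 ≤
      (b - a) * K ^ 2 * ∫ τ in a..t, ‖(u' τ).val - (u τ).val‖ ^ 2 := by
    intro t ht
    have hsub : Icc a t ⊆ Icc a b := Icc_subset_Icc_right ht.2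
    have h1 := seqE_duh_le (a := a) (b := t) hν ((hec.mono hsub).aestronglyMeasurable
      measurableSet_Icc) (right_mem_Icc.2 ht.1) 0
    rw [← hdiff t ht, seqE_zero_fourierCoef] at h1
    simp only [seqE_zero_fourierCoef] at h1
    have hi : IntegrableOn (fun τ => ‖(u' τ).val - (u τ).val‖ ^ 2) (Icc a t) :=
      ((hcd.mono hsub).norm.pow 2).integrableOn_Icc
    have h2 : ∫⁻ τ in Icc a t, ‖e τ‖ₑ ^ 2 ≤
        ENNReal.ofReal (K ^ 2 * ∫ τ in a..t, ‖(u' τ).val - (u τ).val‖ ^ 2) := by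
      rw [intervalIntegral.integral_of_le ht.1, ← integral_Icc_eq_integral_Ioc,
        ← integral_const_mul, ofReal_integral_eq_lintegral_ofReal (hi.const_mul _)
          (ae_of_all _ fun τ => by positivity)]
      refine setLIntegral_mono' measurableSet_Icc fun τ hτ => ?_
      rw [← mul_pow, ← ofReal_norm, ← ENNReal.ofReal_pow (norm_nonneg _)]
      exact ENNReal.ofReal_le_ofReal (pow_le_pow_left₀ (norm_nonneg _) (heL τ (hsub hτ)) 2)
    have h3 : 0 ≤ ∫ τ in a..t, ‖(u' τ).val - (u τ).val‖ ^ 2 :=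
      intervalIntegral.integral_nonneg ht.1 fun _ _ => by positivity
    have h4 : ENNReal.ofReal (‖(u' t).val - (u t).val‖ ^ 2) ≤
        ENNReal.ofReal ((t - a) * (K ^ 2 * ∫ τ in a..t, ‖(u' τ).val - (u τ).val‖ ^ 2)) := by
      rw [ENNReal.ofReal_pow (norm_nonneg _), ofReal_norm,
        ENNReal.ofReal_mul (by linarith [ht.1])]
      exact h1.trans (mul_le_mul' le_rfl h2)
    rw [ENNReal.ofReal_le_ofReal_iff (mul_nonneg (by linarith [ht.1])
      (mul_nonneg (sq_nonneg K) h3))] at h4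
    rw [mul_assoc]
    exact h4.trans (mul_le_mul_of_nonneg_right (by linarith [ht.2]) (mul_nonneg (sq_nonneg K) h3))
  intro t ht
  have h0 := eq_zero_of_le_integral (hcd.norm.pow 2) (fun _ _ => sq_nonneg _) hy ht
  exact HSp.ext (sub_eq_zero.1 (norm_eq_zero.1 (pow_eq_zero_iff two_ne_zero |>.1 h0)))

end Solutions

/-! ### Displacements that controls can produce in short time -/

section Control

variable {d s q : ℕ} {ν A : ℝ} {f : ℝ → ℝ} {h : ℝ → HSp d (s - 1)}
  {H : Submodule ℝ (HSp d (s + 2))}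

/-- Standing assumptions on the equation `∂ₜu - νΔu + f(u) = h + η`, with `h` given for all times
and `f` of order `q + 1 ≥ 2` with leading part `A y^(q+1)`. -/
structure Admissible (d s q : ℕ) (ν A : ℝ) (f : ℝ → ℝ) (h : ℝ → HSp d (s - 1)) : Prop where
  leadingPart : HasLeadingPart d s f A q
  one_le_q : 1 ≤ q
  one_le_s : 1 ≤ s
  dim_lt : (d : ℝ) / 2 < s
  visc_pos : 0 < ν
  forcing : MemLp h 2 volume

/-- Some `H`-valued control steers the solution from `u₀` at time `a` to `u₁` at time `b`. -/
def Steers (ν : ℝ) (f : ℝ → ℝ) (h : ℝ → HSp d (s - 1)) (H : Submodule ℝ (HSp d (s + 2)))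
    (a b : ℝ) (u₀ u₁ : HSp d s) : Prop :=
  ∃ η : ℝ → H, MemLp η 2 (volume.restrict (Icc a b)) ∧ ∃ u : ℝ → HSp d s,
    SolvesOn ν f a b u₀ (fun t => h t + HSp.incl (by omega) (η t : HSp d (s + 2))) u ∧ u b = u₁

lemma memLp_forcing {a b : ℝ} (hh : MemLp h 2 (volume.restrict (Icc a b))) {η : ℝ → H}
    (hη : MemLp η 2 (volume.restrict (Icc a b))) :
    MemLp (fun t => h t + HSp.incl (by omega) (η t : HSp d (s + 2))) 2
      (volume.restrict (Icc a b)) :=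
  hh.add (((HSp.inclCLM (d := d) (show s - 1 ≤ s + 2 by omega)).comp H.subtypeL).comp_memLp' hη)

lemma Steers.trans (S : Admissible d s q ν A f h) {a b c : ℝ} (hab : a ≤ b) (hbc : b ≤ c)
    {u₀ u₁ u₂ : HSp d s} (h₁ : Steers ν f h H a b u₀ u₁) (h₂ : Steers ν f h H b c u₁ u₂) :
    Steers ν f h H a c u₀ u₂ := by
  obtain ⟨η, hη, u, hu, rfl⟩ := h₁
  obtain ⟨η', hη', u', hu', rfl⟩ := h₂
  refine ⟨(Iic b).piecewise η η', memLp_piecewise hη hη', (Iic b).piecewise u u', ?_, ?_⟩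
  · convert hu.concat S.leadingPart S.dim_lt hab hbc hu' (memLp_forcing (S.forcing.restrict _) hη)
      (memLp_forcing (S.forcing.restrict _) hη') using 1
    funext t
    by_cases ht : t ∈ Iic b
    · simp only [piecewise_eq_of_mem _ _ _ ht]
    · simp only [piecewise_eq_of_notMem _ _ _ ht]
  · rcases hbc.eq_or_lt with rfl | hlt
    · rw [piecewise_eq_of_mem _ _ _ (mem_Iic.2 le_rfl), hu'.initial]
    · exact piecewise_eq_of_notMem _ _ _ (not_le.2 hlt)

/-- The displacement `w` can be produced, up to an arbitrarily small error and in arbitrarily short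
time, from every state and at every time. Since all initial states are allowed, the errors of
successive displacements just add up. -/
def Shiftable (ν : ℝ) (f : ℝ → ℝ) (h : ℝ → HSp d (s - 1)) (H : Submodule ℝ (HSp d (s + 2)))
    (w : HSp d s) : Prop :=
  ∀ (v : HSp d s) (a ε τ : ℝ), 0 < ε → 0 < τ →
    ∃ δ : ℝ, 0 < δ ∧ δ < τ ∧ ∃ u₁, Steers ν f h H a (a + δ) v u₁ ∧ ‖u₁ - (v + w)‖ < ε

lemma Shiftable.add (S : Admissible d s q ν A f h) {w w' : HSp d s} (hw : Shiftable ν f h H w)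
    (hw' : Shiftable ν f h H w') : Shiftable ν f h H (w + w') := by
  intro v a ε τ hε hτ
  obtain ⟨δ, hδ, hδτ, u₁, h₁, hu₁⟩ := hw v a (ε / 2) (τ / 2) (by linarith) (by linarith)
  obtain ⟨δ', hδ', hδτ', u₂, h₂, hu₂⟩ :=
    hw' u₁ (a + δ) (ε / 2) (τ / 2) (by linarith) (by linarith)
  refine ⟨δ + δ', by linarith, by linarith, u₂, ?_, ?_⟩
  · rw [← add_assoc]
    exact h₁.trans S (by linarith) (by linarith) h₂
  · have e : u₂ - (v + (w + w')) = (u₂ - (u₁ + w')) + (u₁ - (v + w)) := by abel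
    rw [e]
    exact (norm_add_le _ _).trans_lt (by linarith)

lemma isClosed_shiftable : IsClosed {w : HSp d s | Shiftable ν f h H w} := by
  refine isClosed_of_closure_subset fun w hw => ?_
  intro v a ε τ hε hτ
  obtain ⟨w', hw', hww'⟩ := Metric.mem_closure_iff.1 hw (ε / 2) (by linarith)
  obtain ⟨δ, hδ, hδτ, u₁, h₁, hu₁⟩ := hw' v a (ε / 2) τ (by linarith) hτ
  refine ⟨δ, hδ, hδτ, u₁, h₁, ?_⟩
  have e : u₁ - (v + w) = (u₁ - (v + w')) - (w - w') := by abel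
  rw [dist_eq_norm] at hww'
  rw [e]
  exact (norm_sub_le _ _).trans_lt (by linarith)

/-- The response to a constant impulse, read off at the end of the time interval. -/
lemma Admissible.exists_steers (S : Admissible d s q ν A f h) (ζ : HSp d (s + 2))
    {η : HSp d (s + 2)} (hη : η ∈ H) {Z W : HSp d s}
    (hZ : ∀ᵐ x ∂(torusMeasure d), Z.val x = ζ.val x ^ (q + 1))
    (hW : W = HSp.incl (Nat.le_add_right s 2) η - A • Z) (v : HSp d s) {ε : ℝ} (hε : 0 < ε) :
    ∃ ρ : ℝ, 0 < ρ ∧ ∃ Λ : ℝ, 1 ≤ Λ ∧ ∀ lam : ℝ, Λ ≤ lam → ∀ a : ℝ, ∀ v' : HSp d s, ‖v' - v‖ ≤ ρ →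
      ∃ u₁, Steers ν f h H a (a + (lam ^ (q + 1))⁻¹)
        (v' + lam • HSp.incl (Nat.le_add_right s 2) ζ) u₁ ∧
        ‖u₁ - lam • HSp.incl (Nat.le_add_right s 2) ζ - v - W‖ < ε := by
  obtain ⟨ρ, hρ, Λ, hΛ, hex⟩ := S.leadingPart.exists_impulse_response S.one_le_q S.one_le_s S.dim_lt
    S.visc_pos S.forcing ζ η hZ hW v hε
  refine ⟨ρ, hρ, Λ, hΛ, fun lam hl a v' hv' => ?_⟩
  obtain ⟨u, hu, hclose⟩ := hex lam hl a v' hv'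
  have hl0 : 0 < lam ^ (q + 1) := pow_pos (by linarith) _
  refine ⟨_, ⟨fun _ => ⟨lam ^ (q + 1) • η, H.smul_mem _ hη⟩, memLp_const _, u, hu, rfl⟩, ?_⟩
  have h1 := hclose _ (right_mem_Icc.2 (by linarith [inv_pos.2 hl0]))
  rwa [add_sub_cancel_left, mul_inv_cancel₀ hl0.ne', one_smul] at h1

lemma exists_ge_inv_pow_lt (q : ℕ) (Λ : ℝ) {τ : ℝ} (hτ : 0 < τ) :
    ∃ lam : ℝ, Λ ≤ lam ∧ (lam ^ (q + 1))⁻¹ < τ :=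
  ((eventually_ge_atTop Λ).and ((tendsto_pow_atTop (α := ℝ) (n := q + 1)
    (by omega)).inv_tendsto_atTop.eventually_lt_const hτ)).exists

lemma HSp.val_zero_pow (d s q : ℕ) :
    ∀ᵐ x ∂(torusMeasure d), (0 : HSp d s).val x = (0 : HSp d (s + 2)).val x ^ (q + 1) := by
  rw [HSp.val_zero, HSp.val_zero]
  filter_upwards [Lp.coeFn_zero ℝ 2 (torusMeasure d)] with x hx
  rw [hx]
  simp

/-- A large constant control acting for a short time produces any displacement in `H`. -/
lemma Admissible.shiftable_of_mem (S : Admissible d s q ν A f h) {η : HSp d (s + 2)} (hη : η ∈ H) :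
    Shiftable ν f h H (HSp.incl (Nat.le_add_right s 2) η) := by
  intro v a ε τ hε hτ
  obtain ⟨ρ, hρ, Λ, hΛ, hex⟩ := S.exists_steers 0 hη (HSp.val_zero_pow d s q)
    (by rw [smul_zero, sub_zero]) v hε
  obtain ⟨lam, hl, hlτ⟩ := exists_ge_inv_pow_lt q Λ hτ
  obtain ⟨u₁, h₁, hu₁⟩ := hex lam hl a v (by simpa using hρ.le)
  simp only [map_zero, smul_zero, add_zero, sub_zero] at h₁ hu₁
  refine ⟨_, inv_pos.2 (pow_pos (by linarith) _), hlτ, u₁, h₁, ?_⟩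
  rwa [← sub_sub]

/-- If all multiples of `ζ` are available as displacements, then so is `-A ζ^(q+1)`: move by a large
multiple `lam ζ`, let the equation act without control for time `lam^{-(q+1)}`, and move back. -/
lemma Admissible.shiftable_pow (S : Admissible d s q ν A f h) {ζ : HSp d (s + 2)}
    (hζ : ∀ c : ℝ, Shiftable ν f h H (HSp.incl (Nat.le_add_right s 2) (c • ζ))) {Z : HSp d s}
    (hZ : ∀ᵐ x ∂(torusMeasure d), Z.val x = ζ.val x ^ (q + 1)) :
    Shiftable ν f h H (-(A • Z)) := by
  intro v a ε τ hε hτ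
  obtain ⟨ρ, hρ, Λ, hΛ, hex⟩ := S.exists_steers (W := -(A • Z)) ζ H.zero_mem hZ
    (by rw [map_zero, zero_sub]) v (half_pos hε)
  obtain ⟨lam, hl, hlτ⟩ := exists_ge_inv_pow_lt q Λ (τ := τ / 3) (by linarith)
  have hl0 : 0 < (lam ^ (q + 1))⁻¹ := inv_pos.2 (pow_pos (by linarith) _)
  simp only [map_smul] at hζ
  set z := HSp.incl (Nat.le_add_right s 2) ζ with hz
  obtain ⟨δ, hδ, hδτ, u₁, h₁, hu₁⟩ := hζ lam v a ρ (τ / 3) hρ (by linarith)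
  obtain ⟨u₂, h₂, hu₂⟩ := hex lam hl (a + δ) (u₁ - lam • z) (by
    rw [sub_sub, add_comm (lam • z)]
    exact hu₁.le)
  rw [sub_add_cancel] at h₂
  obtain ⟨δ', hδ', hδτ', u₃, h₃, hu₃⟩ :=
    hζ (-lam) u₂ (a + δ + (lam ^ (q + 1))⁻¹) (ε / 2) (τ / 3) (by linarith) (by linarith)
  refine ⟨δ + (lam ^ (q + 1))⁻¹ + δ', by linarith, by linarith, u₃, ?_, ?_⟩
  · rw [← add_assoc, ← add_assoc]
    exact (h₁.trans S (by linarith) (by linarith) h₂).trans S (by linarith) (by linarith) h₃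
  · have e : u₃ - (v + -(A • Z)) = (u₃ - (u₂ + -lam • z)) + (u₂ - lam • z - v - -(A • Z)) := by
      rw [neg_smul]
      abel
    rw [e]
    exact (norm_add_le _ _).trans_lt (by linarith)

/-- If the displacements in a space `V` are available, then so are `A` times the elements of the
cone over `V`. -/
lemma Admissible.shiftable_cone (S : Admissible d s q ν A f h) {V : Submodule ℝ (HSp d (s + 2))}
    (hV : ∀ ζ ∈ V, Shiftable ν f h H (HSp.incl (Nat.le_add_right s 2) ζ)) {w : HSp d s}
    (hw : w ∈ cone s (q + 1) V) : Shiftable ν f h H (A • w) := by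
  obtain ⟨n, -, η, hη, ζ, hζ, hw⟩ := hw
  choose Z hZ using fun m =>
    HSp.exists_pow S.dim_lt (HSp.incl (Nat.le_add_right s 2) (ζ m)) (q + 1)
  have hsum : ∀ I : Finset (Fin n), Shiftable ν f h H
      (HSp.incl (Nat.le_add_right s 2) (A • η) + ∑ m ∈ I, -(A • Z m)) := by
    intro I
    induction I using Finset.induction_on with
    | empty => simpa only [Finset.sum_empty, add_zero] using hV _ (V.smul_mem A hη)
    | insert m I hm ih =>
      rw [Finset.sum_insert hm, add_left_comm]
      exact (S.shiftable_pow (fun c => hV _ (V.smul_mem c (hζ m))) (hZ m)).add S ih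
  have e : A • w = HSp.incl (Nat.le_add_right s 2) (A • η) + ∑ m, -(A • Z m) := by
    have : w = HSp.incl (Nat.le_add_right s 2) η - ∑ m, Z m := by
      refine HSp.ext (Lp.ext ?_)
      have hs : (∑ m, Z m).val = ∑ m, (Z m).val := map_sum HSp.toL2 Z Finset.univ
      rw [HSp.val_sub, HSp.incl_val, hs]
      filter_upwards [hw, Lp.coeFn_sub η.val (∑ m, (Z m).val), ae_all_iff.2 hZ,
        Lp.coeFn_finsetSum Finset.univ fun m => (Z m).val] with x h1 h2 h3 h4
      rw [h2, Pi.sub_apply, h4, Finset.sum_apply]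
      simp only [h3]
      exact h1
    rw [this, smul_sub, map_smul, Finset.smul_sum, Finset.sum_neg_distrib, sub_eq_add_neg]
  rw [e]
  exact hsum _

/-- The spaces `H_j` consist of available displacements. The sign of `A` does not matter, because
each `H_j` is a vector space. -/
lemma Admissible.shiftable_iterSpace (S : Admissible d s q ν A f h) (hA : A ≠ 0) (j : ℕ) :
    ∀ ζ ∈ iterSpace s (q + 1) H j, Shiftable ν f h H (HSp.incl (Nat.le_add_right s 2) ζ) := by
  induction j with
  | zero => exact fun ζ hζ => S.shiftable_of_mem hζ
  | succ j ih =>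
    intro ζ hζ
    have h1 : A⁻¹ • ζ ∈ coneClosure s (q + 1) (iterSpace s (q + 1) H j) :=
      (nextSpace_isGreatest (Nat.succ_ne_zero q) _).1 (Submodule.smul_mem _ _ hζ)
    rw [mem_coneClosure] at h1
    have h2 : closure (cone s (q + 1) (iterSpace s (q + 1) H j)) ⊆
        (fun w : HSp d s => A • w) ⁻¹' {w | Shiftable ν f h H w} :=
      closure_minimal (fun w hw => S.shiftable_cone ih hw)
        (isClosed_shiftable.preimage (continuous_const_smul A))
    have h3 := h2 h1
    rwa [mem_preimage, map_smul, smul_inv_smul₀ hA] at h3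

/-- If `H` is saturating, every displacement in `H^s` is available. -/
lemma Admissible.shiftable (S : Admissible d s q ν A f h) (hA : A ≠ 0)
    (hH : Saturating s (q + 1) H) (w : HSp d s) : Shiftable ν f h H w := by
  have h1 : closure (⋃ j : ℕ, HSp.incl (Nat.le_add_right s 2) ''
      (iterSpace s (q + 1) H (j + 1) : Set (HSp d (s + 2)))) ⊆ {w | Shiftable ν f h H w} := by
    refine closure_minimal (iUnion_subset fun j => ?_) isClosed_shiftable
    rintro _ ⟨ζ, hζ, rfl⟩
    exact S.shiftable_iterSpace hA (j + 1) ζ hζ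
  exact h1 (hH w)

/-! ### Reaching the target at the prescribed time -/

/-- Without control, the solution stays near `u₁` for a short time if it starts close enough. -/
lemma Admissible.exists_coasting (S : Admissible d s q ν A f h) (H : Submodule ℝ (HSp d (s + 2)))
    (u₁ : HSp d s) {ε : ℝ} (hε : 0 < ε) :
    ∃ ρ : ℝ, 0 < ρ ∧ ∃ τ : ℝ, 0 < τ ∧ ∀ δ : ℝ, 0 < δ → δ ≤ τ → ∀ (a : ℝ) (v : HSp d s),
      ‖v - u₁‖ ≤ ρ → ∃ u₂, Steers ν f h H a (a + δ) v u₂ ∧ ‖u₂ - u₁‖ < ε := by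
  obtain ⟨ρ, hρ, Λ, hΛ, hex⟩ := S.exists_steers (W := 0) 0 H.zero_mem
    (HSp.val_zero_pow d s q) (by rw [map_zero, smul_zero, sub_zero]) u₁ hε
  refine ⟨ρ, hρ, (Λ ^ (q + 1))⁻¹, inv_pos.2 (pow_pos (by linarith) _), fun δ hδ hδτ a v hv => ?_⟩
  -- choose `lam` with `lam^{-(q+1)} = δ`
  set lam : ℝ := (δ⁻¹) ^ (((q + 1 : ℕ) : ℝ)⁻¹) with hlam
  have hl : lam ^ (q + 1) = δ⁻¹ := Real.rpow_inv_natCast_pow (inv_pos.2 hδ).le (by omega)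
  have hΛl : Λ ≤ lam := by
    refine le_of_pow_le_pow_left₀ (n := q + 1) (by omega) (Real.rpow_nonneg (inv_pos.2 hδ).le _) ?_
    rw [hl]
    exact (le_inv_comm₀ hδ (pow_pos (by linarith) _)).1 hδτ
  obtain ⟨u₂, h₂, hu₂⟩ := hex lam hΛl a v hv
  rw [hl, inv_inv] at h₂
  simp only [map_zero, smul_zero, add_zero, sub_zero] at h₂ hu₂
  exact ⟨u₂, h₂, hu₂⟩

/-- Moving to the target and coasting there alternate until the final time is reached. -/
lemma Admissible.exists_steers_near (S : Admissible d s q ν A f h) (hA : A ≠ 0)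
    (hH : Saturating s (q + 1) H) {a b : ℝ} (hab : a < b) (u₀ u₁ : HSp d s) {ε : ℝ} (hε : 0 < ε) :
    ∃ u₂, Steers ν f h H a b u₀ u₂ ∧ ‖u₂ - u₁‖ < ε := by
  obtain ⟨ρ, hρ, τ, hτ, hcoast⟩ := S.exists_coasting H u₁ hε
  have key : ∀ (n : ℕ) (a : ℝ) (u₀ : HSp d s), a < b → b - a ≤ n * τ →
      ∃ u₂, Steers ν f h H a b u₀ u₂ ∧ ‖u₂ - u₁‖ < ε := by
    intro n
    induction n with
    | zero =>
      intro a u₀ hab hn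
      rw [Nat.cast_zero, zero_mul] at hn
      linarith
    | succ n ih =>
      intro a u₀ hab hn
      push_cast at hn
      obtain ⟨δ, hδ, hδb, v, hv, hvu⟩ :=
        S.shiftable hA hH (u₁ - u₀) u₀ a ρ (b - a) hρ (by linarith)
      rw [add_sub_cancel] at hvu
      rcases le_or_gt (b - (a + δ)) τ with hle | hlt
      · obtain ⟨u₂, h₂, hu₂⟩ := hcoast (b - (a + δ)) (by linarith) hle (a + δ) v hvu.le
        rw [add_sub_cancel] at h₂
        exact ⟨u₂, hv.trans S (by linarith) (by linarith) h₂, hu₂⟩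
      · obtain ⟨v', hv', -⟩ := hcoast τ hτ le_rfl (a + δ) v hvu.le
        obtain ⟨u₂, h₂, hu₂⟩ := ih (a + δ + τ) v' (by linarith) (by linarith)
        exact ⟨u₂, (hv.trans S (by linarith) (by linarith) hv').trans S (by linarith) (by linarith)
          h₂, hu₂⟩
  -- every round but the last takes at least time `τ`
  obtain ⟨n, hn⟩ := exists_nat_ge ((b - a) / τ)
  exact key n a u₀ hab ((div_le_iff₀ hτ).1 hn)

end Control

/-! ### The nonlinearity `P + g` -/

/-- A polynomial of degree at most `q + 1` is Lipschitz with constant of order `q`. -/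
lemma exists_polynomial_lipschitz (P : Polynomial ℝ) {q : ℕ} (hP : P.natDegree ≤ q + 1) :
    ∃ L : ℝ, 0 ≤ L ∧ ∀ x y : ℝ, |P.eval x - P.eval y| ≤ L * (1 + |x| + |y|) ^ q * |x - y| := by
  refine ⟨∑ i ∈ Finset.range (q + 2), |P.coeff i| * i, by positivity, fun x y => ?_⟩
  have hM : 1 ≤ 1 + |x| + |y| := by linarith [abs_nonneg x, abs_nonneg y]
  have hmax : max |x| |y| ≤ 1 + |x| + |y| :=
    max_le (by linarith [abs_nonneg y]) (by linarith [abs_nonneg x])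
  rw [Polynomial.eval_eq_sum_range' (n := q + 2) (by omega),
    Polynomial.eval_eq_sum_range' (n := q + 2) (by omega), ← Finset.sum_sub_distrib,
    Finset.sum_mul, Finset.sum_mul]
  refine (Finset.abs_sum_le_sum_abs _ _).trans (Finset.sum_le_sum fun i hi => ?_)
  have hi' : i - 1 ≤ q := by
    have := Finset.mem_range.1 hi
    omega
  have h1 : max |x| |y| ^ (i - 1) ≤ (1 + |x| + |y|) ^ q :=
    (pow_le_pow_left₀ (le_max_of_le_left (abs_nonneg x)) hmax _).trans (pow_le_pow_right₀ hM hi')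
  rw [← mul_sub, abs_mul]
  calc |P.coeff i| * |x ^ i - y ^ i|
      ≤ |P.coeff i| * (|x - y| * i * max |x| |y| ^ (i - 1)) := by
        gcongr
        exact abs_pow_sub_pow_le x y i
    _ ≤ |P.coeff i| * (|x - y| * i * (1 + |x| + |y|) ^ q) := by gcongr
    _ = _ := by ring

/-- The polynomial dominates: either `g = 0`, or the order `s` of `g` acting on `H^s` is at most
the order `q` of the remainder. -/
lemma hasLeadingPart_polynomial_add {d s q : ℕ} (hs1 : 1 ≤ s) (hs : (d : ℝ) / 2 < s)
    {P : Polynomial ℝ} (hP : P.natDegree = q + 1) {g : ℝ → ℝ} (hg : BddSmooth g)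
    (hcond : (∀ y : ℝ, g y = 0) ∨ s ≤ q) :
    HasLeadingPart d s (fun y => P.eval y + g y) P.leadingCoeff q := by
  constructor
  · obtain ⟨L, hL0, hL⟩ := exists_polynomial_lipschitz P hP.le
    obtain ⟨C, hC0, hC⟩ := hg.lipschitz
    refine ⟨L + C, by positivity, fun x y => ?_⟩
    have h1 : 1 ≤ (1 + |x| + |y|) ^ q :=
      one_le_pow₀ (by linarith [abs_nonneg x, abs_nonneg y])
    calc |P.eval x + g x - (P.eval y + g y)| = |(P.eval x - P.eval y) + (g x - g y)| := by
          congr 1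
          ring
      _ ≤ |P.eval x - P.eval y| + |g x - g y| := abs_add_le _ _
      _ ≤ L * (1 + |x| + |y|) ^ q * |x - y| + C * |x - y| := add_le_add (hL x y) (hC x y)
      _ ≤ L * (1 + |x| + |y|) ^ q * |x - y| + C * (1 + |x| + |y|) ^ q * |x - y| := by
          gcongr
          exact le_mul_of_one_le_right hC0 h1
      _ = _ := by ring
  · intro ζ R
    have hp := Growth.polynomial hs (HSp.incl (Nat.le_add_right s 2) ζ) R P hP
    rcases hcond with h0 | hsq
    · exact hp.congr fun lam v => ae_of_all _ fun x => by simp only [h0, add_zero]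
    · exact (hp.add ((Growth.bddSmooth hs1 hs hg ζ R).mono hsq)).congr
        fun lam v => ae_of_all _ fun x => by ring

lemma SolvesOn.congr_forcing {d s : ℕ} {ν a b : ℝ} {f : ℝ → ℝ} {u₀ : HSp d s}
    {φ φ' : ℝ → HSp d (s - 1)} {u : ℝ → HSp d s} (hu : SolvesOn ν f a b u₀ φ u)
    (h : EqOn φ φ' (Icc a b)) : SolvesOn ν f a b u₀ φ' u := by
  refine ⟨hu.continuousOn, hu.memL2, hu.initial, fun k t ht => ?_⟩
  rw [hu.equation k t ht]
  congr 1
  refine intervalIntegral.integral_congr fun τ hτ => ?_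
  rw [uIcc_of_le ht.1] at hτ
  simp only [h ⟨hτ.1, hτ.2.trans ht.2⟩]

lemma isSolution_iff_solvesOn {d s : ℕ} {ν T : ℝ} {f : ℝ → ℝ} {u₀ : HSp d s}
    {φ : ℝ → HSp d (s - 1)} {u : ℝ → HSp d s} :
    IsSolution ν T f u₀ φ u ↔ SolvesOn ν f 0 T u₀ φ u :=
  ⟨fun h => ⟨h.continuousOn, h.memL2, h.initial, h.equation⟩,
    fun h => ⟨h.continuousOn, h.memL2, h.initial, h.equation⟩⟩

end TorusParabolic

end

theorem theorem2p3
    (d : ℕ) (hd : 1 ≤ d)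
    (s : ℕ) (hs : (d : ℝ) / 2 < (s : ℝ))
    (ν : ℝ) (hν : 0 < ν)
    (T : ℝ) (hT : 0 < T)
    (p : ℕ) (hp : 2 ≤ p)
    (P : Polynomial ℝ) (hP : P.natDegree = p)
    (g : ℝ → ℝ) (hg : ContDiff ℝ ∞ g)
    (hgb : ∀ n : ℕ, ∃ C : ℝ, ∀ y : ℝ, |iteratedDeriv n g y| ≤ C)
    (hcond : (∀ y : ℝ, g y = 0) ∨ s < p)
    (h : ℝ → TorusParabolic.HSp d (s - 1))
    (hh : MemLp h 2 (volume.restrict (Icc 0 T)))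
    (H : Submodule ℝ (TorusParabolic.HSp d (s + 2))) (hfin : FiniteDimensional ℝ H)
    (hsat : TorusParabolic.Saturating s p H) :
    TorusParabolic.ApproxControllable ν T (fun y => P.eval y + g y) h H := by
  have hs1 : 1 ≤ s := by
    have h1 : (0 : ℝ) < s := lt_of_le_of_lt (by positivity) hs
    exact_mod_cast h1
  obtain ⟨q, rfl⟩ : ∃ q, p = q + 1 := ⟨p - 1, by omega⟩
  have hA : P.leadingCoeff ≠ 0 := by
    rw [Polynomial.leadingCoeff_ne_zero]
    rintro rfl
    simp at hP
  have hf := TorusParabolic.hasLeadingPart_polynomial_add (d := d) hs1 hs hP ⟨hg, hgb⟩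
    (hcond.imp id (by omega))
  -- the forcing is extended by zero, so that the impulse lemma is uniform in the starting time
  have S : TorusParabolic.Admissible d s q ν P.leadingCoeff (fun y => P.eval y + g y)
      ((Icc 0 T).indicator h) :=
    ⟨hf, by omega, hs1, hs, hν, (memLp_indicator_iff_restrict measurableSet_Icc).2 hh⟩
  intro ε hε u₀ u₁
  obtain ⟨u₂, ⟨η, hη, u, hu, rfl⟩, hclose⟩ := S.exists_steers_near hA hsat hT u₀ u₁ hε
  have hu' := hu.congr_forcing (φ' := fun t => h t +
    TorusParabolic.HSp.incl (by omega) (η t : TorusParabolic.HSp d (s + 2))) fun t ht => by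
      simp only [indicator_of_mem ht]
  refine ⟨η, hη, u, TorusParabolic.isSolution_iff_solvesOn.2 hu', fun w hw => ?_, hclose⟩
  exact hu'.eqOn hf hs hν.le (TorusParabolic.memLp_forcing hh hη)
    (TorusParabolic.isSolution_iff_solvesOn.1 hw)
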